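/- Let $k$ be a commutative ring. DG $k$-modules are unbounded and cohomologically graded; $\mathsf{dgAlg}_k$ is the category of (associative, unital) DG $k$-algebras. In all the categories below, weak equivalences are the quasi-isomorphisms, fibrations are the degreewise surjections, and an object is cofibrant if the map to it from the initial object has the left lifting property against maps that are both. For DG $k$-algebras $R,S$: - $\mathsf{dgMod}^0_{R-S}$ is the category of pointed DG $R$-$S$-bimodules, i.e. DG bimodules $X$ (over $k$) with a morphism of DG $k$-modules $k\to X$; write $1\in X$ for the image of the unit. $X$ is *distinguished* if the map $S\to X$, $s\mapsto 1\cdot s$, is a quasi-isomorphism. - $\mathsf{dgAlg}_{R-S}$ is the category of DG $k$-algebras $A$ with morphisms of DG algebras $R\to A$ and $S\to A$. $A$ is *distinguished* if $S\to A$ is a quasi-isomorphism. - $F:\mathsf{dgMod}^0_{R-S}\to\mathsf{dgAlg}_{R-S}$ is the free functor: $F(X)$ is the quotient of the tensor algebra $T(X)=k\oplus X\oplus X\otimes_k X\oplus\cdots$ by the relations that identify the base point $1\in X$ with the unit, and $x\otimes 1\cdot s\sim x\cdot s$, $r\cdot 1\otimes x\sim r\cdot x$ ($x\in X$, $s\in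 S$, $r\in R$), with structure maps $s\mapsto 1\cdot s$ and $r\mapsto r\cdot 1$. An element $x\in S^0$ is *homotopy invertible* if it is a cocycle and there is a cocycle $y\in S^0$ such that $xy-1$ and $yx-1$ are coboundaries. **Lemma (Axiom III).** Let $R$ be a cofibrant DG $k$-algebra, and let $S$ be a DG $k$-algebra in which every homotopy invertible element is invertible. Then the total left derived functor $\mathbf{L}F:\mathrm{Ho}(\mathsf{dgMod}^0_{R-S})\to\mathrm{Ho}(\mathsf{dgAlg}_{R-S})$ exists and preserves distinguished objects (an object of a homotopy category being distinguished if it is isomorphic there to the image of a distinguished object). Moreover, $F$ sends every cofibrant distinguished object of $\mathsf{dgMod}^0_{R-S}$ to a cofibrant distinguished object of $\mathsf{dgAlg}_{R-S}$. -/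

import Mathlib

open CategoryTheory

universe u

noncomputable section

namespace DG

/-! ### Differential graded modules over a commutative ring (unbounded, cohomological grading) -/

/-- A DG `k`-module structure on `M`: an internal direct sum decomposition `M = ⨁ n : ℤ, Mⁿ`
and a differential of degree `+1`. -/
class DGModule (k M : Type u) [CommRing k] [AddCommGroup M] [Module k M] where
  gr : ℤ → Submodule k M
  isInternal : DirectSum.IsInternal gr
  d : M →ₗ[k] M
  d_mem : ∀ {n : ℤ} {x : M}, x ∈ gr n → d x ∈ gr (n + 1)
  d_d : ∀ x : M, d (d x) = 0

/-- The component of degree `n`. -/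
def gr (k : Type u) {M : Type u} [CommRing k] [AddCommGroup M] [Module k M] [DGModule k M]
    (n : ℤ) : Submodule k M := DGModule.gr n

/-- The differential. -/
def d (k : Type u) {M : Type u} [CommRing k] [AddCommGroup M] [Module k M] [DGModule k M] :
    M →ₗ[k] M := DGModule.d

/-- The sign `(-1)ⁿ`. -/
def sgn (n : ℤ) : ℤ := (n.negOnePow : ℤ)

section Module

variable (k : Type u) [CommRing k]
variable {M : Type u} [AddCommGroup M] [Module k M] [DGModule k M]
variable {N : Type u} [AddCommGroup N] [Module k N] [DGModule k N]

lemma d_mem {n : ℤ} {x : M} (hx : x ∈ gr k n) : d k x ∈ gr k (n + 1) := DGModule.d_mem hx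

lemma d_d (x : M) : d k (d k x) = 0 := DGModule.d_d x

/-- A morphism of DG `k`-modules: `k`-linear, of degree `0`, commuting with the differentials. -/
structure DGHom (k : Type u) [CommRing k] (M N : Type u) [AddCommGroup M] [Module k M]
    [DGModule k M] [AddCommGroup N] [Module k N] [DGModule k N] where
  toLinearMap : M →ₗ[k] N
  map_mem : ∀ {n : ℤ} {x : M}, x ∈ gr k n → toLinearMap x ∈ gr k n
  map_d : ∀ x : M, toLinearMap (d k x) = d k (toLinearMap x)

variable (M) in
/-- The `n`-cocycles. -/
def cocycles (n : ℤ) : Submodule k M := gr k n ⊓ LinearMap.ker (d k)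

variable (M) in
/-- The `n`-coboundaries. -/
def coboundaries (n : ℤ) : Submodule k M := (gr k (n - 1)).map (d k)

variable (M) in
/-- The `n`-th cohomology `Hⁿ(M)`. -/
abbrev H (n : ℤ) : Type u :=
  cocycles k M n ⧸ (coboundaries k M n).submoduleOf (cocycles k M n)

variable {k}

/-- The map induced on `n`-cocycles. -/
def DGHom.mapCocycles (f : DGHom k M N) (n : ℤ) : cocycles k M n →ₗ[k] cocycles k N n :=
  f.toLinearMap.restrict (fun x hx => ⟨f.map_mem hx.1, by
    have h : d k x = 0 := hx.2
    simp [← f.map_d, h]⟩)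

/-- The map `Hⁿ(f) : Hⁿ(M) → Hⁿ(N)`. -/
def DGHom.mapH (f : DGHom k M N) (n : ℤ) : H k M n →ₗ[k] H k N n :=
  Submodule.mapQ _ _ (f.mapCocycles n) (by
    rintro ⟨x, hx⟩ ⟨z, hz, hzx⟩
    exact ⟨f.toLinearMap z, f.map_mem hz, by
      rw [← f.map_d, hzx]; rfl⟩)

/-- Quasi-isomorphisms (the weak equivalences). -/
def DGHom.IsQuasiIso (f : DGHom k M N) : Prop := ∀ n : ℤ, Function.Bijective (f.mapH n)

end Module

/-! ### Linear algebra of gradings -/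

section Graded

variable (k : Type u) [CommRing k]
variable {M : Type u} [AddCommGroup M] [Module k M] [DGModule k M]

variable (M) in
lemma bijective_coe : Function.Bijective (DirectSum.coeLinearMap (gr k (M := M))) :=
  DGModule.isInternal (k := k) (M := M)

/-- The linear map on `M = ⨁ Mⁿ` with prescribed restrictions to the components. -/
def gradedLift {P : Type u} [AddCommGroup P] [Module k P] (φ : ℤ → M →ₗ[k] P) : M →ₗ[k] P :=
  (DirectSum.toModule k ℤ P (fun n => (φ n).comp (gr k n).subtype)).comp
    (LinearEquiv.ofBijective (DirectSum.coeLinearMap (gr k (M := M)))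
      (bijective_coe k M)).symm.toLinearMap

lemma gradedLift_apply {P : Type u} [AddCommGroup P] [Module k P] (φ : ℤ → M →ₗ[k] P)
    {n : ℤ} {x : M} (hx : x ∈ gr k n) : gradedLift k φ x = φ n x := by
  have h : (LinearEquiv.ofBijective (DirectSum.coeLinearMap (gr k (M := M)))
      (bijective_coe k M)).symm x =
        DirectSum.lof k ℤ (fun n => gr k (M := M) n) n ⟨x, hx⟩ := by
    rw [LinearEquiv.symm_apply_eq]
    exact (DirectSum.coeLinearMap_lof (gr k (M := M)) n ⟨x, hx⟩).symm
  simp [gradedLift, h]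

lemma homogeneous_induction {P : M → Prop} (x : M) (zero : P 0)
    (add : ∀ x y, P x → P y → P (x + y)) (hom : ∀ (n : ℤ) (x : M), x ∈ gr k n → P x) : P x := by
  have hx : x ∈ ⨆ n, gr k (M := M) n := by
    have := (DGModule.isInternal (k := k) (M := M)).submodule_iSup_eq_top
    exact this ▸ Submodule.mem_top
  exact Submodule.iSup_induction (gr k (M := M)) (motive := P) hx hom zero add

variable (M) in
/-- The grading involution `x ↦ (-1)^|x| x`. -/
def gradingSign : M →ₗ[k] M := gradedLift k (fun n => sgn n • LinearMap.id)

lemma gradingSign_apply {n : ℤ} {x : M} (hx : x ∈ gr k n) : gradingSign k M x = sgn n • x := by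
  simp [gradingSign, gradedLift_apply k _ hx]

end Graded

lemma sgn_add (m n : ℤ) : sgn (m + n) = sgn m * sgn n := by
  simp [sgn, Int.negOnePow_add]

lemma sgn_zero : sgn 0 = 1 := by simp [sgn]

lemma sgn_succ (n : ℤ) : sgn (n + 1) = - sgn n := by simp [sgn, Int.negOnePow_succ]

lemma sgn_mul_self (n : ℤ) : sgn n * sgn n = 1 := by
  rcases Int.units_eq_one_or n.negOnePow with h | h <;> simp [sgn, h]

/-! ### Differential graded algebras -/

/-- DG `k`-algebras: monoids in DG `k`-modules. -/
structure DGAlg (k : Type u) [CommRing k] where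
  carrier : Type u
  [ring : Ring carrier]
  [algebra : Algebra k carrier]
  [dg : DGModule k carrier]
  one_mem : (1 : carrier) ∈ gr k 0
  mul_mem : ∀ {p q : ℤ} {a b : carrier}, a ∈ gr k p → b ∈ gr k q → a * b ∈ gr k (p + q)
  leibniz : ∀ {p : ℤ} {a : carrier} (b : carrier), a ∈ gr k p →
    d k (a * b) = d k a * b + sgn p • (a * d k b)

attribute [instance] DGAlg.ring DGAlg.algebra DGAlg.dg

instance (k : Type u) [CommRing k] : CoeSort (DGAlg k) (Type u) := ⟨DGAlg.carrier⟩

section Alg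

variable {k : Type u} [CommRing k]

/-- Morphisms of DG `k`-algebras. -/
@[ext]
structure DGAlg.Hom (A B : DGAlg k) where
  toAlgHom : A →ₐ[k] B
  map_mem : ∀ {n : ℤ} {x : A}, x ∈ gr k n → toAlgHom x ∈ gr k n
  map_d : ∀ x : A, toAlgHom (d k x) = d k (toAlgHom x)

/-- The category `dgAlg_k`. -/
instance : Category (DGAlg k) where
  Hom A B := DGAlg.Hom A B
  id A := ⟨AlgHom.id k A, fun h => h, fun _ => rfl⟩
  comp f g := ⟨g.toAlgHom.comp f.toAlgHom, fun h => g.map_mem (f.map_mem h),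
    fun x => by simp [f.map_d, g.map_d]⟩

/-- The underlying map of DG `k`-modules. -/
def DGAlg.Hom.toDGHom {A B : DGAlg k} (f : DGAlg.Hom A B) : DGHom k A B :=
  ⟨f.toAlgHom.toLinearMap, f.map_mem, f.map_d⟩

variable (k) in
/-- Quasi-isomorphisms in `dgAlg_k`. -/
def DGAlg.quasiIso : MorphismProperty (DGAlg k) :=
  fun _ _ f => (DGAlg.Hom.toDGHom f).IsQuasiIso

variable (k) in
/-- Fibrations in `dgAlg_k`: (degreewise) surjections. -/
def DGAlg.fibration : MorphismProperty (DGAlg k) :=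
  fun _ _ f => Function.Surjective (DGAlg.Hom.toAlgHom f)

end Alg

/-- An object `X` is cofibrant, with respect to given classes `W` of weak equivalences and `Fib` of
fibrations, if the map from the initial object to `X` has the left lifting property against all
trivial fibrations. -/
def IsCofibrant {C : Type*} [Category C] (W Fib : MorphismProperty C) (X : C) : Prop :=
  ∀ ⦃A B : C⦄ (p : A ⟶ B), W p → Fib p → ∀ f : X ⟶ B, ∃ g : X ⟶ A, g ≫ p = f

/-- Cofibrant DG algebras. -/
def DGAlg.Cofibrant {k : Type u} [CommRing k] (R : DGAlg k) : Prop :=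
  IsCofibrant (DGAlg.quasiIso k) (DGAlg.fibration k) R

/-- `x` is homotopy invertible: a degree `0` cocycle having an inverse up to coboundaries which is
itself a degree `0` cocycle. -/
def HomotopyInvertible {k : Type u} [CommRing k] {S : DGAlg k} (x : S) : Prop :=
  x ∈ cocycles k S 0 ∧ ∃ y ∈ cocycles k S 0,
    x * y - 1 ∈ coboundaries k S 0 ∧ y * x - 1 ∈ coboundaries k S 0

/-! ### DG algebras under `R` and `S` -/

/-- Objects of `dgAlg_{R-S}`: DG algebras with morphisms from `R` and from `S`. -/
structure AlgUnder {k : Type u} [CommRing k] (R S : DGAlg k) where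
  alg : DGAlg k
  fromR : R ⟶ alg
  fromS : S ⟶ alg

section AlgUnder

variable {k : Type u} [CommRing k] {R S : DGAlg k}

/-- Morphisms of `dgAlg_{R-S}`. -/
@[ext]
structure AlgUnder.Hom (A B : AlgUnder R S) where
  hom : A.alg ⟶ B.alg
  fromR_hom : A.fromR ≫ hom = B.fromR
  fromS_hom : A.fromS ≫ hom = B.fromS

/-- The category `dgAlg_{R-S}`. -/
instance : Category (AlgUnder R S) where
  Hom A B := AlgUnder.Hom A B
  id A := ⟨𝟙 _, Category.comp_id _, Category.comp_id _⟩
  comp f g := ⟨f.hom ≫ g.hom,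
    by rw [← Category.assoc, f.fromR_hom, g.fromR_hom],
    by rw [← Category.assoc, f.fromS_hom, g.fromS_hom]⟩

variable (R S) in
/-- Weak equivalences in `dgAlg_{R-S}`. -/
def AlgUnder.quasiIso : MorphismProperty (AlgUnder R S) :=
  fun _ _ f => DGAlg.quasiIso k (AlgUnder.Hom.hom f)

variable (R S) in
/-- Fibrations in `dgAlg_{R-S}`. -/
def AlgUnder.fibration : MorphismProperty (AlgUnder R S) :=
  fun _ _ f => DGAlg.fibration k (AlgUnder.Hom.hom f)

/-- Cofibrant objects of `dgAlg_{R-S}`. -/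
def AlgUnder.Cofibrant (A : AlgUnder R S) : Prop :=
  IsCofibrant (AlgUnder.quasiIso R S) (AlgUnder.fibration R S) A

variable (R S) in
/-- Distinguished objects of `dgAlg_{R-S}`: the map `S → A` (which is `s ↦ 1 · s`) is a weak
equivalence. -/
def AlgUnder.distinguished : ObjectProperty (AlgUnder R S) :=
  fun A => DGAlg.quasiIso k A.fromS

end AlgUnder

/-! ### Pointed DG bimodules -/

/-- Objects of `dgMod⁰_{R-S}`: DG `R`-`S`-bimodules `X` (over `k`) with a morphism of DG
`k`-modules `k → X`, that is, a cocycle `pt` (the image of `1`) of degree `0`.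
The right action `x · s` is `MulOpposite.op s • x`. -/
structure PtBimod {k : Type u} [CommRing k] (R S : DGAlg k) where
  carrier : Type u
  [addCommGroup : AddCommGroup carrier]
  [module : Module k carrier]
  [leftModule : Module R carrier]
  [rightModule : Module (S.carrier)ᵐᵒᵖ carrier]
  [leftTower : IsScalarTower k R carrier]
  [rightTower : IsScalarTower k (S.carrier)ᵐᵒᵖ carrier]
  [comm : SMulCommClass R (S.carrier)ᵐᵒᵖ carrier]
  [dg : DGModule k carrier]
  lsmul_mem : ∀ {p q : ℤ} {r : R} {x : carrier}, r ∈ gr k p → x ∈ gr k q → r • x ∈ gr k (p + q)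
  rsmul_mem : ∀ {p q : ℤ} {x : carrier} {s : S}, x ∈ gr k p → s ∈ gr k q →
    MulOpposite.op s • x ∈ gr k (p + q)
  d_lsmul : ∀ {p : ℤ} {r : R} (x : carrier), r ∈ gr k p →
    d k (r • x) = d k r • x + sgn p • (r • d k x)
  d_rsmul : ∀ {p : ℤ} {x : carrier} (s : S), x ∈ gr k p →
    d k (MulOpposite.op s • x) =
      MulOpposite.op s • d k x + sgn p • (MulOpposite.op (d k s) • x)
  pt : carrier
  pt_mem : pt ∈ gr k 0
  d_pt : d k pt = 0

attribute [instance] PtBimod.addCommGroup PtBimod.module PtBimod.leftModule PtBimod.rightModule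
  PtBimod.leftTower PtBimod.rightTower PtBimod.comm PtBimod.dg

instance {k : Type u} [CommRing k] (R S : DGAlg k) : CoeSort (PtBimod R S) (Type u) :=
  ⟨PtBimod.carrier⟩

section PtBimod

variable {k : Type u} [CommRing k] {R S : DGAlg k}

/-- The right multiplication `x · s`. -/
def PtBimod.rmul {X : PtBimod R S} (x : X) (s : S) : X := MulOpposite.op s • x

/-- Morphisms of pointed DG bimodules. -/
@[ext]
structure PtBimod.Hom (X Y : PtBimod R S) where
  toLinearMap : X →ₗ[k] Y
  map_lsmul : ∀ (r : R) (x : X), toLinearMap (r • x) = r • toLinearMap x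
  map_rmul : ∀ (x : X) (s : S), toLinearMap (PtBimod.rmul x s) = PtBimod.rmul (toLinearMap x) s
  map_mem : ∀ {n : ℤ} {x : X}, x ∈ gr k n → toLinearMap x ∈ gr k n
  map_d : ∀ x : X, toLinearMap (d k x) = d k (toLinearMap x)
  map_pt : toLinearMap X.pt = Y.pt

/-- The category `dgMod⁰_{R-S}`. -/
instance : Category (PtBimod R S) where
  Hom X Y := PtBimod.Hom X Y
  id X := ⟨LinearMap.id, fun _ _ => rfl, fun _ _ => rfl, fun h => h, fun _ => rfl, rfl⟩
  comp f g := ⟨g.toLinearMap.comp f.toLinearMap, fun r x => by simp [f.map_lsmul, g.map_lsmul],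
    fun x s => by simp [f.map_rmul, g.map_rmul], fun h => g.map_mem (f.map_mem h),
    fun x => by simp [f.map_d, g.map_d], by simp [f.map_pt, g.map_pt]⟩

/-- The underlying map of DG `k`-modules. -/
def PtBimod.Hom.toDGHom {X Y : PtBimod R S} (f : PtBimod.Hom X Y) : DGHom k X Y :=
  ⟨f.toLinearMap, f.map_mem, f.map_d⟩

variable (R S) in
/-- Weak equivalences in `dgMod⁰_{R-S}`. -/
def PtBimod.quasiIso : MorphismProperty (PtBimod R S) :=
  fun _ _ f => (PtBimod.Hom.toDGHom f).IsQuasiIso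

variable (R S) in
/-- Fibrations in `dgMod⁰_{R-S}`: (degreewise) surjections. -/
def PtBimod.fibration : MorphismProperty (PtBimod R S) :=
  fun _ _ f => Function.Surjective (PtBimod.Hom.toLinearMap f)

/-- Cofibrant objects of `dgMod⁰_{R-S}`. -/
def PtBimod.Cofibrant (X : PtBimod R S) : Prop :=
  IsCofibrant (PtBimod.quasiIso R S) (PtBimod.fibration R S) X

lemma PtBimod.rmul_mem {X : PtBimod R S} {p q : ℤ} {x : X} {s : S} (hx : x ∈ gr k p)
    (hs : s ∈ gr k q) : PtBimod.rmul x s ∈ gr k (p + q) := X.rsmul_mem hx hs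

lemma PtBimod.d_rmul {X : PtBimod R S} {p : ℤ} {x : X} (s : S) (hx : x ∈ gr k p) :
    d k (PtBimod.rmul x s) = PtBimod.rmul (d k x) s + sgn p • PtBimod.rmul x (d k s) :=
  X.d_rsmul s hx

variable (X : PtBimod R S)

/-- Right multiplication as a bilinear map. -/
def PtBimod.rmulHom : X →ₗ[k] S →ₗ[k] X :=
  LinearMap.mk₂ k PtBimod.rmul
    (fun x y s => smul_add _ x y)
    (fun c x s => by
      unfold PtBimod.rmul
      rw [← algebraMap_smul (S.carrier)ᵐᵒᵖ c x, ← algebraMap_smul (S.carrier)ᵐᵒᵖ c, smul_smul,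
        smul_smul, Algebra.commutes])
    (fun x s t => by simp [PtBimod.rmul, add_smul])
    (fun c x s => by simp [PtBimod.rmul])

/-- Left multiplication as a bilinear map. -/
def PtBimod.lmulHom : R →ₗ[k] X →ₗ[k] X :=
  LinearMap.mk₂ k (fun (r : R) (x : X) => r • x)
    (fun r r' x => add_smul r r' x)
    (fun c r x => smul_assoc c r x)
    (fun r x y => smul_add r x y)
    (fun c r x => by
      rw [← algebraMap_smul R c x, ← algebraMap_smul R c, smul_smul,
        smul_smul, Algebra.commutes])

lemma PtBimod.rmulHom_apply (x : X) (s : S) : X.rmulHom x s = PtBimod.rmul x s := rfl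

lemma PtBimod.lmulHom_apply (r : R) (x : X) : X.lmulHom r x = r • x := rfl

/-- The map of right DG `S`-modules `S ≅ k ⊗ S → X`, `s ↦ 1 · s`, induced by the point. -/
def PtBimod.fromS : DGHom k S X where
  toLinearMap := X.rmulHom X.pt
  map_mem := fun {n} x hx => by
    have h := PtBimod.rmul_mem X.pt_mem hx
    rwa [zero_add] at h
  map_d := fun s => by
    have h := PtBimod.d_rmul s X.pt_mem
    rw [PtBimod.rmulHom_apply, PtBimod.rmulHom_apply, h, X.d_pt, sgn_zero, one_smul]
    simp [PtBimod.rmul]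

variable (R S) in
/-- Distinguished objects of `dgMod⁰_{R-S}`. -/
def PtBimod.distinguished : ObjectProperty (PtBimod R S) :=
  fun X => X.fromS.IsQuasiIso

end PtBimod

/-! ### The functor `F : dgMod⁰_{R-S} ⥤ dgAlg_{R-S}` -/

section F

variable {k : Type u} [CommRing k] {R S : DGAlg k} (X : PtBimod R S)

/-- The relations imposed on the tensor algebra `T(X) = k ⊕ X ⊕ X ⊗ X ⊕ ⋯`: the base point of `X`
is the unit, `x ⊗ 1·s = x·s` and `r·1 ⊗ x = r·x`. -/
inductive FRel : TensorAlgebra k X → TensorAlgebra k X → Prop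
  | pt : FRel (TensorAlgebra.ι k X.pt) 1
  | right (x : X) (s : S) : FRel
      (TensorAlgebra.ι k x * TensorAlgebra.ι k (PtBimod.rmul X.pt s))
      (TensorAlgebra.ι k (PtBimod.rmul x s))
  | left (r : R) (x : X) : FRel
      (TensorAlgebra.ι k (r • X.pt) * TensorAlgebra.ι k x)
      (TensorAlgebra.ι k (r • x))

/-- The underlying algebra of `F(X)`: the quotient of the tensor algebra of `X` over `k` by the
two-sided ideal generated by the relations. -/
def FCarrier : Type u := RingQuot (FRel X)

instance : Ring (FCarrier X) := inferInstanceAs (Ring (RingQuot (FRel X)))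

instance : Algebra k (FCarrier X) := inferInstanceAs (Algebra k (RingQuot (FRel X)))

/-- The projection `T(X) → F(X)`. -/
def Fmk : TensorAlgebra k X →ₐ[k] FCarrier X := RingQuot.mkAlgHom k (FRel X)

lemma Fmk_surjective : Function.Surjective (Fmk X) := RingQuot.mkAlgHom_surjective k (FRel X)

lemma Fmk_rel {a b : TensorAlgebra k X} (h : FRel X a b) : Fmk X a = Fmk X b :=
  RingQuot.mkAlgHom_rel k h

/-- The canonical map `X → F(X)`. -/
def Fι : X →ₗ[k] FCarrier X :=
  (Fmk X).toLinearMap.comp (TensorAlgebra.ι k)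

lemma Fι_apply (x : X) : Fι X x = Fmk X (TensorAlgebra.ι k x) := rfl

lemma Fι_pt : Fι X X.pt = 1 := by
  rw [Fι_apply, Fmk_rel X FRel.pt, map_one]

lemma Fι_right (x : X) (s : S) :
    Fι X x * Fι X (PtBimod.rmul X.pt s) = Fι X (PtBimod.rmul x s) := by
  rw [Fι_apply, Fι_apply, Fι_apply, ← map_mul, Fmk_rel X (FRel.right x s)]

lemma Fι_left (r : R) (x : X) : Fι X (r • X.pt) * Fι X x = Fι X (r • x) := by
  rw [Fι_apply, Fι_apply, Fι_apply, ← map_mul, Fmk_rel X (FRel.left r x)]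

/-- Algebra maps out of `F(X)`. -/
def Flift {B : Type u} [Semiring B] [Algebra k B] (f : X →ₗ[k] B) (h1 : f X.pt = 1)
    (h2 : ∀ (x : X) (s : S), f x * f (PtBimod.rmul X.pt s) = f (PtBimod.rmul x s))
    (h3 : ∀ (r : R) (x : X), f (r • X.pt) * f x = f (r • x)) : FCarrier X →ₐ[k] B :=
  RingQuot.liftAlgHom k ⟨TensorAlgebra.lift k f, by
    intro a b h
    cases h with
    | pt => simpa using h1
    | right x s => simpa using h2 x s
    | left r x => simpa using h3 r x⟩

lemma Flift_ι {B : Type u} [Semiring B] [Algebra k B] (f : X →ₗ[k] B) (h1 : f X.pt = 1)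
    (h2 : ∀ (x : X) (s : S), f x * f (PtBimod.rmul X.pt s) = f (PtBimod.rmul x s))
    (h3 : ∀ (r : R) (x : X), f (r • X.pt) * f x = f (r • x)) (x : X) :
    Flift X f h1 h2 h3 (Fι X x) = f x := by
  refine Eq.trans (RingQuot.liftAlgHom_mkAlgHom_apply k _ _ _) ?_
  rw [TensorAlgebra.lift_ι_apply]

variable {X} in
lemma Fhom_ext {B : Type u} [Semiring B] [Algebra k B] {f g : FCarrier X →ₐ[k] B}
    (h : ∀ x, f (Fι X x) = g (Fι X x)) : f = g := by
  refine RingQuot.ringQuot_ext' k f g (TensorAlgebra.hom_ext ?_)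
  ext x
  exact h x

/-- Homogeneous monomials `x₁ ⊗ ⋯ ⊗ xₘ` of total degree `n`. -/
inductive FMonomial : ℤ → FCarrier X → Prop
  | one : FMonomial 0 1
  | cons {p n : ℤ} {x : X} {a : FCarrier X} : x ∈ gr k p → FMonomial n a →
      FMonomial (p + n) (Fι X x * a)

/-- The grading of `F(X)` by total degree. -/
def Fgr (n : ℤ) : Submodule k (FCarrier X) := Submodule.span k {a | FMonomial X n a}

lemma Fone_mem : (1 : FCarrier X) ∈ Fgr X 0 := Submodule.subset_span FMonomial.one

variable {X}

lemma FMonomial.mul {m n : ℤ} {a b : FCarrier X} (ha : FMonomial X m a) (hb : FMonomial X n b) :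
    FMonomial X (m + n) (a * b) := by
  induction ha with
  | one => simpa using hb
  | cons hx _ ih => rw [mul_assoc, add_assoc]; exact FMonomial.cons hx ih

lemma Fmul_mem {m n : ℤ} {a b : FCarrier X} (ha : a ∈ Fgr X m) (hb : b ∈ Fgr X n) :
    a * b ∈ Fgr X (m + n) := by
  have h : Fgr X m * Fgr X n ≤ Fgr X (m + n) := by
    unfold Fgr
    rw [Submodule.span_mul_span]
    apply Submodule.span_mono
    rintro _ ⟨a, ha, b, hb, rfl⟩
    exact ha.mul hb
  exact h (Submodule.mul_mem_mul ha hb)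

lemma Fι_mem {n : ℤ} {x : X} (hx : x ∈ gr k n) : Fι X x ∈ Fgr X n := by
  have h := FMonomial.cons hx (FMonomial.one (X := X))
  rw [mul_one, add_zero] at h
  exact Submodule.subset_span h

lemma F_iSup : ⨆ n, Fgr X n = ⊤ := by
  have hmul : ∀ a b : FCarrier X, a ∈ ⨆ n, Fgr X n → b ∈ ⨆ n, Fgr X n →
      a * b ∈ ⨆ n, Fgr X n := by
    intro a b ha hb
    have h : (⨆ n, Fgr X n) * (⨆ n, Fgr X n) ≤ ⨆ n, Fgr X n := by
      rw [Submodule.iSup_mul]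
      refine iSup_le fun m => ?_
      rw [Submodule.mul_iSup]
      refine iSup_le fun n => ?_
      refine le_trans ?_ (le_iSup (Fgr X) (m + n))
      rw [Submodule.mul_le]
      exact fun a ha b hb => Fmul_mem ha hb
    exact h (Submodule.mul_mem_mul ha hb)
  let P : Subalgebra k (FCarrier X) :=
    { (⨆ n, Fgr X n : Submodule k (FCarrier X)) with
      mul_mem' := fun {a b} ha hb => hmul a b ha hb
      algebraMap_mem' := fun r => by
        rw [Algebra.algebraMap_eq_smul_one]
        exact Submodule.smul_mem _ _ (Submodule.mem_iSup_of_mem 0 (Fone_mem X)) }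
  have hx : ∀ x : X, Fι X x ∈ P := fun x => by
    refine homogeneous_induction (P := fun x => Fι X x ∈ P) k x ?_ (fun x y hx hy => ?_)
      (fun n x hx => ?_)
    · rw [map_zero]; exact P.zero_mem
    · rw [map_add]; exact P.add_mem hx hy
    · exact Submodule.mem_iSup_of_mem n (Fι_mem hx)
  rw [eq_top_iff]
  intro a _
  obtain ⟨t, rfl⟩ := Fmk_surjective X a
  change _ ∈ P
  induction t using TensorAlgebra.induction with
  | algebraMap r => rw [AlgHom.commutes]; exact P.algebraMap_mem r
  | ι x => exact hx x
  | mul a b ha hb => rw [map_mul]; exact P.mul_mem (ha trivial) (hb trivial)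
  | add a b ha hb => rw [map_add]; exact P.add_mem (ha trivial) (hb trivial)

lemma F_induction {P : FCarrier X → Prop} (a : FCarrier X) (zero : P 0)
    (add : ∀ a b, P a → P b → P (a + b)) (smul : ∀ (c : k) a, P a → P (c • a))
    (mon : ∀ n a, FMonomial X n a → P a) : P a := by
  have ha : a ∈ ⨆ n, Fgr X n := by rw [F_iSup]; exact Submodule.mem_top
  refine Submodule.iSup_induction (Fgr X) (motive := P) ha (fun n x hx => ?_) zero add
  exact Submodule.span_induction (fun x hx => mon n x hx) zero (fun x y _ _ => add x y)
    (fun c x _ => smul c x) hx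

lemma Frel_right {B : Type u} [Semiring B] [Algebra k B] (f : X →ₗ[k] B)
    (h : ∀ (p q : ℤ) (x : X) (s : S), x ∈ gr k p → s ∈ gr k q →
      f x * f (PtBimod.rmul X.pt s) = f (PtBimod.rmul x s)) (x : X) (s : S) :
    f x * f (PtBimod.rmul X.pt s) = f (PtBimod.rmul x s) := by
  rw [← PtBimod.rmulHom_apply, ← PtBimod.rmulHom_apply]
  refine homogeneous_induction (P := fun x => f x * f (X.rmulHom X.pt s) = f (X.rmulHom x s)) k x ?_
    (fun x y hx hy => ?_) (fun p x hx => ?_)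
  · simp
  · simp only [map_add, LinearMap.add_apply, add_mul, hx, hy]
  · refine homogeneous_induction (P := fun s => f x * f (X.rmulHom X.pt s) = f (X.rmulHom x s)) k s ?_
      (fun s t hs ht => ?_) (fun q s hs => ?_)
    · simp
    · simp only [map_add, mul_add, hs, ht]
    · exact h p q x s hx hs

lemma Frel_left {B : Type u} [Semiring B] [Algebra k B] (f : X →ₗ[k] B)
    (h : ∀ (p q : ℤ) (r : R) (x : X), r ∈ gr k p → x ∈ gr k q →
      f (r • X.pt) * f x = f (r • x)) (r : R) (x : X) :
    f (r • X.pt) * f x = f (r • x) := by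
  rw [← PtBimod.lmulHom_apply, ← PtBimod.lmulHom_apply]
  refine homogeneous_induction (P := fun x => f (X.lmulHom r X.pt) * f x = f (X.lmulHom r x)) k x ?_
    (fun x y hx hy => ?_) (fun q x hx => ?_)
  · simp
  · simp only [map_add, mul_add, hx, hy]
  · refine homogeneous_induction (P := fun r => f (X.lmulHom r X.pt) * f x = f (X.lmulHom r x)) k r ?_
      (fun s t hs ht => ?_) (fun p r hr => ?_)
    · simp
    · simp only [map_add, LinearMap.add_apply, add_mul, hs, ht]
    · exact h p q r x hr hx

variable (X) in
/-- The linear map `X → F(X)[t, t⁻¹]`, `x ↦ x t^|x|`. -/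
def FspreadLin : X →ₗ[k] AddMonoidAlgebra (FCarrier X) ℤ :=
  gradedLift k fun n =>
    { toFun := fun x => AddMonoidAlgebra.single n (Fι X x)
      map_add' := fun x y => by rw [map_add, AddMonoidAlgebra.single_add]
      map_smul' := fun c x => by
        rw [map_smul, RingHom.id_apply, AddMonoidAlgebra.smul_single] }

lemma FspreadLin_apply {n : ℤ} {x : X} (hx : x ∈ gr k n) :
    FspreadLin X x = AddMonoidAlgebra.single n (Fι X x) := by
  rw [FspreadLin, gradedLift_apply k _ hx]; rfl

variable (X) in
/-- The algebra map `F(X) → F(X)[t, t⁻¹]` which detects the grading. -/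
def Fspread : FCarrier X →ₐ[k] AddMonoidAlgebra (FCarrier X) ℤ :=
  Flift X (FspreadLin X)
    ((FspreadLin_apply X.pt_mem).trans (by rw [Fι_pt, AddMonoidAlgebra.one_def]))
    (Frel_right (FspreadLin X) fun p q x s hx hs => by
      rw [FspreadLin_apply hx, FspreadLin_apply (PtBimod.rmul_mem X.pt_mem hs),
        FspreadLin_apply (PtBimod.rmul_mem hx hs), AddMonoidAlgebra.single_mul_single,
        Fι_right, zero_add])
    (Frel_left (FspreadLin X) fun p q r x hr hx => by
      rw [FspreadLin_apply hx, FspreadLin_apply (X.lsmul_mem hr X.pt_mem),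
        FspreadLin_apply (X.lsmul_mem hr hx), AddMonoidAlgebra.single_mul_single,
        Fι_left, add_zero])

lemma Fspread_apply {n : ℤ} {a : FCarrier X} (ha : a ∈ Fgr X n) :
    Fspread X a = AddMonoidAlgebra.single n a := by
  unfold Fgr at ha
  induction ha using Submodule.span_induction with
  | mem a ha =>
    induction ha with
    | one => rw [map_one]; rfl
    | cons hx _ ih =>
      rw [map_mul, ih, Fspread, Flift_ι, FspreadLin_apply hx, AddMonoidAlgebra.single_mul_single]
  | zero => simp
  | add a b _ _ ha hb => rw [map_add, ha, hb, AddMonoidAlgebra.single_add]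
  | smul c a _ ha => rw [map_smul, ha, AddMonoidAlgebra.smul_single]

variable (X) in
lemma F_isInternal : DirectSum.IsInternal (Fgr X) := by
  have key : ∀ (w : DirectSum ℤ (fun n => Fgr X n)) (n : ℤ),
      (Fspread X (DirectSum.coeAddMonoidHom (Fgr X) w)).coeff n = (w n : FCarrier X) := by
    intro w n
    induction w using DirectSum.induction_on with
    | zero => simp
    | of m x =>
      rw [DirectSum.coeAddMonoidHom_of, Fspread_apply x.2, AddMonoidAlgebra.coeff_single]
      by_cases h : m = n
      · subst h; simp
      · rw [DirectSum.of_eq_of_ne _ _ _ (Ne.symm h), Finsupp.single_eq_of_ne (Ne.symm h)]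
        rfl
    | add v w hv hw => simp [hv, hw]
  constructor
  · intro v w hvw
    refine DFinsupp.ext fun n => Subtype.ext ?_
    rw [← key v n, ← key w n, hvw]
  · intro a
    have ha : a ∈ ⨆ n, Fgr X n := by rw [F_iSup]; exact Submodule.mem_top
    rw [Submodule.iSup_eq_range_dfinsupp_lsum] at ha
    obtain ⟨w, hw⟩ := ha
    exact ⟨w, hw⟩

variable (X) in
/-- The matrices `[[(-1)^|x| x, dx], [0, x]]`: their products encode the signed Leibniz rule. -/
def FmatLin : X →ₗ[k] Matrix (Fin 2) (Fin 2) (FCarrier X) where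
  toFun x := !![Fι X (gradingSign k X x), Fι X (d k x); 0, Fι X x]
  map_add' x y := by ext i j; fin_cases i <;> fin_cases j <;> simp
  map_smul' c x := by ext i j; fin_cases i <;> fin_cases j <;> simp

lemma FmatLin_apply {n : ℤ} {x : X} (hx : x ∈ gr k n) :
    FmatLin X x = !![sgn n • Fι X x, Fι X (d k x); 0, Fι X x] := by
  change !![_, _; _, _] = _
  rw [gradingSign_apply k hx, map_zsmul]

variable (X) in
/-- The algebra map with `x ↦ [[(-1)^|x| x, dx], [0, x]]`. -/
def Fmat : FCarrier X →ₐ[k] Matrix (Fin 2) (Fin 2) (FCarrier X) :=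
  Flift X (FmatLin X)
    (by
      rw [FmatLin_apply X.pt_mem, X.d_pt, map_zero, Fι_pt, sgn_zero, one_smul,
        Matrix.one_fin_two])
    (Frel_right (FmatLin X) fun p q x s hx hs => by
      have hd : d k (PtBimod.rmul X.pt s) = PtBimod.rmul X.pt (d k s) := by
        rw [PtBimod.d_rmul s X.pt_mem, X.d_pt, sgn_zero, one_smul]
        simp [PtBimod.rmul]
      rw [FmatLin_apply hx, FmatLin_apply (PtBimod.rmul_mem X.pt_mem hs),
        FmatLin_apply (PtBimod.rmul_mem hx hs), hd, PtBimod.d_rmul s hx, Matrix.mul_fin_two,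
        map_add, map_zsmul, ← Fι_right X x s, ← Fι_right X (d k x), ← Fι_right X x (d k s),
        zero_add, sgn_add]
      simp only [smul_mul_assoc, mul_smul_comm, mul_zero, zero_mul, add_zero, zero_add, smul_smul,
        smul_zero]
      rw [add_comm (sgn p • _), mul_comm (sgn q)])
    (Frel_left (FmatLin X) fun p q r x hr hx => by
      have hd : d k (r • X.pt) = d k r • X.pt := by
        rw [X.d_lsmul X.pt hr, X.d_pt, smul_zero, smul_zero, add_zero]
      rw [FmatLin_apply hx, FmatLin_apply (X.lsmul_mem hr X.pt_mem),
        FmatLin_apply (X.lsmul_mem hr hx), hd, X.d_lsmul x hr, Matrix.mul_fin_two,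
        map_add, map_zsmul, ← Fι_left X r x, ← Fι_left X (d k r) x, ← Fι_left X r (d k x),
        add_zero, sgn_add]
      simp only [smul_mul_assoc, mul_smul_comm, mul_zero, zero_mul, add_zero, zero_add, smul_smul,
        smul_zero]
      rw [add_comm (sgn p • _), mul_comm (sgn q)])

variable (X) in
/-- The differential of `F(X)`: the upper right entry. -/
def Fd : FCarrier X →ₗ[k] FCarrier X where
  toFun a := Fmat X a 0 1
  map_add' a b := by rw [map_add]; rfl
  map_smul' c a := by rw [map_smul]; rfl

lemma Fmat_ι {n : ℤ} {x : X} (hx : x ∈ gr k n) :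
    Fmat X (Fι X x) = !![sgn n • Fι X x, Fι X (d k x); 0, Fι X x] := by
  rw [Fmat, Flift_ι, FmatLin_apply hx]

lemma Fd_ι (x : X) : Fd X (Fι X x) = Fι X (d k x) := by
  change Fmat X _ 0 1 = _
  rw [Fmat, Flift_ι]
  rfl

lemma Fmat_apply {n : ℤ} {a : FCarrier X} (ha : a ∈ Fgr X n) :
    Fmat X a = !![sgn n • a, Fd X a; 0, a] := by
  have h : Fmat X a 0 0 = sgn n • a ∧ Fmat X a 1 0 = 0 ∧ Fmat X a 1 1 = a := by
    unfold Fgr at ha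
    induction ha using Submodule.span_induction with
    | mem a ha =>
      induction ha with
      | one => rw [map_one, sgn_zero]; simp
      | @cons p n x a hx _ ih =>
        obtain ⟨h1, h2, h3⟩ := ih
        rw [map_mul, Fmat_ι hx]
        refine ⟨?_, ?_, ?_⟩
        · simp only [Matrix.mul_apply, Fin.sum_univ_two, h1, h2]
          simp only [Matrix.of_apply, Matrix.cons_val', Matrix.cons_val_zero, Matrix.cons_val_one,
            Matrix.cons_val_fin_one, mul_zero, add_zero, smul_mul_assoc, mul_smul_comm, smul_smul,
            sgn_add, mul_comm (sgn n)]
        · simp [Matrix.mul_apply, Fin.sum_univ_two, h2]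
        · simp [Matrix.mul_apply, Fin.sum_univ_two, h3]
    | zero => simp
    | add a b _ _ ha hb =>
      refine ⟨?_, ?_, ?_⟩
      · rw [map_add, Matrix.add_apply, ha.1, hb.1, smul_add]
      · rw [map_add, Matrix.add_apply, ha.2.1, hb.2.1, add_zero]
      · rw [map_add, Matrix.add_apply, ha.2.2, hb.2.2]
    | smul c a _ ha =>
      refine ⟨?_, ?_, ?_⟩
      · rw [map_smul, Matrix.smul_apply, ha.1, smul_comm]
      · rw [map_smul, Matrix.smul_apply, ha.2.1, smul_zero]
      · rw [map_smul, Matrix.smul_apply, ha.2.2]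
  obtain ⟨h1, h2, h3⟩ := h
  rw [Matrix.eta_fin_two (Fmat X a), h1, h2, h3]
  rfl

lemma F_leibniz {p : ℤ} {a : FCarrier X} (b : FCarrier X) (ha : a ∈ Fgr X p) :
    Fd X (a * b) = Fd X a * b + sgn p • (a * Fd X b) := by
  refine F_induction (P := fun b => Fd X (a * b) = Fd X a * b + sgn p • (a * Fd X b)) b
    (by simp) (fun b c hb hc => ?_) (fun c b hb => ?_) (fun n b hb => ?_)
  · rw [mul_add, map_add, hb, hc, map_add, mul_add, mul_add, smul_add]
    exact add_add_add_comm _ _ _ _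
  · simp only [mul_smul_comm, map_smul, hb, smul_add]
    rw [smul_comm c (sgn p)]
  · have hb' : b ∈ Fgr X n := Submodule.subset_span hb
    change Fmat X (a * b) 0 1 = _
    rw [map_mul, Fmat_apply ha, Fmat_apply hb', Matrix.mul_fin_two]
    change (sgn p • a) * Fd X b + Fd X a * b = _
    rw [smul_mul_assoc, add_comm]

lemma Fd_one : Fd X 1 = 0 := by
  change Fmat X 1 0 1 = 0
  rw [map_one]; simp

lemma Fd_mem {n : ℤ} {a : FCarrier X} (ha : a ∈ Fgr X n) : Fd X a ∈ Fgr X (n + 1) := by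
  unfold Fgr at ha
  induction ha using Submodule.span_induction with
  | mem a ha =>
    induction ha with
    | one => rw [Fd_one]; exact Submodule.zero_mem _
    | @cons p n x a hx ha ih =>
      have ha' : a ∈ Fgr X n := Submodule.subset_span ha
      rw [F_leibniz a (Fι_mem hx), Fd_ι]
      refine Submodule.add_mem _ ?_ (zsmul_mem ?_ _)
      · have := Fmul_mem (Fι_mem (d_mem k hx)) ha'
        rwa [add_right_comm] at this
      · have := Fmul_mem (Fι_mem hx) ih
        rwa [← add_assoc] at this
  | zero => rw [map_zero]; exact Submodule.zero_mem _
  | add a b _ _ ha hb => rw [map_add]; exact Submodule.add_mem _ ha hb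
  | smul c a _ ha => rw [map_smul]; exact Submodule.smul_mem _ _ ha

lemma Fd_d (a : FCarrier X) : Fd X (Fd X a) = 0 := by
  refine F_induction (P := fun a => Fd X (Fd X a) = 0) a (by simp)
    (fun a b ha hb => by simp [ha, hb]) (fun c a ha => by simp [ha]) (fun n a ha => ?_)
  induction ha with
  | one => rw [Fd_one, map_zero]
  | @cons p n x a hx ha ih =>
    rw [F_leibniz a (Fι_mem hx), map_add, map_zsmul, F_leibniz _ (Fι_mem hx), ih, Fd_ι,
      F_leibniz a (Fι_mem (d_mem k hx)), Fd_ι, d_d, sgn_succ]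
    simp

variable (X) in
/-- The DG algebra `F(X)`. -/
def FAlg : DGAlg k where
  carrier := FCarrier X
  dg :=
    { gr := Fgr X
      isInternal := F_isInternal X
      d := Fd X
      d_mem := Fd_mem
      d_d := Fd_d }
  one_mem := Fone_mem X
  mul_mem := Fmul_mem
  leibniz := F_leibniz

variable (X) in
/-- The algebra map `S → F(X)`, `s ↦ 1·s`. -/
def FfromSAlg : S →ₐ[k] FCarrier X :=
  AlgHom.ofLinearMap ((Fι X).comp (X.rmulHom X.pt))
    (by simp [PtBimod.rmulHom_apply, PtBimod.rmul, Fι_pt])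
    (fun s t => by
      simp only [LinearMap.comp_apply, PtBimod.rmulHom_apply]
      rw [Fι_right]
      simp [PtBimod.rmul, mul_smul])

variable (X) in
/-- The algebra map `R → F(X)`, `r ↦ r·1`. -/
def FfromRAlg : R →ₐ[k] FCarrier X :=
  AlgHom.ofLinearMap ((Fι X).comp (X.lmulHom.flip X.pt))
    (by simp [PtBimod.lmulHom_apply, Fι_pt])
    (fun r t => by
      simp only [LinearMap.comp_apply, LinearMap.flip_apply, PtBimod.lmulHom_apply]
      rw [Fι_left, mul_smul])

variable (X) in
/-- The morphism `S → F(X)`, `s ↦ 1·s`. -/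
def FfromS : S ⟶ FAlg X :=
  DGAlg.Hom.mk (FfromSAlg X)
    (fun {_ _} hs => Fι_mem (X.fromS.map_mem hs))
    (fun s => by
      change Fι X (X.fromS.toLinearMap (d k s)) = Fd X (Fι X (X.fromS.toLinearMap s))
      rw [Fd_ι, X.fromS.map_d])

variable (X) in
/-- The morphism `R → F(X)`, `r ↦ r·1`. -/
def FfromR : R ⟶ FAlg X :=
  DGAlg.Hom.mk (FfromRAlg X)
    (fun {n r} hr => by
      have h := X.lsmul_mem hr X.pt_mem
      rw [add_zero] at h
      exact Fι_mem h)
    (fun r => by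
      change Fι X (d k r • X.pt) = Fd X (Fι X (r • X.pt))
      rw [Fd_ι]
      congr 1
      refine homogeneous_induction (P := fun r => d k r • X.pt = d k (r • X.pt)) k r ?_
        (fun a b ha hb => ?_) (fun p r hr => ?_)
      · simp
      · simp only [map_add, add_smul, ha, hb]
      · rw [X.d_lsmul X.pt hr, X.d_pt, smul_zero, smul_zero, add_zero])

variable {Y : PtBimod R S}

/-- The algebra map `F(f)`. -/
def FmapAlg (f : X ⟶ Y) : FCarrier X →ₐ[k] FCarrier Y :=
  Flift X ((Fι Y).comp (PtBimod.Hom.toLinearMap f))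
    (by rw [LinearMap.comp_apply, PtBimod.Hom.map_pt f, Fι_pt])
    (fun x s => by
      simp only [LinearMap.comp_apply]
      rw [PtBimod.Hom.map_rmul f, PtBimod.Hom.map_rmul f, PtBimod.Hom.map_pt f, Fι_right])
    (fun r x => by
      simp only [LinearMap.comp_apply]
      rw [PtBimod.Hom.map_lsmul f, PtBimod.Hom.map_lsmul f, PtBimod.Hom.map_pt f, Fι_left])

lemma FmapAlg_ι (f : X ⟶ Y) (x : X) :
    FmapAlg f (Fι X x) = Fι Y (PtBimod.Hom.toLinearMap f x) := by
  rw [FmapAlg, Flift_ι]; rfl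

lemma FmapAlg_mem (f : X ⟶ Y) {n : ℤ} {a : FCarrier X} (ha : a ∈ Fgr X n) :
    FmapAlg f a ∈ Fgr Y n := by
  unfold Fgr at ha
  induction ha using Submodule.span_induction with
  | mem a ha =>
    induction ha with
    | one => rw [map_one]; exact Fone_mem Y
    | cons hx _ ih =>
      rw [map_mul, FmapAlg_ι]
      exact Fmul_mem (Fι_mem (PtBimod.Hom.map_mem f hx)) ih
  | zero => rw [map_zero]; exact Submodule.zero_mem _
  | add a b _ _ ha hb => rw [map_add]; exact Submodule.add_mem _ ha hb
  | smul c a _ ha => rw [map_smul]; exact Submodule.smul_mem _ _ ha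

lemma FmapAlg_d (f : X ⟶ Y) (a : FCarrier X) : FmapAlg f (Fd X a) = Fd Y (FmapAlg f a) := by
  refine F_induction (P := fun a => FmapAlg f (Fd X a) = Fd Y (FmapAlg f a)) a (by simp)
    (fun a b ha hb => by simp [ha, hb]) (fun c a ha => by simp [ha]) (fun n a ha => ?_)
  induction ha with
  | one => rw [Fd_one, map_zero, map_one, Fd_one]
  | @cons p n x a hx ha ih =>
    rw [F_leibniz a (Fι_mem hx), map_add, map_zsmul, map_mul, map_mul, map_mul, ih, Fd_ι,
      FmapAlg_ι, FmapAlg_ι, F_leibniz _ (Fι_mem (PtBimod.Hom.map_mem f hx)), Fd_ι,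
      PtBimod.Hom.map_d f]

variable (R S) in
/-- The free functor `F : dgMod⁰_{R-S} ⥤ dgAlg_{R-S}`. -/
def F : PtBimod R S ⥤ AlgUnder R S where
  obj X := ⟨FAlg X, FfromR X, FfromS X⟩
  map {X Y} f := AlgUnder.Hom.mk
    (DGAlg.Hom.mk (FmapAlg f) (FmapAlg_mem f) (FmapAlg_d f))
    (by
      apply DGAlg.Hom.ext
      ext r
      change FmapAlg f (Fι X (r • X.pt)) = Fι Y (r • Y.pt)
      rw [FmapAlg_ι, PtBimod.Hom.map_lsmul f, PtBimod.Hom.map_pt f])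
    (by
      apply DGAlg.Hom.ext
      ext s
      change FmapAlg f (Fι X (PtBimod.rmul X.pt s)) = Fι Y (PtBimod.rmul Y.pt s)
      rw [FmapAlg_ι, PtBimod.Hom.map_rmul f, PtBimod.Hom.map_pt f])
  map_id X := by
    apply AlgUnder.Hom.ext
    apply DGAlg.Hom.ext
    exact Fhom_ext fun x => FmapAlg_ι (𝟙 X) x
  map_comp {X Y Z} f g := by
    apply AlgUnder.Hom.ext
    apply DGAlg.Hom.ext
    refine Fhom_ext fun x => ?_
    change FmapAlg (f ≫ g) (Fι X x) = FmapAlg g (FmapAlg f (Fι X x))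
    rw [FmapAlg_ι, FmapAlg_ι, FmapAlg_ι]
    rfl

end F

end DG

end

/-!
The free functor `F` is left adjoint to the functor which regards a DG algebra under `R` and `S` as
a bimodule pointed by its unit, and this right adjoint preserves trivial fibrations; hence `F`
preserves cofibrant objects (`F_cofibrant`). Everything else rests on the fact that homotopies
extend from `X` to `F(X)`: a homotopy on the generators which is compatible with the relations is a
morphism from `F(X)` to the path algebra of the target, so it extends as a derivation and the two
morphisms agree on cohomology (`F_mapH_eq_of_homotopy`).

*Distinguished objects.* Let `X` be cofibrant and distinguished. The triangular DG algebra of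
matrices `[[r, x], [0, s]]`, with `x` shifted by one degree, is the homotopy pullback of `R → X` and
`S → X`. As `S → X` is a quasi-isomorphism, its projection to `R` is a trivial fibration, and since
`R` is cofibrant it has a section. Such a section is a morphism `φ : R → S` with a derivation
`h : R → X` which is a homotopy between `r ↦ r · 1` and `r ↦ 1 · φ(r)`
(`PtBimod.exists_derivation`). So `S → X` is linear over `R` up to a coherent homotopy, where `R`
acts on `S` through `φ`. The homotopy is used to twist the left action on the mapping path object of
`S → X`, which makes it a pointed bimodule with a trivial fibration to `X`. As `X` is cofibrant,
there is a section, which consists of a strict map of pointed bimodules `ρ : X → S` and a homotopy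
`K` from the identity of `X` to `x ↦ 1 · ρ(x)`
(`PtBimod.HtpyLinear.exists_homotopy_section`). The map `ρ` induces a retraction `F(X) → S` of
`S → F(X)`, and `K` extends to a homotopy which shows that it is an inverse on cohomology
(`F_distinguished`).

*The derived functor.* The same argument, with a trivial twist, applied to a quasi-isomorphism
between cofibrant objects shows that `F` preserves such quasi-isomorphisms (`F_quasiIso`).
Functorial cofibrant resolutions are built in one step from cells: a cell over `Y` is a formal boundary, made
of cells which are already there, together with its image in `Y`. The semifree bimodule on all cells
which are consistent is cofibrant, because values of a lift are chosen by recursion on cells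
(`Cell.data_cofibrant`), and its augmentation is a quasi-isomorphism, because each cocycle is
hit by a cell and each cocycle with trivial image is the boundary of a cell
(`Cell.augmentation_quasiIso`). The values of `F` on the resolutions are then the left derived
functor (`isLeftDerivedFunctor_of_resolution`), and since the resolution of a distinguished bimodule
is distinguished and cofibrant, the derived functor preserves distinguished objects.
-/


noncomputable section

namespace DG

/-! ### Cohomology of DG modules -/

section Cohomology

variable {k : Type u} [CommRing k]
variable {M : Type u} [AddCommGroup M] [Module k M] [DGModule k M]
variable {N : Type u} [AddCommGroup N] [Module k N] [DGModule k N]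
variable {P : Type u} [AddCommGroup P] [Module k P] [DGModule k P]

lemma d_mem_of_eq {m n : ℤ} {x : M} (hx : x ∈ gr k m) (h : m + 1 = n) : d k x ∈ gr k n :=
  h ▸ d_mem k hx

lemma d_mem' {n : ℤ} {x : M} (hx : x ∈ gr k (n - 1)) : d k x ∈ gr k n :=
  d_mem_of_eq hx (by ring)

/-- The element-wise form of bijectivity on cohomology. -/
lemma DGHom.isQuasiIso_iff (f : DGHom k M N) :
    f.IsQuasiIso ↔ ∀ n : ℤ,
      (∀ x ∈ gr k n, d k x = 0 → (∃ w ∈ gr k (n - 1), d k w = f.toLinearMap x) →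
        ∃ z ∈ gr k (n - 1), d k z = x) ∧
      (∀ y ∈ gr k n, d k y = 0 → ∃ x ∈ gr k n, d k x = 0 ∧
        ∃ w ∈ gr k (n - 1), d k w = y - f.toLinearMap x) := by
  refine forall_congr' fun n => and_congr ?_ ?_
  · rw [← LinearMap.ker_eq_bot, LinearMap.ker_eq_bot']
    constructor
    · intro h x hx hdx hw
      have := h (Submodule.Quotient.mk ⟨x, hx, hdx⟩)
        ((Submodule.Quotient.mk_eq_zero _).2 hw)
      exact (Submodule.Quotient.mk_eq_zero _).1 this
    · intro h x hx
      obtain ⟨⟨x, hx1, hx2⟩, rfl⟩ := Submodule.Quotient.mk_surjective _ x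
      exact (Submodule.Quotient.mk_eq_zero _).2
        (h x hx1 hx2 ((Submodule.Quotient.mk_eq_zero _).1 hx))
  · constructor
    · intro h y hy hdy
      obtain ⟨x, hx⟩ := h (Submodule.Quotient.mk ⟨y, hy, hdy⟩)
      obtain ⟨⟨x, hx1, hx2⟩, rfl⟩ := Submodule.Quotient.mk_surjective _ x
      exact ⟨x, hx1, hx2, (Submodule.Quotient.eq _).1 hx.symm⟩
    · intro h y
      obtain ⟨⟨y, hy1, hy2⟩, rfl⟩ := Submodule.Quotient.mk_surjective _ y
      obtain ⟨x, hx1, hx2, hw⟩ := h y hy1 hy2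
      exact ⟨Submodule.Quotient.mk ⟨x, hx1, hx2⟩, ((Submodule.Quotient.eq _).2 hw).symm⟩

lemma DGHom.mapH_eq_comp (f : DGHom k M N) (g : DGHom k N P) (c : DGHom k M P)
    (h : ∀ x, c.toLinearMap x = g.toLinearMap (f.toLinearMap x)) (n : ℤ) :
    (c.mapH n : H k M n → H k P n) = g.mapH n ∘ f.mapH n := by
  funext x
  obtain ⟨x, rfl⟩ := Submodule.Quotient.mk_surjective _ x
  exact congrArg Submodule.Quotient.mk (Subtype.ext (h x))

lemma DGHom.mapH_eq_id (f : DGHom k M M) (h : ∀ x, f.toLinearMap x = x) (n : ℤ) :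
    (f.mapH n : H k M n → H k M n) = id := by
  funext x
  obtain ⟨x, rfl⟩ := Submodule.Quotient.mk_surjective _ x
  exact congrArg Submodule.Quotient.mk (Subtype.ext (h x))

/-- Chain homotopic maps agree on cohomology. -/
lemma DGHom.mapH_eq_of_homotopy (f g : DGHom k M N) (K : M →ₗ[k] N)
    (hK : ∀ {n : ℤ} {x : M}, x ∈ gr k n → K x ∈ gr k (n - 1))
    (h : ∀ x, K (d k x) = f.toLinearMap x - g.toLinearMap x - d k (K x)) (n : ℤ) :
    (f.mapH n : H k M n → H k N n) = g.mapH n := by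
  funext x
  obtain ⟨⟨x, hx, hdx⟩, rfl⟩ := Submodule.Quotient.mk_surjective _ x
  refine (Submodule.Quotient.eq _).2 ⟨K x, hK hx, ?_⟩
  have hdx' : d k x = 0 := hdx
  have := h x
  rw [hdx', map_zero, eq_comm, sub_eq_zero] at this
  exact this.symm

lemma DGHom.IsQuasiIso.comp_of_eq {f : DGHom k M N} {g : DGHom k N P} {c : DGHom k M P}
    (hf : f.IsQuasiIso) (hg : g.IsQuasiIso)
    (h : ∀ x, c.toLinearMap x = g.toLinearMap (f.toLinearMap x)) : c.IsQuasiIso := fun n => by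
  rw [DGHom.mapH_eq_comp f g c h]
  exact (hg n).comp (hf n)

lemma DGHom.IsQuasiIso.of_comp_left {f : DGHom k M N} {g : DGHom k N P} {c : DGHom k M P}
    (hc : c.IsQuasiIso) (hg : g.IsQuasiIso)
    (h : ∀ x, c.toLinearMap x = g.toLinearMap (f.toLinearMap x)) : f.IsQuasiIso := fun n => by
  have := hc n
  rw [DGHom.mapH_eq_comp f g c h] at this
  exact (Function.Bijective.of_comp_iff' (hg n) _).1 this

end Cohomology

/-! ### Projections onto the graded components -/

section Proj

variable {k : Type u} [CommRing k]

/-- A family of submodules spanning `M` is a grading as soon as there are linear projections onto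
its members which are orthogonal. -/
lemma isInternal_of_proj {M : Type u} [AddCommGroup M] [Module k M] (G : ℤ → Submodule k M)
    (π : ℤ → M →ₗ[k] M) (h1 : ∀ n, ∀ x ∈ G n, π n x = x)
    (h2 : ∀ m n, m ≠ n → ∀ x ∈ G n, π m x = 0) (h3 : ∀ x : M, x ∈ ⨆ n, G n) :
    DirectSum.IsInternal G := by
  have key : ∀ (w : DirectSum ℤ (fun n => G n)) (n : ℤ),
      π n (DirectSum.coeAddMonoidHom G w) = (w n : M) := by
    intro w n
    induction w using DirectSum.induction_on with
    | zero => simp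
    | of m x =>
      rw [DirectSum.coeAddMonoidHom_of]
      by_cases h : n = m
      · subst h; rw [h1 n x x.2, DirectSum.of_eq_same]
      · rw [h2 n m h x x.2, DirectSum.of_eq_of_ne _ _ _ h]; rfl
    | add v w hv hw => simp [hv, hw]
  constructor
  · intro v w hvw
    refine DFinsupp.ext fun n => Subtype.ext ?_
    rw [← key v n, ← key w n, hvw]
  · intro a
    have ha := h3 a
    rw [Submodule.iSup_eq_range_dfinsupp_lsum] at ha
    obtain ⟨w, hw⟩ := ha
    exact ⟨w, hw⟩

variable {M : Type u} [AddCommGroup M] [Module k M] [DGModule k M]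
variable {N : Type u} [AddCommGroup N] [Module k N] [DGModule k N]

variable (k M) in
/-- The projection of `M` onto its component of degree `n`. -/
def proj (n : ℤ) : M →ₗ[k] M := gradedLift k fun m => if m = n then LinearMap.id else 0

lemma proj_of_mem {n : ℤ} {x : M} (hx : x ∈ gr k n) : proj k M n x = x := by
  rw [proj, gradedLift_apply k _ hx, if_pos rfl]; rfl

lemma proj_of_mem_ne {m n : ℤ} {x : M} (hx : x ∈ gr k m) (h : m ≠ n) : proj k M n x = 0 := by
  rw [proj, gradedLift_apply k _ hx, if_neg h]; rfl

lemma proj_mem (n : ℤ) (x : M) : proj k M n x ∈ gr k n := by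
  refine homogeneous_induction (P := fun x => proj k M n x ∈ gr k n) k x ?_
    (fun x y hx hy => ?_) (fun m x hx => ?_)
  · rw [map_zero]; exact Submodule.zero_mem _
  · rw [map_add]; exact Submodule.add_mem _ hx hy
  · by_cases h : m = n
    · subst h; rwa [proj_of_mem hx]
    · rw [proj_of_mem_ne hx h]; exact Submodule.zero_mem _

lemma DGHom.proj_comm (f : DGHom k M N) (n : ℤ) (x : M) :
    f.toLinearMap (proj k M n x) = proj k N n (f.toLinearMap x) := by
  refine homogeneous_induction
    (P := fun x => f.toLinearMap (proj k M n x) = proj k N n (f.toLinearMap x)) k x ?_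
    (fun x y hx hy => ?_) (fun m x hx => ?_)
  · simp
  · simp only [map_add, hx, hy]
  · by_cases h : m = n
    · subst h; rw [proj_of_mem hx, proj_of_mem (f.map_mem hx)]
    · rw [proj_of_mem_ne hx h, proj_of_mem_ne (f.map_mem hx) h, map_zero]

/-- A surjective morphism of DG modules is surjective in each degree. -/
lemma DGHom.surjective_gr {f : DGHom k M N} (hs : Function.Surjective f.toLinearMap) (n : ℤ)
    (y : N) (hy : y ∈ gr k n) : ∃ x ∈ gr k n, f.toLinearMap x = y := by
  obtain ⟨x, rfl⟩ := hs y
  exact ⟨proj k M n x, proj_mem n x, by rw [f.proj_comm, proj_of_mem hy]⟩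

/-- A trivial fibration has the lifting property against the inclusion of a sphere into a disk. -/
lemma DGHom.exists_lift {f : DGHom k M N} (hf : f.IsQuasiIso)
    (hs : Function.Surjective f.toLinearMap) {n : ℤ} {z : M} {b : N} (hz : z ∈ gr k (n + 1))
    (hdz : d k z = 0) (hb : b ∈ gr k n) (hdb : d k b = f.toLinearMap z) :
    ∃ a ∈ gr k n, d k a = z ∧ f.toLinearMap a = b := by
  have hn : n + 1 - 1 = n := by ring
  obtain ⟨a₀, ha₀, hda₀⟩ := ((f.isQuasiIso_iff.1 hf) (n + 1)).1 z hz hdz ⟨b, by rwa [hn], hdb⟩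
  rw [hn] at ha₀
  -- `b - f a₀` is a cocycle, hence cohomologous to the image of a cocycle `x`
  obtain ⟨x, hx, hdx, w, hw, hdw⟩ := ((f.isQuasiIso_iff.1 hf) n).2 (b - f.toLinearMap a₀)
    (Submodule.sub_mem _ hb (f.map_mem ha₀)) (by rw [map_sub, hdb, ← f.map_d, hda₀, sub_self])
  obtain ⟨v, hv, rfl⟩ := DGHom.surjective_gr hs _ w hw
  refine ⟨a₀ + x + d k v, Submodule.add_mem _ (Submodule.add_mem _ ha₀ hx) (d_mem' hv), ?_, ?_⟩
  · rw [map_add, map_add, hda₀, hdx, d_d, add_zero, add_zero]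
  · rw [map_add, map_add, f.map_d, hdw]; abel

lemma linearMap_ext_gr {P : Type u} [AddCommGroup P] [Module k P] {f g : M →ₗ[k] P}
    (h : ∀ (n : ℤ) (x : M), x ∈ gr k n → f x = g x) (x : M) : f x = g x :=
  homogeneous_induction (P := fun x => f x = g x) k x (by simp)
    (fun x y hx hy => by rw [map_add, map_add, hx, hy]) h

lemma sgn_smul_smul {P : Type u} [AddCommGroup P] (n : ℤ) (x : P) : sgn n • sgn n • x = x := by
  rw [smul_smul, sgn_mul_self, one_smul]

lemma gradingSign_mem {n : ℤ} {x : M} (hx : x ∈ gr k n) : gradingSign k M x ∈ gr k n := by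
  rw [gradingSign_apply k hx]; exact zsmul_mem hx _

lemma DGAlg.gradingSign_one (A : DGAlg k) : gradingSign k A 1 = 1 := by
  rw [gradingSign_apply k A.one_mem, sgn_zero, one_smul]

lemma DGAlg.gradingSign_mul (A : DGAlg k) (a b : A) :
    gradingSign k A (a * b) = gradingSign k A a * gradingSign k A b := by
  refine linearMap_ext_gr (f := (gradingSign k A).comp (LinearMap.mulRight k b))
    (g := (LinearMap.mulRight k (gradingSign k A b)).comp (gradingSign k A)) (fun p a ha => ?_) a
  refine linearMap_ext_gr (f := (gradingSign k A).comp (LinearMap.mulLeft k a))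
    (g := (LinearMap.mulLeft k (gradingSign k A a)).comp (gradingSign k A)) (fun q b hb => ?_) b
  simp only [LinearMap.comp_apply, LinearMap.mulLeft_apply]
  rw [gradingSign_apply k (A.mul_mem ha hb), gradingSign_apply k ha, gradingSign_apply k hb,
    sgn_add, smul_mul_smul_comm]

lemma DGAlg.d_one (A : DGAlg k) : d k (1 : A) = 0 := by
  have h := A.leibniz (1 : A) A.one_mem
  rw [mul_one, mul_one, one_mul, sgn_zero, one_smul] at h
  exact left_eq_add.1 h

end Proj

/-! ### Homotopy pullbacks of DG modules -/

section HPullback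

variable {k : Type u} [CommRing k]
variable {A : Type u} [AddCommGroup A] [Module k A] [DGModule k A]
variable {B : Type u} [AddCommGroup B] [Module k B] [DGModule k B]
variable {C : Type u} [AddCommGroup C] [Module k C] [DGModule k C]

/-- The homotopy pullback of `v : A → C` and `w : B → C`. Its elements of degree `n` are the
triples `(a, b, c)` with `a` and `b` of degree `n` and `c` of degree `n - 1`, a homotopy between
the images of `a` and `b`: the differential is `d(a, b, c) = (da, db, v a - w b - dc)`. -/
def HPullback (_ : DGHom k A C) (_ : DGHom k B C) : Type u := A × B × C

namespace HPullback

variable {v : DGHom k A C} {w : DGHom k B C}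

instance : AddCommGroup (HPullback v w) := inferInstanceAs (AddCommGroup (A × B × C))

instance : Module k (HPullback v w) := inferInstanceAs (Module k (A × B × C))

variable (v w) in
/-- The first component. -/
def fst : HPullback v w →ₗ[k] A := LinearMap.fst k A (B × C)

variable (v w) in
/-- The second component. -/
def snd : HPullback v w →ₗ[k] B := (LinearMap.fst k B C).comp (LinearMap.snd k A (B × C))

variable (v w) in
/-- The homotopy component. -/
def htpy : HPullback v w →ₗ[k] C := (LinearMap.snd k B C).comp (LinearMap.snd k A (B × C))

variable (v w) in
/-- The triple `(a, b, c)`. -/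
def mk (a : A) (b : B) (c : C) : HPullback v w := (a, b, c)

@[simp] lemma fst_mk (a : A) (b : B) (c : C) : fst v w (mk v w a b c) = a := rfl
@[simp] lemma snd_mk (a : A) (b : B) (c : C) : snd v w (mk v w a b c) = b := rfl
@[simp] lemma htpy_mk (a : A) (b : B) (c : C) : htpy v w (mk v w a b c) = c := rfl

lemma ext {x y : HPullback v w} (h1 : fst v w x = fst v w y) (h2 : snd v w x = snd v w y)
    (h3 : htpy v w x = htpy v w y) : x = y :=
  Prod.ext h1 (Prod.ext h2 h3)

variable (v w) in
/-- The linear map with three given components. -/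
def mkLin {P : Type u} [AddCommGroup P] [Module k P] (f : P →ₗ[k] A) (g : P →ₗ[k] B)
    (h : P →ₗ[k] C) : P →ₗ[k] HPullback v w :=
  f.prod (g.prod h)

@[simp] lemma fst_mkLin {P : Type u} [AddCommGroup P] [Module k P] (f : P →ₗ[k] A)
    (g : P →ₗ[k] B) (h : P →ₗ[k] C) (x : P) : fst v w (mkLin v w f g h x) = f x := rfl
@[simp] lemma snd_mkLin {P : Type u} [AddCommGroup P] [Module k P] (f : P →ₗ[k] A)
    (g : P →ₗ[k] B) (h : P →ₗ[k] C) (x : P) : snd v w (mkLin v w f g h x) = g x := rfl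
@[simp] lemma htpy_mkLin {P : Type u} [AddCommGroup P] [Module k P] (f : P →ₗ[k] A)
    (g : P →ₗ[k] B) (h : P →ₗ[k] C) (x : P) : htpy v w (mkLin v w f g h x) = h x := rfl

variable (v w) in
/-- The grading, with the homotopy component shifted by one. -/
def grading (n : ℤ) : Submodule k (HPullback v w) :=
  (gr k n).comap (fst v w) ⊓ (gr k n).comap (snd v w) ⊓ (gr k (n - 1)).comap (htpy v w)

lemma mem_grading {n : ℤ} {x : HPullback v w} : x ∈ grading v w n ↔
    fst v w x ∈ gr k n ∧ snd v w x ∈ gr k n ∧ htpy v w x ∈ gr k (n - 1) := by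
  simp only [grading, Submodule.mem_inf, Submodule.mem_comap, and_assoc]

instance : DGModule k (HPullback v w) where
  gr := grading v w
  isInternal := by
    refine isInternal_of_proj _ (fun n => mkLin v w ((proj k A n).comp (fst v w))
      ((proj k B n).comp (snd v w)) ((proj k C (n - 1)).comp (htpy v w))) ?_ ?_ ?_
    · intro n x hx
      obtain ⟨h1, h2, h3⟩ := mem_grading.1 hx
      exact ext (by simp [proj_of_mem h1]) (by simp [proj_of_mem h2]) (by simp [proj_of_mem h3])
    · intro m n hmn x hx
      obtain ⟨h1, h2, h3⟩ := mem_grading.1 hx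
      exact ext (by simp [proj_of_mem_ne h1 hmn.symm]) (by simp [proj_of_mem_ne h2 hmn.symm])
        (by simp [proj_of_mem_ne (n := m - 1) h3 (by omega)])
    · intro x
      have hx : x = mk v w (fst v w x) 0 0 + mk v w 0 (snd v w x) 0 + mk v w 0 0 (htpy v w x) :=
        ext (by simp) (by simp) (by simp)
      rw [hx]
      refine Submodule.add_mem _ (Submodule.add_mem _ ?_ ?_) ?_
      · refine homogeneous_induction (P := fun a => mkLin v w LinearMap.id 0 0 a ∈ _) k
          (fst v w x) (by rw [map_zero]; exact Submodule.zero_mem _)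
          (fun x y hx hy => by rw [map_add]; exact Submodule.add_mem _ hx hy) fun n a ha => ?_
        exact Submodule.mem_iSup_of_mem n (mem_grading.2 ⟨ha, by simp, by simp⟩)
      · refine homogeneous_induction (P := fun a => mkLin v w 0 LinearMap.id 0 a ∈ _) k
          (snd v w x) (by rw [map_zero]; exact Submodule.zero_mem _)
          (fun x y hx hy => by rw [map_add]; exact Submodule.add_mem _ hx hy) fun n a ha => ?_
        exact Submodule.mem_iSup_of_mem n (mem_grading.2 ⟨by simp, ha, by simp⟩)
      · refine homogeneous_induction (P := fun a => mkLin v w 0 0 LinearMap.id a ∈ _) k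
          (htpy v w x) (by rw [map_zero]; exact Submodule.zero_mem _)
          (fun x y hx hy => by rw [map_add]; exact Submodule.add_mem _ hx hy) fun n a ha => ?_
        exact Submodule.mem_iSup_of_mem (n + 1)
          (mem_grading.2 ⟨by simp, by simp, by simpa using ha⟩)
  d := mkLin v w ((d k).comp (fst v w)) ((d k).comp (snd v w))
    (v.toLinearMap.comp (fst v w) - w.toLinearMap.comp (snd v w) - (d k).comp (htpy v w))
  d_mem := fun {n x} hx => by
    obtain ⟨h1, h2, h3⟩ := mem_grading.1 hx
    refine mem_grading.2 ⟨d_mem k h1, d_mem k h2, ?_⟩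
    rw [add_sub_cancel_right]
    exact Submodule.sub_mem _ (Submodule.sub_mem _ (v.map_mem h1) (w.map_mem h2)) (d_mem' h3)
  d_d := fun x => ext (by simp [d_d]) (by simp [d_d]) (by simp [d_d, v.map_d, w.map_d])

lemma mem_gr {n : ℤ} {x : HPullback v w} : x ∈ gr k n ↔
    fst v w x ∈ gr k n ∧ snd v w x ∈ gr k n ∧ htpy v w x ∈ gr k (n - 1) := mem_grading

lemma mk_mem {n : ℤ} {a : A} {b : B} {c : C} (ha : a ∈ gr k n) (hb : b ∈ gr k n)
    (hc : c ∈ gr k (n - 1)) : mk v w a b c ∈ gr k n := mem_gr.2 ⟨ha, hb, hc⟩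

@[simp] lemma fst_d (x : HPullback v w) : fst v w (d k x) = d k (fst v w x) := rfl
@[simp] lemma snd_d (x : HPullback v w) : snd v w (d k x) = d k (snd v w x) := rfl
@[simp] lemma htpy_d (x : HPullback v w) : htpy v w (d k x) =
    v.toLinearMap (fst v w x) - w.toLinearMap (snd v w x) - d k (htpy v w x) := rfl

variable (v w) in
/-- The projection of the homotopy pullback to `A`. -/
def fstHom : DGHom k (HPullback v w) A := ⟨fst v w, fun h => (mem_gr.1 h).1, fun _ => rfl⟩

variable (v w) in
lemma fst_surjective : Function.Surjective (fst v w) := fun a => ⟨mk v w a 0 0, rfl⟩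

/-- Quasi-isomorphisms are stable under homotopy pullback. -/
lemma fstHom_isQuasiIso (hw : w.IsQuasiIso) : (fstHom v w).IsQuasiIso := by
  have hw' := w.isQuasiIso_iff.1 hw
  refine (fstHom v w).isQuasiIso_iff.2 fun n => ⟨?_, ?_⟩
  · rintro x hx hdx ⟨a, ha, hda⟩
    obtain ⟨-, h2, h3⟩ := mem_gr.1 hx
    have hda : d k a = fst v w x := hda
    have hdb : d k (snd v w x) = 0 := by rw [← snd_d, hdx, map_zero]
    have hdc : v.toLinearMap (fst v w x) - w.toLinearMap (snd v w x) - d k (htpy v w x) = 0 := by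
      rw [← htpy_d, hdx, map_zero]
    have hva : d k (v.toLinearMap a) = v.toLinearMap (fst v w x) := by rw [← v.map_d, hda]
    obtain ⟨b, hb, hdb'⟩ := (hw' n).1 (snd v w x) h2 hdb
      ⟨v.toLinearMap a - htpy v w x, Submodule.sub_mem _ (v.map_mem ha) h3, by
        rw [map_sub, hva, ← sub_eq_zero, ← hdc]; abel⟩
    -- the defect of `(a, b, 0)` is a cocycle, which is corrected by changing `b`
    obtain ⟨b', hb', hdb'', c, hc, hdc'⟩ := (hw' (n - 1)).2
      (v.toLinearMap a - w.toLinearMap b - htpy v w x)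
      (Submodule.sub_mem _ (Submodule.sub_mem _ (v.map_mem ha) (w.map_mem hb)) h3)
      (by rw [map_sub, map_sub, hva, ← w.map_d, hdb', hdc])
    refine ⟨mk v w a (b + b') c, mk_mem ha (Submodule.add_mem _ hb hb') hc, ext ?_ ?_ ?_⟩
    · simpa using hda
    · simp [hdb', hdb'']
    · simp only [htpy_d, fst_mk, snd_mk, htpy_mk, hdc', map_add]; abel
  · intro a ha hda
    obtain ⟨b, hb, hdb, c, hc, hdc⟩ := (hw' n).2 (v.toLinearMap a) (v.map_mem ha)
      (by rw [← v.map_d, hda, map_zero])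
    refine ⟨mk v w a b c, mk_mem ha hb hc, ext ?_ ?_ ?_, 0, Submodule.zero_mem _, ?_⟩
    · simpa using hda
    · simpa using hdb
    · simp [hdc]
    · simp [fstHom]

end HPullback

end HPullback

/-! ### Triangular DG algebras -/

section Triangular

variable {k : Type u} [CommRing k] {R S : DGAlg k}

namespace PtBimod

variable {X : PtBimod R S}

@[simp] lemma rmul_add (x : X) (s t : S) : rmul x (s + t) = rmul x s + rmul x t :=
  map_add (X.rmulHom x) s t

@[simp] lemma add_rmul (x y : X) (s : S) : rmul (x + y) s = rmul x s + rmul y s :=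
  smul_add _ x y

@[simp] lemma zero_rmul (s : S) : rmul (0 : X) s = 0 := smul_zero _

@[simp] lemma rmul_zero (x : X) : rmul x (0 : S) = 0 := map_zero (X.rmulHom x)

@[simp] lemma sub_rmul (x y : X) (s : S) : rmul (x - y) s = rmul x s - rmul y s :=
  smul_sub _ x y

@[simp] lemma rmul_one (x : X) : rmul x (1 : S) = x := one_smul _ x

lemma rmul_rmul (x : X) (s t : S) : rmul (rmul x s) t = rmul x (s * t) :=
  smul_smul (MulOpposite.op t) (MulOpposite.op s) x

lemma lsmul_rmul (r : R) (x : X) (s : S) : r • rmul x s = rmul (r • x) s :=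
  smul_comm r (MulOpposite.op s) x

lemma zsmul_rmul (n : ℤ) (x : X) (s : S) : rmul (n • x) s = n • rmul x s :=
  map_zsmul (X.rmulHom.flip s) n x

lemma smul_rmul (c : k) (x : X) (s : S) : rmul (c • x) s = c • rmul x s :=
  map_smul (X.rmulHom.flip s) c x

lemma rmul_smul (c : k) (x : X) (s : S) : rmul x (c • s) = c • rmul x s :=
  map_smul (X.rmulHom x) c s

lemma zsmul_lsmul (n : ℤ) (r : R) (x : X) : (n • r) • x = n • (r • x) :=
  map_zsmul (X.lmulHom.flip x) n r

lemma lsmul_smul (c : k) (r : R) (x : X) : r • (c • x) = c • (r • x) :=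
  map_smul (X.lmulHom r) c x

lemma d_lsmul_pt (r : R) : d k (r • X.pt) = d k r • X.pt :=
  linearMap_ext_gr (f := (d k).comp (X.lmulHom.flip X.pt)) (g := (X.lmulHom.flip X.pt).comp (d k))
    (fun p r hr => by
      simp only [LinearMap.comp_apply, LinearMap.flip_apply, lmulHom_apply]
      rw [X.d_lsmul X.pt hr, X.d_pt, smul_zero, smul_zero, add_zero]) r

variable (X) in
/-- The map of left DG `R`-modules `R → X`, `r ↦ r · 1`, induced by the point. -/
def fromR : DGHom k R X where
  toLinearMap := X.lmulHom.flip X.pt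
  map_mem := fun {n} x hx => by
    have h := X.lsmul_mem hx X.pt_mem
    rwa [add_zero] at h
  map_d := fun r => (d_lsmul_pt r).symm

lemma fromR_apply (r : R) : X.fromR.toLinearMap r = r • X.pt := rfl

lemma fromS_apply (s : S) : X.fromS.toLinearMap s = rmul X.pt s := rfl

variable (X) in
/-- The underlying DG module of the triangular algebra: triples `(r, s, x)` with `r ∈ R`, `s ∈ S`
and `x ∈ X` of degree one less. -/
abbrev Tri : Type u := HPullback X.fromR X.fromS

namespace Tri

open HPullback

/-- Multiplication of the triangular matrices `[[r, x], [0, s]]`; the sign comes from the shift of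
the entry `x`. -/
instance : Mul X.Tri where
  mul a b := HPullback.mk _ _ (fst _ _ a * fst _ _ b) (snd _ _ a * snd _ _ b)
    (gradingSign k R (fst _ _ a) • htpy _ _ b + rmul (htpy _ _ a) (snd _ _ b))

instance : One X.Tri where
  one := HPullback.mk _ _ 1 1 0

@[simp] lemma fst_mul (a b : X.Tri) : fst _ _ (a * b) = fst _ _ a * fst _ _ b := rfl
@[simp] lemma snd_mul (a b : X.Tri) : snd _ _ (a * b) = snd _ _ a * snd _ _ b := rfl
@[simp] lemma htpy_mul (a b : X.Tri) : htpy _ _ (a * b) =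
    gradingSign k R (fst _ _ a) • htpy _ _ b + rmul (htpy _ _ a) (snd _ _ b) := rfl
@[simp] lemma fst_one : fst _ _ (1 : X.Tri) = 1 := rfl
@[simp] lemma snd_one : snd _ _ (1 : X.Tri) = 1 := rfl
@[simp] lemma htpy_one : htpy _ _ (1 : X.Tri) = 0 := rfl

instance : Ring X.Tri where
  __ := (inferInstance : AddCommGroup X.Tri)
  left_distrib a b c := by
    refine ext ?_ ?_ ?_
    · simp [mul_add]
    · simp [mul_add]
    · simp only [htpy_mul, map_add, smul_add, rmul_add]; abel
  right_distrib a b c := by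
    refine ext ?_ ?_ ?_
    · simp [add_mul]
    · simp [add_mul]
    · simp only [htpy_mul, map_add, add_smul, add_rmul]; abel
  zero_mul a := ext (by simp) (by simp) (by simp)
  mul_zero a := ext (by simp) (by simp) (by simp)
  mul_assoc a b c := by
    refine ext (by simp [mul_assoc]) (by simp [mul_assoc]) ?_
    simp only [htpy_mul, fst_mul, snd_mul, DGAlg.gradingSign_mul, smul_add, add_rmul, mul_smul,
      rmul_rmul, lsmul_rmul, add_assoc]
  one_mul a := ext (by simp) (by simp) (by simp [DGAlg.gradingSign_one])
  mul_one a := ext (by simp) (by simp) (by simp)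

instance : Algebra k X.Tri := Algebra.ofModule
  (fun c a b => ext (by simp) (by simp)
    (by simp only [htpy_mul, map_smul, smul_assoc, smul_rmul, smul_add]))
  (fun c a b => ext (by simp) (by simp)
    (by simp only [htpy_mul, map_smul, lsmul_smul, rmul_smul, smul_add]))

variable (X) in
/-- The triangular DG algebra of a pointed bimodule: the homotopy pullback of `R → X` and `S → X`.
A section `(id, φ, h)` of its projection to `R` consists of a morphism `φ : R → S` and a homotopy
`h` between `r ↦ r · 1` and `r ↦ 1 · φ(r)` which is a derivation. -/
def alg : DGAlg k where
  carrier := X.Tri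
  dg := (inferInstance : DGModule k X.Tri)
  one_mem := mk_mem R.one_mem S.one_mem (Submodule.zero_mem _)
  mul_mem := fun {p q a b} ha hb => by
    obtain ⟨h1, h2, h3⟩ := mem_gr.1 ha
    obtain ⟨h1', h2', h3'⟩ := mem_gr.1 hb
    refine mk_mem (R.mul_mem h1 h1') (S.mul_mem h2 h2') (Submodule.add_mem _ ?_ ?_)
    · have := X.lsmul_mem (gradingSign_mem h1) h3'
      rwa [← add_sub_assoc] at this
    · have := rmul_mem h3 h2'
      rwa [sub_add_eq_add_sub] at this
  leibniz := fun {p a} b ha => by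
    obtain ⟨h1, h2, h3⟩ := mem_gr.1 ha
    refine ext ?_ ?_ ?_
    · simp only [fst_d, fst_mul, map_add, map_zsmul]
      exact R.leibniz _ h1
    · simp only [snd_d, snd_mul, map_add, map_zsmul]
      exact S.leibniz _ h2
    · have hs : sgn (p - 1) = - sgn p := by
        have := sgn_succ (p - 1)
        rw [sub_add_cancel] at this
        rw [this, neg_neg]
      simp only [htpy_d, htpy_mul, fst_mul, snd_mul, map_add, map_zsmul, fst_d, snd_d,
        gradingSign_apply k h1, gradingSign_apply k (d_mem k h1), fromR_apply, fromS_apply,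
        sgn_succ, zsmul_lsmul, X.d_lsmul _ h1, d_rmul _ h3, hs, mul_smul, smul_sub, smul_add,
        sgn_smul_smul, sub_rmul, lsmul_rmul, rmul_rmul, neg_smul, zsmul_rmul]
      abel

variable (X) in
/-- The projection of the triangular algebra to `R`. -/
def toR : alg X ⟶ R :=
  DGAlg.Hom.mk (AlgHom.ofLinearMap (fst X.fromR X.fromS) rfl fun _ _ => rfl)
    (fun h => (mem_gr.1 h).1) fun _ => rfl

variable (X) in
/-- The projection of the triangular algebra to `S`. -/
def toS : alg X ⟶ S :=
  DGAlg.Hom.mk (AlgHom.ofLinearMap (snd X.fromR X.fromS) rfl fun _ _ => rfl)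
    (fun h => (mem_gr.1 h).2.1) fun _ => rfl

end Tri

/-- If `R` is cofibrant and `X` is distinguished, the left multiplication of `R` on the point of `X`
is homotopic, by a derivation, to the right multiplication along a morphism `φ : R → S`: the
projection of the triangular algebra to `R` is a trivial fibration. -/
lemma exists_derivation (hR : R.Cofibrant) (hX : distinguished R S X) :
    ∃ (φ : R ⟶ S) (h : R →ₗ[k] X), (∀ {n : ℤ} {r : R}, r ∈ gr k n → h r ∈ gr k (n - 1)) ∧
      (∀ r r', h (r * r') = gradingSign k R r • h r' + rmul (h r) (DGAlg.Hom.toAlgHom φ r')) ∧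
      ∀ r, h (d k r) = r • X.pt - rmul X.pt (DGAlg.Hom.toAlgHom φ r) - d k (h r) := by
  obtain ⟨σ, hσ⟩ := hR (Tri.toR X) (HPullback.fstHom_isQuasiIso hX)
    (HPullback.fst_surjective X.fromR X.fromS) (𝟙 R)
  have hfst : ∀ r, HPullback.fst X.fromR X.fromS (DGAlg.Hom.toAlgHom σ r) = r := fun r =>
    congrArg (fun τ : R ⟶ R => DGAlg.Hom.toAlgHom τ r) hσ
  refine ⟨σ ≫ Tri.toS X, (HPullback.htpy X.fromR X.fromS).comp
    (DGAlg.Hom.toAlgHom σ).toLinearMap, fun hr => ?_, fun r r' => ?_, fun r => ?_⟩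
  · exact (HPullback.mem_gr.1 (DGAlg.Hom.map_mem σ hr)).2.2
  · have h : HPullback.htpy X.fromR X.fromS (DGAlg.Hom.toAlgHom σ (r * r')) =
        gradingSign k R (HPullback.fst X.fromR X.fromS (DGAlg.Hom.toAlgHom σ r)) •
          HPullback.htpy X.fromR X.fromS (DGAlg.Hom.toAlgHom σ r') +
        rmul (HPullback.htpy X.fromR X.fromS (DGAlg.Hom.toAlgHom σ r))
          (HPullback.snd X.fromR X.fromS (DGAlg.Hom.toAlgHom σ r')) := by
      rw [map_mul]; rfl
    rw [hfst] at h
    exact h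
  · have h : HPullback.htpy X.fromR X.fromS (DGAlg.Hom.toAlgHom σ (d k r)) =
        HPullback.fst X.fromR X.fromS (DGAlg.Hom.toAlgHom σ r) • X.pt -
          rmul X.pt (HPullback.snd X.fromR X.fromS (DGAlg.Hom.toAlgHom σ r)) -
          d k (HPullback.htpy X.fromR X.fromS (DGAlg.Hom.toAlgHom σ r)) := by
      rw [DGAlg.Hom.map_d σ]; rfl
    rw [hfst] at h
    exact h

end PtBimod

end Triangular

/-! ### Mapping path objects of pointed bimodules -/

section MappingPath

variable {k : Type u} [CommRing k] {R S : DGAlg k}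

variable (k) in
/-- The identity of a DG module. -/
def DGHom.id (M : Type u) [AddCommGroup M] [Module k M] [DGModule k M] : DGHom k M M :=
  ⟨LinearMap.id, fun h => h, fun _ => rfl⟩

lemma DGHom.id_apply {M : Type u} [AddCommGroup M] [Module k M] [DGModule k M] (x : M) :
    (DGHom.id k M).toLinearMap x = x := rfl

/-- A map of pointed right DG `S`-modules `Y → X` which is compatible with the left action of `R`
up to a coherent homotopy: `η r y` is a homotopy between `r · g(y)` and `g(r · y)`, and it is a
derivation in `r`. -/
structure PtBimod.HtpyLinear (Y X : PtBimod R S) where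
  g : DGHom k Y X
  η : R →ₗ[k] Y →ₗ[k] X
  map_rmul : ∀ y s, g.toLinearMap (rmul y s) = rmul (g.toLinearMap y) s
  map_pt : g.toLinearMap Y.pt = X.pt
  η_mem : ∀ {p q : ℤ} {r : R} {y : Y}, r ∈ gr k p → y ∈ gr k q → η r y ∈ gr k (p + q - 1)
  η_mul : ∀ r r' y, η (r * r') y = gradingSign k R r • η r' y + η r (r' • y)
  η_rmul : ∀ r y s, η r (rmul y s) = rmul (η r y) s
  η_d : ∀ {p : ℤ} {r : R} (y : Y), r ∈ gr k p →
    η (d k r) y = r • g.toLinearMap y - g.toLinearMap (r • y) - d k (η r y) - sgn p • η r (d k y)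

namespace PtBimod.HtpyLinear

variable {Y X : PtBimod R S} (G : HtpyLinear Y X)

lemma η_one (y : Y) : G.η 1 y = 0 := by
  have h := G.η_mul 1 1 y
  rw [mul_one, DGAlg.gradingSign_one, one_smul, one_smul] at h
  exact left_eq_add.1 h

/-- The underlying DG module of the mapping path object: triples `(x, y, h)` with `h` a homotopy
between `x` and the image of `y`. -/
abbrev Path : Type u := HPullback (DGHom.id k X) G.g

open HPullback

/-- The left action of `R`, twisted by the homotopy `η`. -/
instance : SMul R G.Path where
  smul r a := HPullback.mk _ _ (r • fst _ _ a) (r • snd _ _ a)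
    (gradingSign k R r • htpy _ _ a + G.η r (snd _ _ a))

@[simp] lemma fst_lsmul (r : R) (a : G.Path) : fst _ _ (r • a) = r • fst _ _ a := rfl
@[simp] lemma snd_lsmul (r : R) (a : G.Path) : snd _ _ (r • a) = r • snd _ _ a := rfl
@[simp] lemma htpy_lsmul (r : R) (a : G.Path) : htpy _ _ (r • a) =
    gradingSign k R r • htpy _ _ a + G.η r (snd _ _ a) := rfl

instance : Module R G.Path where
  one_smul a := ext (by simp) (by simp) (by simp [η_one, DGAlg.gradingSign_one])
  mul_smul r r' a := ext (by simp [mul_smul]) (by simp [mul_smul]) (by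
    simp only [htpy_lsmul, snd_lsmul, DGAlg.gradingSign_mul, mul_smul, G.η_mul, smul_add,
      add_assoc])
  smul_zero r := ext (by simp) (by simp) (by simp)
  smul_add r a b := ext (by simp) (by simp) (by
    simp only [htpy_lsmul, map_add, smul_add]; abel)
  add_smul r r' a := ext (by simp [add_smul]) (by simp [add_smul]) (by
    simp only [htpy_lsmul, map_add, add_smul, LinearMap.add_apply]; abel)
  zero_smul a := ext (by simp) (by simp) (by simp)

instance : Module (S.carrier)ᵐᵒᵖ G.Path := inferInstanceAs (Module (S.carrier)ᵐᵒᵖ (X × Y × X))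

@[simp] lemma fst_rsmul (s : S) (a : G.Path) :
    fst _ _ (MulOpposite.op s • a) = rmul (fst _ _ a) s := rfl
@[simp] lemma snd_rsmul (s : S) (a : G.Path) :
    snd _ _ (MulOpposite.op s • a) = rmul (snd _ _ a) s := rfl
@[simp] lemma htpy_rsmul (s : S) (a : G.Path) :
    htpy _ _ (MulOpposite.op s • a) = rmul (htpy _ _ a) s := rfl

/-- The mapping path object of a homotopy linear map, as a pointed bimodule. -/
def path : PtBimod R S where
  carrier := G.Path
  dg := (inferInstance : DGModule k G.Path)
  leftTower := ⟨fun c r a => ext (by simp) (by simp) (by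
    simp only [htpy_lsmul, map_smul, smul_assoc, LinearMap.smul_apply, smul_add])⟩
  rightTower := inferInstanceAs (IsScalarTower k (S.carrier)ᵐᵒᵖ (X × Y × X))
  comm := ⟨fun r s a => by
    induction s using MulOpposite.rec' with
    | h s =>
      refine ext ?_ ?_ ?_
      · simp [lsmul_rmul]
      · simp [lsmul_rmul]
      · simp [lsmul_rmul, G.η_rmul]⟩
  lsmul_mem := fun {p q r a} hr ha => by
    obtain ⟨h1, h2, h3⟩ := mem_gr.1 ha
    refine mk_mem (X.lsmul_mem hr h1) (Y.lsmul_mem hr h2) (Submodule.add_mem _ ?_ (G.η_mem hr h2))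
    have := X.lsmul_mem (gradingSign_mem hr) h3
    rwa [← add_sub_assoc] at this
  rsmul_mem := fun {p q a s} ha hs => by
    obtain ⟨h1, h2, h3⟩ := mem_gr.1 ha
    have := rmul_mem h3 hs
    rw [sub_add_eq_add_sub] at this
    exact mem_gr.2 ⟨rmul_mem h1 hs, rmul_mem h2 hs, this⟩
  d_lsmul := fun {p r} a hr => by
    refine ext ?_ ?_ ?_
    · simp only [fst_d, fst_lsmul, map_add, map_zsmul]
      exact X.d_lsmul _ hr
    · simp only [snd_d, snd_lsmul, map_add, map_zsmul]
      exact Y.d_lsmul _ hr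
    · simp only [htpy_d, htpy_lsmul, fst_lsmul, snd_lsmul, map_add, map_zsmul, snd_d,
        gradingSign_apply k hr, gradingSign_apply k (d_mem k hr), sgn_succ, zsmul_lsmul,
        X.d_lsmul _ hr, smul_sub, smul_add, sgn_smul_smul, neg_smul, G.η_d _ hr, DGHom.id_apply]
      abel
  d_rsmul := fun {p a} s ha => by
    obtain ⟨h1, h2, h3⟩ := mem_gr.1 ha
    have hs : sgn (p - 1) = - sgn p := by
      have := sgn_succ (p - 1)
      rw [sub_add_cancel] at this
      rw [this, neg_neg]
    refine ext ?_ ?_ ?_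
    · simp only [fst_d, fst_rsmul, map_add, map_zsmul]
      exact d_rmul _ h1
    · simp only [snd_d, snd_rsmul, map_add, map_zsmul]
      exact d_rmul _ h2
    · simp only [htpy_d, htpy_rsmul, fst_rsmul, snd_rsmul, map_add, map_zsmul, d_rmul _ h3, hs,
        G.map_rmul, sub_rmul, DGHom.id_apply, neg_smul]
      abel
  pt := HPullback.mk _ _ X.pt Y.pt 0
  pt_mem := mk_mem X.pt_mem Y.pt_mem (Submodule.zero_mem _)
  d_pt := ext (by simp [X.d_pt]) (by simp [Y.d_pt]) (by simp [G.map_pt, DGHom.id_apply])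

/-- The projection of the mapping path object to the target. -/
def pathFst : G.path ⟶ X :=
  PtBimod.Hom.mk (fst (DGHom.id k X) G.g) (fun _ _ => rfl) (fun _ _ => rfl)
    (fun h => (mem_gr.1 h).1) (fun _ => rfl) rfl

/-- The projection of the mapping path object to the source. -/
def pathSnd : G.path ⟶ Y :=
  PtBimod.Hom.mk (snd (DGHom.id k X) G.g) (fun _ _ => rfl) (fun _ _ => rfl)
    (fun h => (mem_gr.1 h).2.1) (fun _ => rfl) rfl

/-- If `g : Y → X` is a homotopy linear quasi-isomorphism and `X` is cofibrant, then `g` has a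
strictly linear right inverse `ρ` up to a homotopy `K`, which is compatible with the actions. -/
lemma exists_homotopy_section (hX : X.Cofibrant) (hG : G.g.IsQuasiIso) :
    ∃ (ρ : X ⟶ Y) (K : X →ₗ[k] X),
      (∀ {n : ℤ} {x : X}, x ∈ gr k n → K x ∈ gr k (n - 1)) ∧
      (∀ x, K (d k x) = x - G.g.toLinearMap (PtBimod.Hom.toLinearMap ρ x) - d k (K x)) ∧
      K X.pt = 0 ∧
      (∀ x s, K (rmul x s) = rmul (K x) s) ∧
      ∀ r x, K (r • x) = gradingSign k R r • K x + G.η r (PtBimod.Hom.toLinearMap ρ x) := by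
  obtain ⟨σ, hσ⟩ := hX G.pathFst (HPullback.fstHom_isQuasiIso hG)
    (HPullback.fst_surjective (DGHom.id k X) G.g) (𝟙 X)
  have hfst : ∀ x, fst (DGHom.id k X) G.g (PtBimod.Hom.toLinearMap σ x) = x := fun x =>
    congrArg (fun τ : X ⟶ X => PtBimod.Hom.toLinearMap τ x) hσ
  refine ⟨σ ≫ G.pathSnd, (htpy (DGHom.id k X) G.g).comp (PtBimod.Hom.toLinearMap σ),
    fun hx => ?_, fun x => ?_, ?_, fun x s => ?_, fun r x => ?_⟩
  · exact (mem_gr.1 (PtBimod.Hom.map_mem σ hx)).2.2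
  · have h : htpy (DGHom.id k X) G.g (PtBimod.Hom.toLinearMap σ (d k x)) =
        fst (DGHom.id k X) G.g (PtBimod.Hom.toLinearMap σ x) -
        G.g.toLinearMap (snd (DGHom.id k X) G.g (PtBimod.Hom.toLinearMap σ x)) -
        d k (htpy (DGHom.id k X) G.g (PtBimod.Hom.toLinearMap σ x)) := by
      rw [PtBimod.Hom.map_d σ]; rfl
    rw [hfst] at h
    exact h
  · exact congrArg (htpy (DGHom.id k X) G.g) (PtBimod.Hom.map_pt σ)
  · exact congrArg (htpy (DGHom.id k X) G.g) (PtBimod.Hom.map_rmul σ x s)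
  · exact congrArg (htpy (DGHom.id k X) G.g) (PtBimod.Hom.map_lsmul σ r x)

end PtBimod.HtpyLinear

end MappingPath

/-! ### The free algebra on a pointed bimodule: adjunction and homotopies -/

section Free

variable {k : Type u} [CommRing k] {R S : DGAlg k}

/-- The left `R`-module structure on an algebra under `R`. -/
abbrev AlgUnder.leftModule (A : AlgUnder R S) : Module R A.alg :=
  Module.compHom A.alg (DGAlg.Hom.toAlgHom A.fromR).toRingHom

/-- The right `S`-module structure on an algebra under `S`. -/
abbrev AlgUnder.rightModule (A : AlgUnder R S) : Module (S.carrier)ᵐᵒᵖ A.alg :=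
  Module.compHom A.alg (DGAlg.Hom.toAlgHom A.fromS).toRingHom.op

/-- The underlying pointed bimodule of a DG algebra under `R` and `S`; the point is the unit. -/
def AlgUnder.bimod (A : AlgUnder R S) : PtBimod R S where
  carrier := A.alg
  leftModule := A.leftModule
  rightModule := A.rightModule
  leftTower := letI := A.leftModule; ⟨fun c r x => by
    change DGAlg.Hom.toAlgHom A.fromR (c • r) * x = c • (DGAlg.Hom.toAlgHom A.fromR r * x)
    rw [map_smul, smul_mul_assoc]⟩
  rightTower := letI := A.rightModule; ⟨fun c s x => by
    change x * DGAlg.Hom.toAlgHom A.fromS (c • s.unop) =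
      c • (x * DGAlg.Hom.toAlgHom A.fromS s.unop)
    rw [map_smul, mul_smul_comm]⟩
  comm := letI := A.leftModule; letI := A.rightModule; ⟨fun r s x =>
    (mul_assoc (DGAlg.Hom.toAlgHom A.fromR r) x (DGAlg.Hom.toAlgHom A.fromS s.unop)).symm⟩
  lsmul_mem := fun hr hx => A.alg.mul_mem (DGAlg.Hom.map_mem A.fromR hr) hx
  rsmul_mem := fun hx hs => A.alg.mul_mem hx (DGAlg.Hom.map_mem A.fromS hs)
  d_lsmul := fun {p r} x hr => by
    have h := A.alg.leibniz x (DGAlg.Hom.map_mem A.fromR hr)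
    rw [← DGAlg.Hom.map_d A.fromR] at h
    exact h
  d_rsmul := fun {p x} s hx => by
    have h := A.alg.leibniz (DGAlg.Hom.toAlgHom A.fromS s) hx
    rw [← DGAlg.Hom.map_d A.fromS] at h
    exact h
  pt := (1 : A.alg)
  pt_mem := A.alg.one_mem
  d_pt := A.alg.d_one

lemma AlgUnder.bimod_lsmul (A : AlgUnder R S) (r : R) (x : A.bimod) :
    r • x = ((DGAlg.Hom.toAlgHom A.fromR r * (show A.alg from x) : A.alg) : A.bimod) := rfl

lemma AlgUnder.bimod_rmul (A : AlgUnder R S) (x : A.bimod) (s : S) :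
    PtBimod.rmul x s =
      (((show A.alg from x) * DGAlg.Hom.toAlgHom A.fromS s : A.alg) : A.bimod) := rfl

variable {X Y : PtBimod R S}

/-- Two morphisms of DG algebras out of `F(X)` which agree on `X` are equal. -/
lemma FAlg_hom_ext {B : DGAlg k} {a b : FAlg X ⟶ B}
    (h : ∀ x, DGAlg.Hom.toAlgHom a (Fι X x) = DGAlg.Hom.toAlgHom b (Fι X x)) : a = b :=
  DGAlg.Hom.ext (Fhom_ext h)

section Desc

variable (B : DGAlg k) (f : DGHom k X B) (h1 : f.toLinearMap X.pt = 1)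
  (h2 : ∀ (x : X) (s : S), f.toLinearMap x * f.toLinearMap (PtBimod.rmul X.pt s) =
    f.toLinearMap (PtBimod.rmul x s))
  (h3 : ∀ (r : R) (x : X), f.toLinearMap (r • X.pt) * f.toLinearMap x = f.toLinearMap (r • x))

lemma Flift_mem {n : ℤ} {a : FCarrier X} (ha : a ∈ Fgr X n) :
    Flift X f.toLinearMap h1 h2 h3 a ∈ gr k n := by
  unfold Fgr at ha
  induction ha using Submodule.span_induction with
  | mem a ha =>
    induction ha with
    | one => rw [map_one]; exact B.one_mem
    | cons hx _ ih =>
      rw [map_mul, Flift_ι]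
      exact B.mul_mem (f.map_mem hx) ih
  | zero => rw [map_zero]; exact Submodule.zero_mem _
  | add a b _ _ ha hb => rw [map_add]; exact Submodule.add_mem _ ha hb
  | smul c a _ ha => rw [map_smul]; exact Submodule.smul_mem _ _ ha

lemma Flift_d (a : FCarrier X) : Flift X f.toLinearMap h1 h2 h3 (Fd X a) =
    d k (Flift X f.toLinearMap h1 h2 h3 a) := by
  refine F_induction (P := fun a => Flift X f.toLinearMap h1 h2 h3 (Fd X a) =
    d k (Flift X f.toLinearMap h1 h2 h3 a)) a (by simp)
    (fun a b ha hb => by simp [ha, hb]) (fun c a ha => by simp [ha]) (fun n a ha => ?_)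
  induction ha with
  | one => rw [Fd_one, map_zero, map_one, B.d_one]
  | @cons p n x a hx ha ih =>
    rw [F_leibniz a (Fι_mem hx), map_add, map_zsmul, map_mul, map_mul, map_mul, ih, Fd_ι,
      Flift_ι, Flift_ι, B.leibniz _ (f.map_mem hx), f.map_d]

/-- The morphism of DG algebras out of `F(X)` induced by a morphism of DG modules which respects the
relations. -/
def FAlgDesc : FAlg X ⟶ B :=
  DGAlg.Hom.mk (Flift X f.toLinearMap h1 h2 h3) (Flift_mem B f h1 h2 h3) (Flift_d B f h1 h2 h3)

lemma FAlgDesc_ι (x : X) :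
    DGAlg.Hom.toAlgHom (FAlgDesc B f h1 h2 h3) (Fι X x) = f.toLinearMap x :=
  Flift_ι X f.toLinearMap h1 h2 h3 x

end Desc

/-- The morphism `F(X) ⟶ A` adjoint to `X ⟶ A`. -/
def F_desc {A : AlgUnder R S} (f : X ⟶ A.bimod) : (F R S).obj X ⟶ A :=
  AlgUnder.Hom.mk
    (FAlgDesc A.alg (PtBimod.Hom.toDGHom f) (PtBimod.Hom.map_pt f)
      (fun x s => by
        have h := PtBimod.Hom.map_rmul f
        refine ((h x s).trans ?_).symm
        rw [AlgUnder.bimod_rmul]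
        refine congrArg _ ?_
        refine Eq.trans ?_ (h X.pt s).symm
        rw [PtBimod.Hom.map_pt f, AlgUnder.bimod_rmul]
        exact (one_mul (DGAlg.Hom.toAlgHom A.fromS s)).symm)
      (fun r x => by
        have h := PtBimod.Hom.map_lsmul f
        refine ((h r x).trans ?_).symm
        rw [AlgUnder.bimod_lsmul]
        refine congrArg (fun z : A.alg => z * (show A.alg from PtBimod.Hom.toLinearMap f x)) ?_
        refine Eq.trans ?_ (h r X.pt).symm
        rw [PtBimod.Hom.map_pt f, AlgUnder.bimod_lsmul]
        exact (mul_one (DGAlg.Hom.toAlgHom A.fromR r)).symm))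
    (by
      apply DGAlg.Hom.ext
      ext r
      refine (FAlgDesc_ι A.alg _ _ _ _ (r • X.pt)).trans ?_
      refine (PtBimod.Hom.map_lsmul f r X.pt).trans ?_
      rw [PtBimod.Hom.map_pt f]
      exact mul_one (DGAlg.Hom.toAlgHom A.fromR r))
    (by
      apply DGAlg.Hom.ext
      ext s
      refine (FAlgDesc_ι A.alg _ _ _ _ (PtBimod.rmul X.pt s)).trans ?_
      refine (PtBimod.Hom.map_rmul f X.pt s).trans ?_
      rw [PtBimod.Hom.map_pt f]
      exact one_mul (DGAlg.Hom.toAlgHom A.fromS s))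

lemma F_desc_ι {A : AlgUnder R S} (f : X ⟶ A.bimod) (x : X) :
    DGAlg.Hom.toAlgHom (AlgUnder.Hom.hom (F_desc f)) (Fι X x) =
      (PtBimod.Hom.toLinearMap f x : A.bimod) :=
  FAlgDesc_ι A.alg _ _ _ _ x

lemma Fι_lsmul (r : R) (x : X) :
    Fι X (r • x) = FfromRAlg X r * Fι X x := (Fι_left X r x).symm

lemma Fι_rmul (x : X) (s : S) :
    Fι X (PtBimod.rmul x s) = Fι X x * FfromSAlg X s := (Fι_right X x s).symm

/-- The morphism `X ⟶ A` adjoint to `F(X) ⟶ A`. -/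
def F_restrict {A : AlgUnder R S} (φ : (F R S).obj X ⟶ A) : X ⟶ A.bimod :=
  PtBimod.Hom.mk ((DGAlg.Hom.toAlgHom (AlgUnder.Hom.hom φ)).toLinearMap.comp (Fι X))
    (fun r x => by
      have h : DGAlg.Hom.toAlgHom (AlgUnder.Hom.hom φ) (FfromRAlg X r) =
          DGAlg.Hom.toAlgHom A.fromR r :=
        congrArg (fun τ : R ⟶ A.alg => DGAlg.Hom.toAlgHom τ r) (AlgUnder.Hom.fromR_hom φ)
      rw [AlgUnder.bimod_lsmul, ← h]
      refine (congrArg (DGAlg.Hom.toAlgHom (AlgUnder.Hom.hom φ)) (Fι_lsmul r x)).trans ?_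
      exact map_mul (DGAlg.Hom.toAlgHom (AlgUnder.Hom.hom φ)) _ _)
    (fun x s => by
      have h : DGAlg.Hom.toAlgHom (AlgUnder.Hom.hom φ) (FfromSAlg X s) =
          DGAlg.Hom.toAlgHom A.fromS s :=
        congrArg (fun τ : S ⟶ A.alg => DGAlg.Hom.toAlgHom τ s) (AlgUnder.Hom.fromS_hom φ)
      rw [AlgUnder.bimod_rmul, ← h]
      refine (congrArg (DGAlg.Hom.toAlgHom (AlgUnder.Hom.hom φ)) (Fι_rmul x s)).trans ?_
      exact map_mul (DGAlg.Hom.toAlgHom (AlgUnder.Hom.hom φ)) _ _)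
    (fun {n x} hx => DGAlg.Hom.map_mem (AlgUnder.Hom.hom φ) (Fι_mem hx : Fι X x ∈ Fgr X n))
    (fun x => by
      refine Eq.trans ?_ (DGAlg.Hom.map_d (AlgUnder.Hom.hom φ) (Fι X x))
      exact congrArg (DGAlg.Hom.toAlgHom (AlgUnder.Hom.hom φ)) (Fd_ι x).symm)
    ((congrArg (DGAlg.Hom.toAlgHom (AlgUnder.Hom.hom φ)) (Fι_pt X)).trans
      (map_one (DGAlg.Hom.toAlgHom (AlgUnder.Hom.hom φ))))

/-- The map of pointed bimodules underlying a morphism of algebras under `R` and `S`. -/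
def AlgUnder.bimodMap {A B : AlgUnder R S} (p : A ⟶ B) : A.bimod ⟶ B.bimod :=
  PtBimod.Hom.mk (DGAlg.Hom.toAlgHom (AlgUnder.Hom.hom p)).toLinearMap
    (fun r x => by
      have h : DGAlg.Hom.toAlgHom (AlgUnder.Hom.hom p) (DGAlg.Hom.toAlgHom A.fromR r) =
          DGAlg.Hom.toAlgHom B.fromR r :=
        congrArg (fun τ : R ⟶ B.alg => DGAlg.Hom.toAlgHom τ r) (AlgUnder.Hom.fromR_hom p)
      exact (map_mul (DGAlg.Hom.toAlgHom (AlgUnder.Hom.hom p)) _ _).trans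
        (congrArg (fun z : B.alg => z * DGAlg.Hom.toAlgHom (AlgUnder.Hom.hom p) x) h))
    (fun x s => by
      have h : DGAlg.Hom.toAlgHom (AlgUnder.Hom.hom p) (DGAlg.Hom.toAlgHom A.fromS s) =
          DGAlg.Hom.toAlgHom B.fromS s :=
        congrArg (fun τ : S ⟶ B.alg => DGAlg.Hom.toAlgHom τ s) (AlgUnder.Hom.fromS_hom p)
      exact (map_mul (DGAlg.Hom.toAlgHom (AlgUnder.Hom.hom p)) _ _).trans
        (congrArg (fun z : B.alg => DGAlg.Hom.toAlgHom (AlgUnder.Hom.hom p) x * z) h))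
    (DGAlg.Hom.map_mem (AlgUnder.Hom.hom p)) (DGAlg.Hom.map_d (AlgUnder.Hom.hom p))
    (map_one (DGAlg.Hom.toAlgHom (AlgUnder.Hom.hom p)))

/-- `F` preserves cofibrant objects, since its right adjoint preserves trivial fibrations. -/
lemma F_cofibrant (hX : X.Cofibrant) : ((F R S).obj X).Cofibrant := by
  intro A B p hp hp' f
  obtain ⟨g, hg⟩ := hX (AlgUnder.bimodMap p) hp hp' (F_restrict f)
  refine ⟨F_desc g, AlgUnder.Hom.ext (FAlg_hom_ext fun x => ?_)⟩
  refine (congrArg (DGAlg.Hom.toAlgHom (AlgUnder.Hom.hom p)) (F_desc_ι g x)).trans ?_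
  exact congrArg (fun τ : X ⟶ B.bimod => PtBimod.Hom.toLinearMap τ x) hg

/-- A homotopy on the generators of `F(X)` between two morphisms `a`, `b` of DG algebras which is
compatible with the relations extends to all of `F(X)`, as an `(a, b)`-derivation: together with
`a` and `b` it is a morphism to the path object of `B`, which is the triangular algebra of `B`
over itself. -/
lemma F_mapH_eq_of_homotopy {B : DGAlg k} (a b : FAlg X ⟶ B) (K : X →ₗ[k] B)
    (hK : ∀ {n : ℤ} {x : X}, x ∈ gr k n → K x ∈ gr k (n - 1))
    (hd : ∀ x, K (d k x) =
      DGAlg.Hom.toAlgHom a (Fι X x) - DGAlg.Hom.toAlgHom b (Fι X x) - d k (K x))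
    (hpt : K X.pt = 0)
    (hright : ∀ x s, K (PtBimod.rmul x s) =
      K x * DGAlg.Hom.toAlgHom b (Fι X (PtBimod.rmul X.pt s)))
    (hleft : ∀ (r : R) x, K (r • x) =
      gradingSign k B (DGAlg.Hom.toAlgHom a (Fι X (r • X.pt))) * K x +
        K (r • X.pt) * DGAlg.Hom.toAlgHom b (Fι X x)) (n : ℤ) :
    ((DGAlg.Hom.toDGHom a).mapH n : H k (FAlg X) n → H k B n) = (DGAlg.Hom.toDGHom b).mapH n := by
  let B' : PtBimod B B := AlgUnder.bimod ⟨B, 𝟙 B, 𝟙 B⟩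
  have hpt' : ∀ s, K (PtBimod.rmul X.pt s) = 0 := fun s => by rw [hright, hpt, zero_mul]
  have ha_one : DGAlg.Hom.toAlgHom a (Fι X X.pt) = 1 := by rw [Fι_pt]; exact map_one _
  have hb_one : DGAlg.Hom.toAlgHom b (Fι X X.pt) = 1 := by rw [Fι_pt]; exact map_one _
  let f : DGHom k X (PtBimod.Tri.alg B') :=
    { toLinearMap := HPullback.mkLin B'.fromR B'.fromS
        ((DGAlg.Hom.toAlgHom a).toLinearMap.comp (Fι X))
        ((DGAlg.Hom.toAlgHom b).toLinearMap.comp (Fι X)) K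
      map_mem := fun {n x} hx => HPullback.mk_mem
        (DGAlg.Hom.map_mem a (Fι_mem hx : Fι X x ∈ Fgr X n))
        (DGAlg.Hom.map_mem b (Fι_mem hx : Fι X x ∈ Fgr X n)) (hK hx)
      map_d := fun x => by
        have e1 : DGAlg.Hom.toAlgHom a (Fι X (d k x)) = d k (DGAlg.Hom.toAlgHom a (Fι X x)) := by
          rw [← Fd_ι]; exact DGAlg.Hom.map_d a _
        have e2 : DGAlg.Hom.toAlgHom b (Fι X (d k x)) = d k (DGAlg.Hom.toAlgHom b (Fι X x)) := by
          rw [← Fd_ι]; exact DGAlg.Hom.map_d b _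
        refine HPullback.ext (v := B'.fromR) (w := B'.fromS) e1 e2 ((hd x).trans ?_)
        refine congrArg₂ (fun y z : B => y - z - d k (K x)) ?_ ?_
        · exact (mul_one _).symm
        · exact (one_mul _).symm }
  have hf2 : ∀ (x : X) (s : S), f.toLinearMap x * f.toLinearMap (PtBimod.rmul X.pt s) =
      f.toLinearMap (PtBimod.rmul x s) := fun x s => by
    refine HPullback.ext (v := B'.fromR) (w := B'.fromS) ?_ ?_ ?_
    · refine Eq.trans ?_ (congrArg (DGAlg.Hom.toAlgHom a) (Fι_right X x s))
      exact (map_mul (DGAlg.Hom.toAlgHom a) _ _).symm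
    · refine Eq.trans ?_ (congrArg (DGAlg.Hom.toAlgHom b) (Fι_right X x s))
      exact (map_mul (DGAlg.Hom.toAlgHom b) _ _).symm
    · change gradingSign k B _ * K (PtBimod.rmul X.pt s) +
        K x * DGAlg.Hom.toAlgHom b (Fι X (PtBimod.rmul X.pt s)) = K (PtBimod.rmul x s)
      rw [hpt', mul_zero, zero_add, hright]
  have hf3 : ∀ (r : R) (x : X), f.toLinearMap (r • X.pt) * f.toLinearMap x =
      f.toLinearMap (r • x) := fun r x => by
    refine HPullback.ext (v := B'.fromR) (w := B'.fromS) ?_ ?_ ?_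
    · refine Eq.trans ?_ (congrArg (DGAlg.Hom.toAlgHom a) (Fι_left X r x))
      exact (map_mul (DGAlg.Hom.toAlgHom a) _ _).symm
    · refine Eq.trans ?_ (congrArg (DGAlg.Hom.toAlgHom b) (Fι_left X r x))
      exact (map_mul (DGAlg.Hom.toAlgHom b) _ _).symm
    · exact (hleft r x).symm
  let Φ : FAlg X ⟶ PtBimod.Tri.alg B' :=
    FAlgDesc (PtBimod.Tri.alg B') f
      (HPullback.ext (v := B'.fromR) (w := B'.fromS) ha_one hb_one hpt) hf2 hf3
  have hΦ : ∀ x, DGAlg.Hom.toAlgHom Φ (Fι X x) = f.toLinearMap x := FAlgDesc_ι _ f _ _ _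
  have hΦa : Φ ≫ PtBimod.Tri.toR B' = a := FAlg_hom_ext fun x =>
    congrArg (HPullback.fst B'.fromR B'.fromS) (hΦ x)
  have hΦb : Φ ≫ PtBimod.Tri.toS B' = b := FAlg_hom_ext fun x =>
    congrArg (HPullback.snd B'.fromR B'.fromS) (hΦ x)
  refine DGHom.mapH_eq_of_homotopy _ _ ((HPullback.htpy B'.fromR B'.fromS).comp
    (DGAlg.Hom.toAlgHom Φ).toLinearMap)
    (fun hx => (HPullback.mem_gr.1 (DGAlg.Hom.map_mem Φ hx)).2.2) (fun x => ?_) n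
  refine (congrArg (HPullback.htpy B'.fromR B'.fromS) (DGAlg.Hom.map_d Φ x)).trans ?_
  rw [← hΦa, ← hΦb]
  refine congrArg₂ (fun y z : B' => y - z -
    d k (HPullback.htpy B'.fromR B'.fromS (DGAlg.Hom.toAlgHom Φ x))) ?_ ?_
  · exact mul_one (HPullback.fst B'.fromR B'.fromS (DGAlg.Hom.toAlgHom Φ x) : B)
  · exact one_mul (HPullback.snd B'.fromR B'.fromS (DGAlg.Hom.toAlgHom Φ x) : B)

end Free

/-! ### `F` on cofibrant objects -/

section Cofibrant

variable {k : Type u} [CommRing k] {R S : DGAlg k} {X Y : PtBimod R S}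

lemma F_map_ι (f : X ⟶ Y) (x : X) :
    DGAlg.Hom.toAlgHom (AlgUnder.Hom.hom ((F R S).map f)) (Fι X x) =
      Fι Y (PtBimod.Hom.toLinearMap f x) := FmapAlg_ι f x

/-- A morphism of pointed bimodules, as a homotopy linear map with trivial homotopy. -/
def PtBimod.HtpyLinear.ofHom (w : Y ⟶ X) : PtBimod.HtpyLinear Y X where
  g := PtBimod.Hom.toDGHom w
  η := 0
  map_rmul := PtBimod.Hom.map_rmul w
  map_pt := PtBimod.Hom.map_pt w
  η_mem := fun _ _ => Submodule.zero_mem _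
  η_mul := fun _ _ _ => by simp
  η_rmul := fun _ _ _ => by simp
  η_d := fun {p r} y _ => by
    have h : r • (PtBimod.Hom.toDGHom w).toLinearMap y -
        (PtBimod.Hom.toDGHom w).toLinearMap (r • y) = 0 :=
      sub_eq_zero.2 (PtBimod.Hom.map_lsmul w r y).symm
    simp [h]

variable (X) in
/-- The canonical map `X → F(X)`, with values in the DG algebra `F(X)`. -/
def FAlgι : X →ₗ[k] FAlg X := Fι X

lemma FAlgι_rmul (x : X) (s : S) :
    FAlgι X (PtBimod.rmul x s) = FAlgι X x * FAlgι X (PtBimod.rmul X.pt s) :=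
  (Fι_right X x s).symm

lemma FAlgι_lsmul (r : R) (x : X) : FAlgι X (r • x) = FAlgι X (r • X.pt) * FAlgι X x :=
  (Fι_left X r x).symm

lemma FAlgι_d (x : X) : FAlgι X (d k x) = d k (FAlgι X x) := (Fd_ι x).symm

lemma FAlgι_mem {n : ℤ} {x : X} (hx : x ∈ gr k n) : FAlgι X x ∈ gr k n :=
  (Fι_mem hx : Fι X x ∈ Fgr X n)

lemma gradingSign_FAlgι (x : X) :
    gradingSign k (FAlg X) (FAlgι X x) = FAlgι X (gradingSign k X x) := by
  refine linearMap_ext_gr (f := (gradingSign k (FAlg X)).comp (FAlgι X))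
    (g := (FAlgι X).comp (gradingSign k X)) (fun p x hx => ?_) x
  rw [LinearMap.comp_apply, LinearMap.comp_apply, gradingSign_apply k (FAlgι_mem hx),
    gradingSign_apply k hx, map_zsmul]

lemma PtBimod.gradingSign_lsmul_pt (r : R) :
    gradingSign k X (r • X.pt) = gradingSign k R r • X.pt := by
  refine linearMap_ext_gr (f := (gradingSign k X).comp X.fromR.toLinearMap)
    (g := X.fromR.toLinearMap.comp (gradingSign k R)) (fun p r hr => ?_) r
  rw [LinearMap.comp_apply, LinearMap.comp_apply, gradingSign_apply k (X.fromR.map_mem hr),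
    gradingSign_apply k hr, map_zsmul]

/-- A homotopy `K : X → X` between the identity and a map `t`, compatible with the relations of
`F(X)`, shows that the endomorphism of `F(X)` which extends `t` is the identity on cohomology. -/
lemma F_mapH_eq_id (b : FAlg X ⟶ FAlg X) (t : X → X) (K : X →ₗ[k] X)
    (hb : ∀ x, DGAlg.Hom.toAlgHom b (FAlgι X x) = FAlgι X (t x))
    (ht : ∀ s, t (PtBimod.rmul X.pt s) = PtBimod.rmul X.pt s)
    (hK : ∀ {n : ℤ} {x : X}, x ∈ gr k n → K x ∈ gr k (n - 1))
    (hd : ∀ x, K (d k x) = x - t x - d k (K x)) (hpt : K X.pt = 0)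
    (hr : ∀ x s, K (PtBimod.rmul x s) = PtBimod.rmul (K x) s)
    (hl : ∀ (r : R) x, FAlgι X (K (r • x)) = FAlgι X (gradingSign k R r • K x) +
      FAlgι X (K (r • X.pt)) * FAlgι X (t x)) (n : ℤ) :
    ((DGAlg.Hom.toDGHom b).mapH n : H k (FAlg X) n → H k (FAlg X) n) = id := by
  have h := F_mapH_eq_of_homotopy (𝟙 (FAlg X)) b ((FAlgι X).comp K)
    (fun hx => FAlgι_mem (hK hx)) (fun x => ?_) ((congrArg (FAlgι X) hpt).trans (map_zero _))
    (fun x s => ?_) (fun r x => ?_) n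
  · rw [← h]
    exact DGHom.mapH_eq_id _ (fun _ => rfl) n
  · change FAlgι X (K (d k x)) =
      FAlgι X x - DGAlg.Hom.toAlgHom b (FAlgι X x) - d k (FAlgι X (K x))
    rw [hd, hb, map_sub, map_sub, FAlgι_d]
  · change FAlgι X (K (PtBimod.rmul x s)) =
      FAlgι X (K x) * DGAlg.Hom.toAlgHom b (FAlgι X (PtBimod.rmul X.pt s))
    rw [hb, ht, hr, FAlgι_rmul]
  · change FAlgι X (K (r • x)) =
      gradingSign k (FAlg X) (FAlgι X (r • X.pt)) * FAlgι X (K x) +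
        FAlgι X (K (r • X.pt)) * DGAlg.Hom.toAlgHom b (FAlgι X x)
    rw [hb, hl, gradingSign_FAlgι, PtBimod.gradingSign_lsmul_pt, FAlgι_lsmul _ (K x)]

/-- A quasi-isomorphism `w` to a cofibrant object has a right inverse on which `F` is a right
inverse in cohomology. -/
lemma exists_section_mapH (hX : X.Cofibrant) (w : Y ⟶ X) (hw : PtBimod.quasiIso R S w) :
    ∃ ρ : X ⟶ Y, PtBimod.quasiIso R S ρ ∧ ∀ n : ℤ, Function.RightInverse
      ((DGAlg.Hom.toDGHom (AlgUnder.Hom.hom ((F R S).map ρ))).mapH n)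
      ((DGAlg.Hom.toDGHom (AlgUnder.Hom.hom ((F R S).map w))).mapH n) := by
  obtain ⟨ρ, K, hK, hd, hpt, hr, hl⟩ :=
    (PtBimod.HtpyLinear.ofHom w).exists_homotopy_section hX hw
  refine ⟨ρ, ?_, fun n => ?_⟩
  · have h : (PtBimod.Hom.toDGHom (ρ ≫ w)).IsQuasiIso := fun n => by
      rw [← DGHom.mapH_eq_of_homotopy (DGHom.id k X) (PtBimod.Hom.toDGHom (ρ ≫ w)) K hK hd n,
        DGHom.mapH_eq_id _ (fun _ => rfl)]
      exact Function.bijective_id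
    exact h.of_comp_left hw fun _ => rfl
  · have hl' : ∀ (r : R) (x : X), K (r • x) = gradingSign k R r • K x := fun r x => by
      rw [hl]; simp [PtBimod.HtpyLinear.ofHom]
    have h := F_mapH_eq_id (AlgUnder.Hom.hom ((F R S).map (ρ ≫ w)))
      (fun x => PtBimod.Hom.toLinearMap (ρ ≫ w) x) K (F_map_ι (ρ ≫ w))
      (fun s => by rw [PtBimod.Hom.map_rmul (ρ ≫ w), PtBimod.Hom.map_pt (ρ ≫ w)])
      hK hd hpt hr (fun r x => by
        rw [hl' r x, hl' r X.pt, hpt, smul_zero, map_zero, zero_mul, add_zero]) n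
    refine congrFun (Eq.trans ?_ h)
    refine (DGHom.mapH_eq_comp _ _ _ (fun x => ?_) n).symm
    exact congrArg (fun τ : (F R S).obj X ⟶ (F R S).obj X =>
      DGAlg.Hom.toAlgHom (AlgUnder.Hom.hom τ) x) ((F R S).map_comp ρ w)

/-- `F` preserves quasi-isomorphisms between cofibrant objects. -/
lemma F_quasiIso (hX : X.Cofibrant) (hY : Y.Cofibrant) (w : Y ⟶ X)
    (hw : PtBimod.quasiIso R S w) : AlgUnder.quasiIso R S ((F R S).map w) := by
  obtain ⟨ρ, hρ, h⟩ := exists_section_mapH hX w hw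
  obtain ⟨σ, -, h'⟩ := exists_section_mapH hY ρ hρ
  -- `F ρ` is injective and surjective on cohomology, and `F w` is its one-sided inverse
  intro n
  have hbij : Function.Bijective
      ((DGAlg.Hom.toDGHom (AlgUnder.Hom.hom ((F R S).map ρ))).mapH n) :=
    ⟨(h n).injective, (h' n).surjective⟩
  refine (Function.Bijective.of_comp_iff _ hbij).1 ?_
  rw [(h n).comp_eq_id]
  exact Function.bijective_id

/-- The algebra `S` with left action of `R` along `φ`. -/
def AlgUnder.ofHom (φ : R ⟶ S) : AlgUnder R S := ⟨S, φ, 𝟙 S⟩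

/-- The map `S → X`, `s ↦ 1 · s`, is homotopy linear for the left action of `R` on `S` along `φ`,
if a derivation `h` makes the left action on the point homotopic to `φ`. -/
def PtBimod.HtpyLinear.ofDerivation (φ : R ⟶ S) (h : R →ₗ[k] X)
    (hmem : ∀ {n : ℤ} {r : R}, r ∈ gr k n → h r ∈ gr k (n - 1))
    (hmul : ∀ r r', h (r * r') = gradingSign k R r • h r' +
      PtBimod.rmul (h r) (DGAlg.Hom.toAlgHom φ r'))
    (hd : ∀ r, h (d k r) = r • X.pt - PtBimod.rmul X.pt (DGAlg.Hom.toAlgHom φ r) - d k (h r)) :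
    PtBimod.HtpyLinear (AlgUnder.ofHom φ).bimod X where
  g := X.fromS
  η := X.rmulHom.comp h
  map_rmul := fun y s => (PtBimod.rmul_rmul X.pt (show S from y) s).symm
  map_pt := PtBimod.rmul_one X.pt
  η_mem := fun {p q r y} hr hy => by
    have := PtBimod.rmul_mem (hmem hr) (show (show S from y) ∈ gr k q from hy)
    rwa [sub_add_eq_add_sub] at this
  η_mul := fun r r' y => by
    change PtBimod.rmul (h (r * r')) (show S from y) =
      gradingSign k R r • PtBimod.rmul (h r') (show S from y) +
      PtBimod.rmul (h r) (DGAlg.Hom.toAlgHom φ r' * (show S from y))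
    rw [hmul, PtBimod.add_rmul, PtBimod.rmul_rmul, PtBimod.lsmul_rmul]
  η_rmul := fun r y s => (PtBimod.rmul_rmul (h r) (show S from y) s).symm
  η_d := fun {p r} y hr => by
    change PtBimod.rmul (h (d k r)) (show S from y) =
      r • PtBimod.rmul X.pt (show S from y) -
      PtBimod.rmul X.pt (DGAlg.Hom.toAlgHom φ r * (show S from y)) -
      d k (PtBimod.rmul (h r) (show S from y)) -
      sgn p • PtBimod.rmul (h r) (d k (show S from y))
    have hs : sgn (p - 1) = - sgn p := by
      have := sgn_succ (p - 1)
      rw [sub_add_cancel] at this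
      rw [this, neg_neg]
    rw [hd, PtBimod.d_rmul _ (hmem hr), hs, PtBimod.sub_rmul, PtBimod.sub_rmul, PtBimod.rmul_rmul,
      PtBimod.lsmul_rmul, neg_smul]
    abel

/-- The map `S → F(X)` is a homotopy equivalence if `X` is cofibrant and distinguished: the
derivation of `exists_derivation` makes `S → X` homotopy linear, hence it has a strict right inverse
`ρ` up to homotopy, and the homotopy extends to `F(X)`. -/
lemma F_distinguished (hR : R.Cofibrant) (hX : X.Cofibrant) (hX' : PtBimod.distinguished R S X) :
    AlgUnder.distinguished R S ((F R S).obj X) := by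
  obtain ⟨φ, h, hmem, hmul, hdh⟩ := PtBimod.exists_derivation hR hX'
  obtain ⟨ρ, K, hK, hd, hpt, hr, hl⟩ :=
    (PtBimod.HtpyLinear.ofDerivation φ h hmem hmul hdh).exists_homotopy_section hX hX'
  let ρ' : FAlg X ⟶ S := AlgUnder.Hom.hom (F_desc ρ)
  have hρ' : FfromS X ≫ ρ' = 𝟙 S := AlgUnder.Hom.fromS_hom (F_desc ρ)
  have hρι : ∀ x, DGAlg.Hom.toAlgHom ρ' (Fι X x) = PtBimod.Hom.toLinearMap ρ x := F_desc_ι ρ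
  have hKpt : ∀ r : R, K (r • X.pt) = h r := fun r => by
    rw [hl, hpt, smul_zero, zero_add, PtBimod.Hom.map_pt ρ]
    exact PtBimod.rmul_one _
  have hH := F_mapH_eq_id (ρ' ≫ FfromS X)
    (fun x => PtBimod.rmul X.pt (show S from PtBimod.Hom.toLinearMap ρ x)) K
    (fun x => congrArg (FfromSAlg X) (hρι x))
    (fun s => by
      have e : (show S from PtBimod.Hom.toLinearMap ρ (PtBimod.rmul X.pt s)) = s := by
        rw [PtBimod.Hom.map_rmul ρ, PtBimod.Hom.map_pt ρ]
        exact one_mul s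
      rw [e]) hK hd hpt hr
    (fun r x => by
      rw [hl, hKpt, map_add, ← FAlgι_rmul]
      rfl)
  intro n
  have e1 := hH n
  rw [DGHom.mapH_eq_comp (DGAlg.Hom.toDGHom ρ') (DGAlg.Hom.toDGHom (FfromS X)) _
    (fun _ => rfl)] at e1
  have e2 : ((DGAlg.Hom.toDGHom ρ').mapH n : H k (FAlg X) n → H k S n) ∘
      (DGAlg.Hom.toDGHom (FfromS X)).mapH n = id := by
    rw [← DGHom.mapH_eq_comp _ _ (DGAlg.Hom.toDGHom (FfromS X ≫ ρ')) (fun _ => rfl), hρ']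
    exact DGHom.mapH_eq_id _ (fun _ => rfl) n
  exact Function.bijective_iff_has_inverse.2 ⟨_, congrFun e2, congrFun e1⟩

end Cofibrant

/-! ### Semifree bimodules -/

section Semifree

lemma sgn_eq_or (n : ℤ) : sgn n = 1 ∨ sgn n = -1 := by
  rcases Int.units_eq_one_or n.negOnePow with h | h <;> simp [sgn, h]

open TensorProduct

variable {k : Type u} [CommRing k] (R S : DGAlg k)

/-- The free `R`-`S`-bimodule on a type `E`. -/
def FreeBimod (E : Type u) : Type u := E →₀ (R.carrier ⊗[k] S.carrier)

lemma sgn_one : sgn 1 = -1 := by simp [sgn]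

namespace FreeBimod

variable {R S} {E : Type u}

instance : AddCommGroup (FreeBimod R S E) :=
  inferInstanceAs (AddCommGroup (E →₀ (R.carrier ⊗[k] S.carrier)))

instance : Module k (FreeBimod R S E) :=
  inferInstanceAs (Module k (E →₀ (R.carrier ⊗[k] S.carrier)))

instance : Module R (FreeBimod R S E) :=
  inferInstanceAs (Module R.carrier (E →₀ (R.carrier ⊗[k] S.carrier)))

instance : IsScalarTower k R (FreeBimod R S E) :=
  inferInstanceAs (IsScalarTower k R.carrier (E →₀ (R.carrier ⊗[k] S.carrier)))

variable (R S) in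
/-- The element `r · c · s` of the free bimodule, as a bilinear map in `r` and `s`. -/
def gen (c : E) : R →ₗ[k] S →ₗ[k] FreeBimod R S E :=
  (TensorProduct.mk k R.carrier S.carrier).compr₂ (Finsupp.lsingle c)

lemma lsmul_gen (r' r : R) (c : E) (s : S) : r' • gen R S c r s = gen R S c (r' * r) s :=
  (Finsupp.smul_single r' c (r ⊗ₜ[k] s)).trans
    (congrArg (Finsupp.single c) (TensorProduct.smul_tmul' r' r s))

variable {P : Type u} [AddCommGroup P] [Module k P]

/-- The linear map with prescribed values on the elements `r · c · s`. -/
def lift (f : E → R →ₗ[k] S →ₗ[k] P) : FreeBimod R S E →ₗ[k] P :=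
  Finsupp.lsum k fun c => TensorProduct.lift (f c)

@[simp] lemma lift_gen (f : E → R →ₗ[k] S →ₗ[k] P) (c : E) (r : R) (s : S) :
    lift f (gen R S c r s) = f c r s :=
  (Finsupp.lsum_single k (fun c => TensorProduct.lift (f c)) c (r ⊗ₜ[k] s)).trans
    (TensorProduct.lift.tmul r s)

/-- Linear maps which agree on the elements `r · c · s` with `r`, `s` homogeneous are equal. -/
lemma linearMap_ext {f g : FreeBimod R S E →ₗ[k] P}
    (h : ∀ (c : E) (p q : ℤ) (r : R) (s : S), r ∈ gr k p → s ∈ gr k q →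
      f (gen R S c r s) = g (gen R S c r s)) (x : FreeBimod R S E) : f x = g x := by
  refine LinearMap.congr_fun (Finsupp.lhom_ext' fun c => TensorProduct.ext' fun r s => ?_) x
  refine linearMap_ext_gr (f := f.comp ((gen R S c).flip s)) (g := g.comp ((gen R S c).flip s))
    (fun p r hr => ?_) r
  exact linearMap_ext_gr (f := f.comp (gen R S c r)) (g := g.comp (gen R S c r))
    (fun q s hs => h c p q r s hr hs) s

lemma linearMap_ext' {f g : FreeBimod R S E →ₗ[k] P}
    (h : ∀ (c : E) (r : R) (s : S), f (gen R S c r s) = g (gen R S c r s)) : f = g :=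
  LinearMap.ext (linearMap_ext fun c _ _ r s _ _ => h c r s)

/-- Right multiplication by an element of `S`. -/
def rmulLin (t : S) : FreeBimod R S E →ₗ[k] FreeBimod R S E :=
  lift fun c => (gen R S c).compl₂ (LinearMap.mulRight k t)

@[simp] lemma rmulLin_gen (c : E) (r : R) (s t : S) :
    rmulLin t (gen R S c r s) = gen R S c r (s * t) := lift_gen _ _ _ _

instance : Module (S.carrier)ᵐᵒᵖ (FreeBimod R S E) where
  smul t x := rmulLin t.unop x
  one_smul x := LinearMap.congr_fun (linearMap_ext' (f := rmulLin 1) (g := LinearMap.id)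
    fun c r s => by simp) x
  mul_smul t t' x := LinearMap.congr_fun (linearMap_ext' (f := rmulLin (t'.unop * t.unop))
    (g := (rmulLin t.unop).comp (rmulLin t'.unop)) fun c r s => by simp [mul_assoc]) x
  smul_zero t := map_zero _
  smul_add t x y := map_add _ x y
  add_smul t t' x := LinearMap.congr_fun (linearMap_ext' (f := rmulLin (t + t').unop)
    (g := rmulLin t.unop + rmulLin t'.unop) fun c r s => by simp [mul_add]) x
  zero_smul x := LinearMap.congr_fun (linearMap_ext' (f := rmulLin 0) (g := 0)
    fun c r s => by simp) x

lemma op_smul_gen (c : E) (r : R) (s t : S) :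
    MulOpposite.op t • gen R S c r s = gen R S c r (s * t) := rmulLin_gen c r s t

lemma op_smul_eq (t : S) (x : FreeBimod R S E) : MulOpposite.op t • x = rmulLin t x := rfl

instance : IsScalarTower k (S.carrier)ᵐᵒᵖ (FreeBimod R S E) where
  smul_assoc a t x := LinearMap.congr_fun (linearMap_ext' (f := rmulLin (a • t.unop))
    (g := a • rmulLin t.unop) fun c r s => by simp) x

/-- Left multiplication by an element of `R`. -/
def lmulLin (r' : R) : FreeBimod R S E →ₗ[k] FreeBimod R S E where
  toFun x := r' • x
  map_add' := smul_add r'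
  map_smul' a x := by
    rw [RingHom.id_apply, ← algebraMap_smul R.carrier a x,
      ← algebraMap_smul R.carrier a (r' • x), smul_smul, smul_smul, Algebra.commutes]

@[simp] lemma lmulLin_apply (r' : R) (x : FreeBimod R S E) : lmulLin r' x = r' • x := rfl

instance : SMulCommClass R (S.carrier)ᵐᵒᵖ (FreeBimod R S E) where
  smul_comm r' t x := LinearMap.congr_fun (linearMap_ext'
    (f := (lmulLin r').comp (rmulLin t.unop)) (g := (rmulLin t.unop).comp (lmulLin r'))
    fun c r s => by simp [lsmul_gen]) x

section Grading

variable (deg : E → ℤ)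

variable (R S) in
/-- The grading of the free bimodule on generators of given degrees. -/
def grading (n : ℤ) : Submodule k (FreeBimod R S E) :=
  Submodule.span k {x | ∃ (c : E) (p q : ℤ) (r : R) (s : S), r ∈ gr k p ∧ s ∈ gr k q ∧
    p + deg c + q = n ∧ x = gen R S c r s}

lemma gen_mem {n : ℤ} {c : E} {p q : ℤ} {r : R} {s : S} (hr : r ∈ gr k p) (hs : s ∈ gr k q)
    (h : p + deg c + q = n) : gen R S c r s ∈ grading R S deg n :=
  Submodule.subset_span ⟨c, p, q, r, s, hr, hs, h, rfl⟩

variable {deg} in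
lemma grading_induction {n : ℤ} {Q : FreeBimod R S E → Prop} {x : FreeBimod R S E}
    (hx : x ∈ grading R S deg n) (zero : Q 0) (add : ∀ x y, Q x → Q y → Q (x + y))
    (smul : ∀ (a : k) x, Q x → Q (a • x))
    (gens : ∀ (c : E) (p q : ℤ) (r : R) (s : S), r ∈ gr k p → s ∈ gr k q →
      p + deg c + q = n → Q (gen R S c r s)) : Q x := by
  refine Submodule.span_induction ?_ zero (fun x y _ _ => add x y) (fun a x _ => smul a x) hx
  rintro _ ⟨c, p, q, r, s, hr, hs, h, rfl⟩
  exact gens c p q r s hr hs h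

variable {deg} in
/-- A linear map which sends the homogeneous generators into a submodule sends the whole graded
component into it. -/
lemma map_mem_of_gen {n : ℤ} (f : FreeBimod R S E →ₗ[k] P) (Q : Submodule k P)
    {x : FreeBimod R S E} (hx : x ∈ grading R S deg n)
    (h : ∀ (c : E) (p q : ℤ) (r : R) (s : S), r ∈ gr k p → s ∈ gr k q →
      p + deg c + q = n → f (gen R S c r s) ∈ Q) : f x ∈ Q :=
  grading_induction (Q := fun x => f x ∈ Q) hx (by rw [map_zero]; exact Q.zero_mem)
    (fun x y hx hy => by rw [map_add]; exact Q.add_mem hx hy)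
    (fun a x hx => by rw [map_smul]; exact Q.smul_mem a hx) h

variable {deg} in
/-- Linear maps which agree on the homogeneous generators agree on the graded component. -/
lemma map_eq_of_gen {n : ℤ} {f g : FreeBimod R S E →ₗ[k] P} {x : FreeBimod R S E}
    (hx : x ∈ grading R S deg n)
    (h : ∀ (c : E) (p q : ℤ) (r : R) (s : S), r ∈ gr k p → s ∈ gr k q →
      p + deg c + q = n → f (gen R S c r s) = g (gen R S c r s)) : f x = g x :=
  sub_eq_zero.1 (map_mem_of_gen (f - g) ⊥ hx fun c p q r s hr hs hn =>
    sub_eq_zero.2 (h c p q r s hr hs hn))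

lemma grading_isInternal : DirectSum.IsInternal (grading R S deg) := by
  have key : ∀ (m : ℤ) (c : E) (p q : ℤ) (r : R) (s : S), r ∈ gr k p → s ∈ gr k q →
      lift (fun c => gradedLift k fun p => (gen R S c).compl₂ (proj k S (m - deg c - p)))
        (gen R S c r s) = if p + deg c + q = m then gen R S c r s else 0 := by
    intro m c p q r s hr hs
    rw [lift_gen, gradedLift_apply k _ hr, LinearMap.compl₂_apply]
    split_ifs with h
    · rw [proj_of_mem (by convert hs using 2; omega)]
    · rw [proj_of_mem_ne hs (by omega), map_zero]
  refine isInternal_of_proj _ (fun m => lift fun c => gradedLift k fun p =>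
    (gen R S c).compl₂ (proj k S (m - deg c - p))) (fun n x hx => ?_) (fun m n hmn x hx => ?_)
    (fun x => ?_)
  · refine map_eq_of_gen (g := LinearMap.id) hx fun c p q r s hr hs hn => ?_
    rw [key _ _ _ _ _ _ hr hs, if_pos hn]; rfl
  · refine map_eq_of_gen (g := 0) hx fun c p q r s hr hs hn => ?_
    rw [key _ _ _ _ _ _ hr hs, if_neg (by omega)]; rfl
  · rw [← Submodule.Quotient.mk_eq_zero]
    refine linearMap_ext (f := (⨆ n, grading R S deg n).mkQ) (g := 0)
      (fun c p q r s hr hs => ?_) x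
    exact (Submodule.Quotient.mk_eq_zero _).2
      (Submodule.mem_iSup_of_mem _ (gen_mem deg hr hs rfl))

lemma lsmul_mem_grading {p n : ℤ} {r' : R} {x : FreeBimod R S E} (hr' : r' ∈ gr k p)
    (hx : x ∈ grading R S deg n) : r' • x ∈ grading R S deg (p + n) :=
  map_mem_of_gen (lmulLin r') _ hx fun c p' q r s hr hs hn => by
    rw [lmulLin_apply, lsmul_gen]
    exact gen_mem deg (R.mul_mem hr' hr) hs (by omega)

lemma rsmul_mem_grading {n q : ℤ} {t : S} {x : FreeBimod R S E} (hx : x ∈ grading R S deg n)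
    (ht : t ∈ gr k q) : MulOpposite.op t • x ∈ grading R S deg (n + q) :=
  map_mem_of_gen (rmulLin t) _ hx fun c p' q r s hr hs hn => by
    rw [rmulLin_gen]
    exact gen_mem deg hr (S.mul_mem hs ht) (by omega)

end Grading

section Differential

variable (deg : E → ℤ) (bd : E → FreeBimod R S E)

/-- The bilinear map `(r, s) ↦ r · x · s`. -/
def act (x : FreeBimod R S E) : R →ₗ[k] S →ₗ[k] FreeBimod R S E :=
  LinearMap.mk₂ k (fun r s => MulOpposite.op s • r • x)
    (fun r r' s => by rw [add_smul, smul_add])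
    (fun a r s => by rw [smul_assoc, op_smul_eq, op_smul_eq, map_smul])
    (fun r s t => by rw [MulOpposite.op_add, add_smul])
    (fun a r s => by rw [MulOpposite.op_smul, smul_assoc])

@[simp] lemma act_apply (x : FreeBimod R S E) (r : R) (s : S) :
    act x r s = MulOpposite.op s • r • x := rfl

/-- The derivation of the free bimodule with prescribed values `bd c` on the generators. -/
def D : FreeBimod R S E →ₗ[k] FreeBimod R S E :=
  lift fun c => (gen R S c).comp (d k) + (act (bd c)).comp (gradingSign k R) +
    sgn (deg c) • (gen R S c).compl₁₂ (gradingSign k R) (d k)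

lemma D_gen (c : E) (r : R) (s : S) : D deg bd (gen R S c r s) =
    gen R S c (d k r) s + MulOpposite.op s • gradingSign k R r • bd c +
      sgn (deg c) • gen R S c (gradingSign k R r) (d k s) := lift_gen _ _ _ _

lemma D_gen_one (c : E) : D deg bd (gen R S c 1 1) = bd c := by
  rw [D_gen, R.d_one, S.d_one, map_zero, map_zero, smul_zero, add_zero, R.gradingSign_one,
    LinearMap.zero_apply, zero_add, one_smul, MulOpposite.op_one, one_smul]

lemma lsmul_zsmul (n : ℤ) (r : R) (x : FreeBimod R S E) : r • (n • x) = n • (r • x) :=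
  map_zsmul (lmulLin r) n x

lemma rsmul_zsmul (n : ℤ) (s : S) (x : FreeBimod R S E) :
    MulOpposite.op s • (n • x) = n • (MulOpposite.op s • x) := map_zsmul (rmulLin s) n x

lemma zsmul_lsmul (n : ℤ) (r : R) (x : FreeBimod R S E) : (n • r) • x = n • (r • x) :=
  smul_assoc n r x

lemma gen_zsmul_left (n : ℤ) (c : E) (r : R) (s : S) :
    gen R S c (n • r) s = n • gen R S c r s := by
  rw [map_zsmul]; rfl

lemma D_lsmul {p : ℤ} {r' : R} (x : FreeBimod R S E) (hr' : r' ∈ gr k p) :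
    D deg bd (r' • x) = d k r' • x + sgn p • (r' • D deg bd x) := by
  refine linearMap_ext (f := (D deg bd).comp (lmulLin r'))
    (g := lmulLin (d k r') + sgn p • (lmulLin r').comp (D deg bd))
    (fun c _ q r s hr hs => ?_) x
  simp only [LinearMap.comp_apply, lmulLin_apply, lsmul_gen, D_gen, LinearMap.add_apply,
    LinearMap.smul_apply, smul_add, R.leibniz r hr', R.gradingSign_mul, gradingSign_apply k hr',
    map_add, smul_mul_assoc, zsmul_lsmul, mul_smul, gen_zsmul_left, lsmul_zsmul, rsmul_zsmul]
  rw [smul_comm r' (MulOpposite.op s), smul_comm (sgn p) (sgn (deg c))]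
  abel

variable {deg} in
lemma D_rsmul {n : ℤ} {x : FreeBimod R S E} (t : S) (hx : x ∈ grading R S deg n) :
    D deg bd (MulOpposite.op t • x) =
      MulOpposite.op t • D deg bd x + sgn n • (MulOpposite.op (d k t) • x) := by
  refine map_eq_of_gen (f := (D deg bd).comp (rmulLin t))
    (g := (rmulLin t).comp (D deg bd) + sgn n • rmulLin (d k t)) hx
    (fun c p q r s hr hs hn => ?_)
  subst hn
  simp only [LinearMap.comp_apply, D_gen, LinearMap.add_apply, LinearMap.smul_apply,
    map_add, map_zsmul, S.leibniz t hs, gradingSign_apply k hr, zsmul_lsmul,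
    MulOpposite.op_mul, mul_smul, smul_add, ← op_smul_eq, op_smul_gen, rsmul_zsmul, sgn_add]
  generalize MulOpposite.op t • MulOpposite.op s • r • bd c = z
  module

variable {deg bd} in
lemma D_mem (hbd : ∀ c, bd c ∈ grading R S deg (deg c + 1)) {n : ℤ} {x : FreeBimod R S E}
    (hx : x ∈ grading R S deg n) : D deg bd x ∈ grading R S deg (n + 1) := by
  refine map_mem_of_gen (D deg bd) _ hx fun c p q r s hr hs hn => ?_
  rw [D_gen]
  refine Submodule.add_mem _ (Submodule.add_mem _ ?_ ?_) (zsmul_mem ?_ _)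
  · exact gen_mem deg (d_mem k hr) hs (by omega)
  · have := rsmul_mem_grading deg (lsmul_mem_grading deg (gradingSign_mem hr) (hbd c)) hs
    convert this using 2
    omega
  · exact gen_mem deg (gradingSign_mem hr) (d_mem k hs) (by omega)

variable {deg bd} in
lemma D_D (hbd : ∀ c, bd c ∈ grading R S deg (deg c + 1)) (hD : ∀ c, D deg bd (bd c) = 0)
    (x : FreeBimod R S E) : D deg bd (D deg bd x) = 0 := by
  refine linearMap_ext (f := (D deg bd).comp (D deg bd)) (g := 0) (fun c p q r s hr hs => ?_) x
  rw [LinearMap.comp_apply, D_gen, map_add, map_add, map_zsmul,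
    D_rsmul bd s (lsmul_mem_grading deg (gradingSign_mem hr) (hbd c)),
    D_lsmul deg bd _ (gradingSign_mem hr), hD, D_gen, D_gen]
  simp only [d_d, map_zero, gradingSign_apply k hr, gradingSign_apply k (d_mem k hr), map_zsmul,
    LinearMap.zero_apply, zsmul_lsmul, sgn_add, smul_zero, zero_add,
    add_zero, rsmul_zsmul]
  rcases sgn_eq_or p with h | h <;> simp [h, sgn_one] <;> abel

end Differential

end FreeBimod

end Semifree

section SemifreeMaps

variable {k : Type u} [CommRing k] {R S : DGAlg k}

namespace FreeBimod

section Eval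

variable {E : Type u} {X : PtBimod R S}

/-- The bilinear map `(r, s) ↦ r · x · s`. -/
def actOn (x : X) : R →ₗ[k] S →ₗ[k] X := X.rmulHom.comp (X.lmulHom.flip x)

@[simp] lemma actOn_apply (x : X) (r : R) (s : S) : actOn x r s = PtBimod.rmul (r • x) s := rfl

/-- The bimodule map out of the free bimodule with prescribed values on the generators. -/
def ev (a : E → X) : FreeBimod R S E →ₗ[k] X := lift fun c => actOn (a c)

@[simp] lemma ev_gen (a : E → X) (c : E) (r : R) (s : S) :
    ev a (gen R S c r s) = PtBimod.rmul (r • a c) s := lift_gen _ _ _ _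

lemma ev_lsmul (a : E → X) (r' : R) (x : FreeBimod R S E) : ev a (r' • x) = r' • ev a x :=
  LinearMap.congr_fun (linearMap_ext' (f := (ev a).comp (lmulLin r'))
    (g := (X.lmulHom r').comp (ev a)) fun c r s => by
      simp [lsmul_gen, PtBimod.lmulHom_apply, PtBimod.lsmul_rmul, mul_smul]) x

lemma ev_rsmul (a : E → X) (t : S) (x : FreeBimod R S E) :
    ev a (MulOpposite.op t • x) = PtBimod.rmul (ev a x) t :=
  LinearMap.congr_fun (linearMap_ext' (f := (ev a).comp (rmulLin t))
    (g := (X.rmulHom.flip t).comp (ev a)) fun c r s => by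
      simp [PtBimod.rmulHom_apply, PtBimod.rmul_rmul]) x

lemma ev_mem {deg : E → ℤ} {a : E → X} (ha : ∀ c, a c ∈ gr k (deg c)) {n : ℤ}
    {x : FreeBimod R S E} (hx : x ∈ grading R S deg n) : ev a x ∈ gr k n :=
  map_mem_of_gen (ev a) _ hx fun c p q r s hr hs hn => by
    rw [ev_gen, ← hn]
    exact PtBimod.rmul_mem (X.lsmul_mem hr (ha c)) hs

/-- Compatibility with the differentials on a generator `c` propagates to the bimodule generated
by `c`. -/
lemma ev_D_gen {deg : E → ℤ} {bd : E → FreeBimod R S E} {a : E → X} {c : E}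
    (hc : a c ∈ gr k (deg c)) (hd : d k (a c) = ev a (bd c)) (r : R) (s : S) :
    ev a (D deg bd (gen R S c r s)) = d k (ev a (gen R S c r s)) := by
  refine linearMap_ext_gr (f := (ev a).comp ((D deg bd).comp ((gen R S c).flip s)))
    (g := (d k).comp ((ev a).comp ((gen R S c).flip s))) (fun p r hr => ?_) r
  simp only [LinearMap.comp_apply, LinearMap.flip_apply, D_gen, map_add, ev_gen, ev_rsmul,
    ev_lsmul, map_zsmul, gradingSign_apply k hr]
  rw [PtBimod.d_rmul s (X.lsmul_mem hr hc), X.d_lsmul _ hr, hd, sgn_add, PtBimod.add_rmul,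
    PtBimod.zsmul_lsmul, PtBimod.zsmul_rmul, LinearMap.smul_apply, map_zsmul, ev_gen]
  module

lemma ev_D {deg : E → ℤ} {bd : E → FreeBimod R S E} {a : E → X}
    (ha : ∀ c, a c ∈ gr k (deg c)) (hd : ∀ c, d k (a c) = ev a (bd c)) (x : FreeBimod R S E) :
    ev a (D deg bd x) = d k (ev a x) :=
  linearMap_ext (f := (ev a).comp (D deg bd)) (g := (d k).comp (ev a))
    (fun c _ _ r s _ _ => ev_D_gen (ha c) (hd c) r s) x

end Eval

section Map

variable {E E' E'' : Type u}

/-- The map of free bimodules induced by a map of the generators. -/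
def map (φ : E → E') : FreeBimod R S E →ₗ[k] FreeBimod R S E' := lift fun c => gen R S (φ c)

@[simp] lemma map_gen (φ : E → E') (c : E) (r : R) (s : S) :
    map φ (gen R S c r s) = gen R S (φ c) r s := lift_gen _ _ _ _

lemma map_map (φ : E → E') (ψ : E' → E'') (x : FreeBimod R S E) :
    map ψ (map φ x) = map (fun c => ψ (φ c)) x :=
  LinearMap.congr_fun (linearMap_ext' (f := (map ψ).comp (map φ)) (g := map fun c => ψ (φ c))
    fun c r s => by simp) x

lemma map_injective {φ : E → E'} (hφ : Function.Injective φ) :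
    Function.Injective (map (R := R) (S := S) φ) := by
  have h : map (R := R) (S := S) φ = Finsupp.lmapDomain (TensorProduct k R.carrier S.carrier) k φ :=
    linearMap_ext' fun c r s => (map_gen φ c r s).trans
      (Finsupp.mapDomain_single (f := φ) (a := c)).symm
  rw [h]
  exact Finsupp.mapDomain_injective hφ

lemma map_lsmul (φ : E → E') (r' : R) (x : FreeBimod R S E) : map φ (r' • x) = r' • map φ x :=
  LinearMap.congr_fun (linearMap_ext' (f := (map φ).comp (lmulLin r'))
    (g := (lmulLin r').comp (map φ)) fun c r s => by simp [lsmul_gen]) x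

lemma map_rsmul (φ : E → E') (t : S) (x : FreeBimod R S E) :
    map φ (MulOpposite.op t • x) = MulOpposite.op t • map φ x :=
  LinearMap.congr_fun (linearMap_ext' (f := (map φ).comp (rmulLin t))
    (g := (rmulLin t).comp (map φ)) fun c r s => by simp) x

lemma map_mem {deg : E → ℤ} {deg' : E' → ℤ} {φ : E → E'} (h : ∀ c, deg' (φ c) = deg c) {n : ℤ}
    {x : FreeBimod R S E} (hx : x ∈ grading R S deg n) : map φ x ∈ grading R S deg' n :=
  map_mem_of_gen (map φ) _ hx fun c p q r s hr hs hn => by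
    rw [map_gen]
    exact gen_mem deg' hr hs (by rw [h, hn])

lemma map_D {deg : E → ℤ} {deg' : E' → ℤ} {bd : E → FreeBimod R S E}
    {bd' : E' → FreeBimod R S E'} {φ : E → E'} (h : ∀ c, deg' (φ c) = deg c)
    (h' : ∀ c, bd' (φ c) = map φ (bd c)) (x : FreeBimod R S E) :
    map φ (D deg bd x) = D deg' bd' (map φ x) :=
  LinearMap.congr_fun (linearMap_ext' (f := (map φ).comp (D deg bd))
    (g := (D deg' bd').comp (map φ)) fun c r s => by
      simp [D_gen, h, h', map_lsmul, map_rsmul]) x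

lemma ev_map {X : PtBimod R S} (φ : E → E') (a : E' → X) (x : FreeBimod R S E) :
    ev a (map φ x) = ev (fun c => a (φ c)) x :=
  LinearMap.congr_fun (linearMap_ext' (f := (ev a).comp (map φ)) (g := ev fun c => a (φ c))
    fun c r s => by simp) x

lemma hom_ev {X Y : PtBimod R S} (f : X ⟶ Y) (a : E → X) (x : FreeBimod R S E) :
    PtBimod.Hom.toLinearMap f (ev a x) = ev (fun c => PtBimod.Hom.toLinearMap f (a c)) x :=
  LinearMap.congr_fun (linearMap_ext' (f := (PtBimod.Hom.toLinearMap f).comp (ev a))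
    (g := ev fun c => PtBimod.Hom.toLinearMap f (a c)) fun c r s => by
      simp [PtBimod.Hom.map_rmul f, PtBimod.Hom.map_lsmul f]) x

/-- Every element of the free bimodule which is homogeneous is a finite sum of homogeneous
generators. -/
lemma exists_eq_sum {deg : E → ℤ} {n : ℤ} {x : FreeBimod R S E} (hx : x ∈ grading R S deg n) :
    ∃ (m : ℕ) (r : Fin m → R) (c : Fin m → E) (s : Fin m → S),
      (∀ i, ∃ p q, r i ∈ gr k p ∧ s i ∈ gr k q ∧ p + deg (c i) + q = n) ∧
      x = ∑ i, gen R S (c i) (r i) (s i) := by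
  refine grading_induction (Q := fun x => ∃ (m : ℕ) (r : Fin m → R) (c : Fin m → E)
    (s : Fin m → S), (∀ i, ∃ p q, r i ∈ gr k p ∧ s i ∈ gr k q ∧ p + deg (c i) + q = n) ∧
      x = ∑ i, gen R S (c i) (r i) (s i)) hx ?_ ?_ ?_ ?_
  · exact ⟨0, Fin.elim0, Fin.elim0, Fin.elim0, fun i => i.elim0, by simp⟩
  · rintro _ _ ⟨m, r, c, s, h, rfl⟩ ⟨m', r', c', s', h', rfl⟩
    refine ⟨m + m', Fin.append r r', Fin.append c c', Fin.append s s', fun i => ?_, ?_⟩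
    · induction i using Fin.addCases with
      | left i => simpa using h i
      | right i => simpa using h' i
    · simp [Fin.sum_univ_add]
  · rintro a _ ⟨m, r, c, s, h, rfl⟩
    refine ⟨m, fun i => a • r i, c, s, fun i => ?_, ?_⟩
    · obtain ⟨p, q, hr, hs, hn⟩ := h i
      exact ⟨p, q, Submodule.smul_mem _ _ hr, hs, hn⟩
    · simp [Finset.smul_sum]
  · intro c p q r s hr hs hn
    exact ⟨1, fun _ => r, fun _ => c, fun _ => s, fun _ => ⟨p, q, hr, hs, hn⟩, by simp⟩

end Map

end FreeBimod

open FreeBimod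

variable (R S) in
/-- Generators, with degrees and boundaries, of a semifree bimodule, one of which is the point. -/
structure SemifreeData where
  E : Type u
  deg : E → ℤ
  bd : E → FreeBimod R S E
  bd_mem : ∀ c, bd c ∈ grading R S deg (deg c + 1)
  D_bd : ∀ c, D deg bd (bd c) = 0
  base : E
  deg_base : deg base = 0
  bd_base : bd base = 0

namespace SemifreeData

variable (T : SemifreeData R S)

/-- The semifree bimodule on given generators. -/
def bimod : PtBimod R S where
  carrier := FreeBimod R S T.E
  dg :=
    { gr := grading R S T.deg
      isInternal := grading_isInternal T.deg
      d := D T.deg T.bd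
      d_mem := D_mem T.bd_mem
      d_d := D_D T.bd_mem T.D_bd }
  lsmul_mem := lsmul_mem_grading T.deg
  rsmul_mem := rsmul_mem_grading T.deg
  d_lsmul := D_lsmul T.deg T.bd
  d_rsmul := D_rsmul T.bd
  pt := gen R S T.base 1 1
  pt_mem := gen_mem T.deg R.one_mem S.one_mem (by rw [T.deg_base]; rfl)
  d_pt := (D_gen_one T.deg T.bd T.base).trans T.bd_base

variable {T}

/-- Maps out of a semifree bimodule are given by compatible values on the generators. -/
def desc {X : PtBimod R S} (a : T.E → X) (ha : ∀ c, a c ∈ gr k (T.deg c))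
    (hd : ∀ c, d k (a c) = ev a (T.bd c)) (hpt : a T.base = X.pt) : T.bimod ⟶ X :=
  PtBimod.Hom.mk (ev a) (ev_lsmul a) (fun x s => ev_rsmul a s x) (ev_mem ha) (ev_D ha hd)
    ((ev_gen a T.base 1 1).trans (by rw [one_smul, PtBimod.rmul_one, hpt]))

/-- Maps of semifree bimodules which send generators to generators. -/
def map {T T' : SemifreeData R S} (φ : T.E → T'.E) (h : ∀ c, T'.deg (φ c) = T.deg c)
    (h' : ∀ c, T'.bd (φ c) = FreeBimod.map φ (T.bd c)) (hb : φ T.base = T'.base) :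
    T.bimod ⟶ T'.bimod :=
  PtBimod.Hom.mk (FreeBimod.map φ) (map_lsmul φ) (fun x s => map_rsmul φ s x) (map_mem h)
    (map_D h h') ((map_gen φ T.base 1 1).trans (by rw [hb]; rfl))

variable (T) in
/-- The generators of a semifree bimodule, as elements. -/
def cell (c : T.E) : T.bimod := (gen R S c 1 1 : FreeBimod R S T.E)

lemma cell_mem (c : T.E) : T.cell c ∈ gr k (T.deg c) :=
  gen_mem T.deg R.one_mem S.one_mem (by ring)

lemma ev_cell (x : FreeBimod R S T.E) : ev T.cell x = (show T.bimod from x) := by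
  refine LinearMap.congr_fun (linearMap_ext' (f := ev T.cell) (g := LinearMap.id)
    fun c r s => ?_) x
  refine (ev_gen T.cell c r s).trans ?_
  change MulOpposite.op s • r • (gen R S c 1 1 : FreeBimod R S T.E) = gen R S c r s
  rw [lsmul_gen, op_smul_gen, mul_one, one_mul]

lemma d_cell (c : T.E) : d k (T.cell c) = ev T.cell (T.bd c) :=
  (D_gen_one T.deg T.bd c).trans (ev_cell (T.bd c)).symm

lemma d_hom_cell {X : PtBimod R S} (f : T.bimod ⟶ X) (c : T.E) :
    d k (PtBimod.Hom.toLinearMap f (T.cell c)) =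
      ev (fun c => PtBimod.Hom.toLinearMap f (T.cell c)) (T.bd c) := by
  rw [← PtBimod.Hom.map_d f, d_cell, hom_ev]

lemma hom_apply {X : PtBimod R S} (f : T.bimod ⟶ X) (x : FreeBimod R S T.E) :
    PtBimod.Hom.toLinearMap f x = ev (fun c => PtBimod.Hom.toLinearMap f (T.cell c)) x :=
  (congrArg (PtBimod.Hom.toLinearMap f) (ev_cell x).symm).trans (hom_ev f T.cell x)

lemma hom_ext {X : PtBimod R S} {f g : T.bimod ⟶ X}
    (h : ∀ c, PtBimod.Hom.toLinearMap f (T.cell c) = PtBimod.Hom.toLinearMap g (T.cell c)) :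
    f = g :=
  PtBimod.Hom.ext (LinearMap.ext fun x => by
    refine (hom_apply f x).trans ((congrArg (fun a => ev a x) (funext h)).trans
      (hom_apply g x).symm))

end SemifreeData

end SemifreeMaps

/-! ### Functorial cofibrant resolutions of pointed bimodules -/

section Resolution

open FreeBimod

variable {k : Type u} [CommRing k] {R S : DGAlg k}

/-- Formal cells over a pointed bimodule `Y`: the point, and for a formal sum `∑ rᵢ · cᵢ · sᵢ` of
cells and `y ∈ Y` a cell of degree `n` with boundary this sum and with image `y` in `Y`. The
boundary is given by a formal sum, rather than by an element of the free bimodule on the cells, so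
that the definition can be recursive; different formal sums give different cells. -/
inductive Cell (Y : PtBimod R S) : Type u
  | pt : Cell Y
  | mk (n : ℤ) (m : ℕ) (r : Fin m → R) (c : Fin m → Cell Y) (s : Fin m → S) (y : Y) : Cell Y

namespace Cell

variable {Y Z V : PtBimod R S}

/-- The degree of a cell. -/
def deg : Cell Y → ℤ
  | pt => 0
  | mk n _ _ _ _ _ => n

/-- The image of a cell in `Y`. -/
def val : Cell Y → Y
  | pt => Y.pt
  | mk _ _ _ _ _ y => y

/-- The boundary of a cell. -/
def bd : Cell Y → FreeBimod R S (Cell Y)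
  | pt => 0
  | mk _ _ r c s _ => ∑ i, gen R S (c i) (r i) (s i)

/-- A cell is valid if its boundary is a homogeneous cocycle of the right degree which is made of
valid cells and has the same image in `Y` as the boundary of the image of the cell. -/
def Valid : Cell Y → Prop
  | pt => True
  | mk n _ r c s y => (∀ i, (c i).Valid) ∧
      (∀ i, ∃ p q, r i ∈ gr k p ∧ s i ∈ gr k q ∧ p + (c i).deg + q = n + 1) ∧ y ∈ gr k n ∧
      D deg bd (∑ i, gen R S (c i) (r i) (s i)) = 0 ∧
      ev val (∑ i, gen R S (c i) (r i) (s i)) = d k y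

/-- The boundary of a valid cell, as an element of the free bimodule on the valid cells. -/
def bdValid : {c : Cell Y // c.Valid} → FreeBimod R S {c : Cell Y // c.Valid}
  | ⟨pt, _⟩ => 0
  | ⟨mk _ _ r c s _, h⟩ => ∑ i, gen R S ⟨c i, h.1 i⟩ (r i) (s i)

lemma map_bdValid (c : {c : Cell Y // c.Valid}) :
    FreeBimod.map Subtype.val (bdValid c) = bd c.1 := by
  obtain ⟨_ | ⟨n, m, r, c, s, y⟩, h⟩ := c
  · exact map_zero _
  · simp [bdValid, bd]

lemma bdValid_mem (c : {c : Cell Y // c.Valid}) :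
    bdValid c ∈ grading R S (fun c : {c : Cell Y // c.Valid} => deg c.1) (deg c.1 + 1) := by
  obtain ⟨_ | ⟨n, m, r, c, s, y⟩, h⟩ := c
  · exact Submodule.zero_mem _
  · refine Submodule.sum_mem _ fun i _ => ?_
    obtain ⟨p, q, hr, hs, hn⟩ := h.2.1 i
    exact gen_mem _ hr hs hn

lemma Valid.D_bd {c : Cell Y} (h : c.Valid) : D deg bd (bd c) = 0 := by
  rcases c with _ | ⟨n, m, r, c, s, y⟩
  · exact map_zero _
  · exact h.2.2.2.1

lemma Valid.val_mem {c : Cell Y} (h : c.Valid) : val c ∈ gr k (deg c) := by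
  rcases c with _ | ⟨n, m, r, c, s, y⟩
  · exact Y.pt_mem
  · exact h.2.2.1

lemma Valid.d_val {c : Cell Y} (h : c.Valid) : d k (val c) = ev val (bd c) := by
  rcases c with _ | ⟨n, m, r, c, s, y⟩
  · exact Y.d_pt.trans (map_zero _).symm
  · exact h.2.2.2.2.symm

lemma map_D_bdValid (x : FreeBimod R S {c : Cell Y // c.Valid}) :
    FreeBimod.map Subtype.val (D (fun c : {c : Cell Y // c.Valid} => deg c.1) bdValid x) =
      D deg bd (FreeBimod.map Subtype.val x) :=
  map_D (fun _ => rfl) (fun c => (map_bdValid c).symm) x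

lemma D_bdValid (c : {c : Cell Y // c.Valid}) :
    D (fun c : {c : Cell Y // c.Valid} => deg c.1) bdValid (bdValid c) = 0 := by
  apply map_injective Subtype.val_injective
  rw [map_D_bdValid, map_bdValid, c.2.D_bd, map_zero]

lemma ev_bdValid {A : PtBimod R S} (a : Cell Y → A) (c : {c : Cell Y // c.Valid}) :
    ev a (bd c.1) = ev (fun c : {c : Cell Y // c.Valid} => a c.1) (bdValid c) := by
  rw [← map_bdValid, ev_map]

/-- Every cocycle on the valid cells whose image in `Y` is the boundary of `y` is the boundary of a
valid cell with image `y`. -/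
lemma exists_bdValid_eq {n : ℤ} {x : FreeBimod R S {c : Cell Y // c.Valid}} {y : Y}
    (hx : x ∈ grading R S (fun c : {c : Cell Y // c.Valid} => deg c.1) n)
    (hdx : D (fun c : {c : Cell Y // c.Valid} => deg c.1) bdValid x = 0) (hy : y ∈ gr k (n - 1))
    (hdy : d k y = ev (fun c : {c : Cell Y // c.Valid} => val c.1) x) :
    ∃ c : {c : Cell Y // c.Valid}, deg c.1 = n - 1 ∧ val c.1 = y ∧ bdValid c = x := by
  obtain ⟨m, r, c, s, h, rfl⟩ := exists_eq_sum hx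
  have hmap : FreeBimod.map Subtype.val (∑ i, gen R S (c i) (r i) (s i)) =
      ∑ i, gen R S (c i).1 (r i) (s i) := by simp
  refine ⟨⟨mk (n - 1) m r (fun i => (c i).1) s y, fun i => (c i).2, fun i => ?_, hy, ?_, ?_⟩,
    rfl, rfl, rfl⟩
  · obtain ⟨p, q, hr, hs, hn⟩ := h i
    exact ⟨p, q, hr, hs, hn.trans (by ring)⟩
  · rw [← hmap, ← map_D_bdValid, hdx, map_zero]
  · rw [← hmap, ev_map, hdy]

variable (Y) in
/-- The semifree bimodule on all valid cells over `Y`. -/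
def data : SemifreeData R S where
  E := {c : Cell Y // c.Valid}
  deg c := deg c.1
  bd := bdValid
  bd_mem := bdValid_mem
  D_bd := D_bdValid
  base := ⟨pt, trivial⟩
  deg_base := rfl
  bd_base := rfl

variable (Y) in
/-- The augmentation of the resolution. -/
def augmentation : (data Y).bimod ⟶ Y :=
  SemifreeData.desc (fun c => val c.1) (fun c => c.2.val_mem)
    (fun c => c.2.d_val.trans (ev_bdValid val c)) rfl

lemma augmentation_cell (c : {c : Cell Y // c.Valid}) :
    PtBimod.Hom.toLinearMap (augmentation Y) ((data Y).cell c) = val c.1 := by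
  refine (ev_gen (fun c : (data Y).E => val c.1) c 1 1).trans ?_
  rw [one_smul, PtBimod.rmul_one]

variable (Y) in
/-- The resolution has cells which hit every cocycle and kill every cocycle with trivial image. -/
lemma augmentation_quasiIso : PtBimod.quasiIso R S (augmentation Y) := by
  refine (DGHom.isQuasiIso_iff _).2 fun n => ⟨?_, ?_⟩
  · rintro x hx hdx ⟨y, hy, hdy⟩
    obtain ⟨c, hc, -, hcx⟩ := exists_bdValid_eq (Y := Y) hx hdx hy hdy
    have hmem := (data Y).cell_mem c
    have hdeg : (data Y).deg c = n - 1 := hc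
    rw [hdeg] at hmem
    exact ⟨(data Y).cell c, hmem, (D_gen_one (data Y).deg (data Y).bd c).trans hcx⟩
  · intro y hy hdy
    have hv : (mk n 0 Fin.elim0 Fin.elim0 Fin.elim0 y : Cell Y).Valid :=
      ⟨fun i => i.elim0, fun i => i.elim0, hy, by simp, by simp [hdy]⟩
    have hmem := (data Y).cell_mem ⟨_, hv⟩
    have hd : d k ((data Y).cell ⟨_, hv⟩) = 0 := D_gen_one (data Y).deg (data Y).bd ⟨_, hv⟩
    refine ⟨(data Y).cell ⟨_, hv⟩, hmem, hd, 0, Submodule.zero_mem _, ?_⟩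
    rw [map_zero]
    exact (sub_eq_zero.2 (augmentation_cell ⟨_, hv⟩).symm).symm

/-- The map induced on cells. -/
def map (f : Y ⟶ Z) : Cell Y → Cell Z
  | pt => pt
  | mk n m r c s y => mk n m r (fun i => (c i).map f) s (PtBimod.Hom.toLinearMap f y)

lemma deg_map (f : Y ⟶ Z) (c : Cell Y) : deg (c.map f) = deg c := by cases c <;> rfl

lemma val_map (f : Y ⟶ Z) (c : Cell Y) :
    val (c.map f) = PtBimod.Hom.toLinearMap f (val c) := by
  cases c
  · exact (PtBimod.Hom.map_pt f).symm
  · rfl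

lemma bd_map (f : Y ⟶ Z) (c : Cell Y) : bd (c.map f) = FreeBimod.map (Cell.map f) (bd c) := by
  cases c
  · exact (map_zero _).symm
  · simp [bd, map]

lemma Valid.map {c : Cell Y} (f : Y ⟶ Z) (h : c.Valid) : (c.map f).Valid := by
  induction c with
  | pt => trivial
  | mk n m r c s y ih =>
    obtain ⟨h1, h2, h3, h4, h5⟩ := h
    have e : ∑ i, gen R S ((c i).map f) (r i) (s i) =
        FreeBimod.map (Cell.map f) (∑ i, gen R S (c i) (r i) (s i)) := by simp
    refine ⟨fun i => ih i (h1 i), fun i => ?_, PtBimod.Hom.map_mem f h3, ?_, ?_⟩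
    · rw [deg_map]; exact h2 i
    · rw [e, ← map_D (deg := deg) (bd := bd) (deg_map f) (bd_map f), h4, map_zero]
    · rw [e, ev_map, ← PtBimod.Hom.map_d f, ← h5, hom_ev]
      exact congrArg (fun a => ev a (∑ i, gen R S (c i) (r i) (s i))) (funext fun c => val_map f c)

lemma map_id_apply (c : Cell Y) : c.map (𝟙 Y) = c := by
  induction c with
  | pt => rfl
  | mk n m r c s y ih => exact congrArg (fun c => mk n m r c s y) (funext ih)

lemma map_comp_apply (f : Y ⟶ Z) (g : Z ⟶ V) (c : Cell Y) :
    c.map (f ≫ g) = (c.map f).map g := by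
  induction c with
  | pt => rfl
  | mk n m r c s y ih =>
    exact congrArg (fun c => mk n m r c s (PtBimod.Hom.toLinearMap (f ≫ g) y)) (funext ih)

lemma bdValid_map (f : Y ⟶ Z) (c : {c : Cell Y // c.Valid}) :
    bdValid ⟨c.1.map f, c.2.map f⟩ =
      FreeBimod.map (fun c : {c : Cell Y // c.Valid} => ⟨c.1.map f, c.2.map f⟩) (bdValid c) := by
  apply map_injective Subtype.val_injective
  rw [map_bdValid, bd_map, ← map_bdValid, map_map, map_map]

/-- The map induced on resolutions. -/
def dataMap (f : Y ⟶ Z) : (data Y).bimod ⟶ (data Z).bimod :=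
  SemifreeData.map (fun c => ⟨c.1.map f, c.2.map f⟩) (fun c => deg_map f c.1) (bdValid_map f) rfl

lemma dataMap_cell (f : Y ⟶ Z) (c : {c : Cell Y // c.Valid}) :
    PtBimod.Hom.toLinearMap (dataMap f) ((data Y).cell c) =
      (data Z).cell ⟨c.1.map f, c.2.map f⟩ :=
  map_gen (fun c : (data Y).E => (⟨c.1.map f, c.2.map f⟩ : (data Z).E)) c 1 1

section Lift

variable {A B : PtBimod R S} (p : A ⟶ B) (f : (data Y).bimod ⟶ B)

open Classical in
/-- The images of the cells under a lift of `f` along `p`, chosen by recursion (and `0` if there is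
no choice, which happens only for cells which are not valid). -/
def liftCell : Cell Y → A
  | pt => A.pt
  | mk n m r c s y =>
    if h : ∃ a ∈ gr k n, d k a = ∑ i, PtBimod.rmul (r i • liftCell (c i)) (s i) ∧
        ∃ hv : (mk n m r c s y).Valid,
          PtBimod.Hom.toLinearMap p a = PtBimod.Hom.toLinearMap f ((data Y).cell ⟨_, hv⟩)
    then h.choose else 0

variable {p}

/-- On valid cells the recursive choice succeeds: the values on the boundary form a cocycle, and a
trivial fibration allows the lift to be extended over the cell. -/
lemma liftCell_spec (hp : PtBimod.quasiIso R S p) (hp' : PtBimod.fibration R S p) (c : Cell Y)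
    (hc : c.Valid) : liftCell p f c ∈ gr k (deg c) ∧
      d k (liftCell p f c) = ev (liftCell p f) (bd c) ∧
      PtBimod.Hom.toLinearMap p (liftCell p f c) =
        PtBimod.Hom.toLinearMap f ((data Y).cell ⟨c, hc⟩) := by
  induction c with
  | pt =>
    refine ⟨A.pt_mem, A.d_pt.trans (map_zero _).symm, ?_⟩
    exact (PtBimod.Hom.map_pt p).trans (PtBimod.Hom.map_pt f).symm
  | mk n m r c s y ih =>
    obtain ⟨h1, h2, h3, h4, h5⟩ := id hc
    have hsum : ev (liftCell p f) (∑ i, gen R S (c i) (r i) (s i)) =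
        ∑ i, PtBimod.rmul (r i • liftCell p f (c i)) (s i) := by simp
    have hmem : ∑ i, PtBimod.rmul (r i • liftCell p f (c i)) (s i) ∈ gr k (n + 1) := by
      refine Submodule.sum_mem _ fun i _ => ?_
      obtain ⟨p', q, hr, hs, hn⟩ := h2 i
      rw [← hn]
      exact PtBimod.rmul_mem (A.lsmul_mem hr (ih i (h1 i)).1) hs
    have hd : d k (∑ i, PtBimod.rmul (r i • liftCell p f (c i)) (s i)) = 0 := by
      have hD : ev (liftCell p f) (D deg bd (∑ i, gen R S (c i) (r i) (s i))) =
          d k (ev (liftCell p f) (∑ i, gen R S (c i) (r i) (s i))) := by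
        simp only [map_sum (D deg bd), map_sum (ev _), map_sum (d k)]
        exact Finset.sum_congr rfl fun i _ =>
          ev_D_gen (ih i (h1 i)).1 (ih i (h1 i)).2.1 (r i) (s i)
      rw [← hsum, ← hD, h4, map_zero]
    have hdf : d k (PtBimod.Hom.toLinearMap f ((data Y).cell ⟨_, hc⟩)) =
        PtBimod.Hom.toLinearMap p (∑ i, PtBimod.rmul (r i • liftCell p f (c i)) (s i)) := by
      refine (SemifreeData.d_hom_cell f ⟨_, hc⟩).trans ?_
      change ev (fun c : {c : Cell Y // c.Valid} => PtBimod.Hom.toLinearMap f ((data Y).cell c))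
        (∑ i, gen R S ⟨c i, h1 i⟩ (r i) (s i)) = PtBimod.Hom.toLinearMap p _
      rw [← hsum, hom_ev]
      simp only [map_sum, ev_gen]
      exact Finset.sum_congr rfl fun i _ =>
        congrArg (fun b => PtBimod.rmul (r i • b) (s i)) (ih i (h1 i)).2.2.symm
    have hex : ∃ a ∈ gr k n, d k a = ∑ i, PtBimod.rmul (r i • liftCell p f (c i)) (s i) ∧
        ∃ hv : (mk n m r c s y).Valid,
          PtBimod.Hom.toLinearMap p a = PtBimod.Hom.toLinearMap f ((data Y).cell ⟨_, hv⟩) := by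
      obtain ⟨a, ha, hda, hpa⟩ := DGHom.exists_lift (f := PtBimod.Hom.toDGHom p) hp hp' hmem hd
        (PtBimod.Hom.map_mem f ((data Y).cell_mem ⟨_, hc⟩)) hdf
      exact ⟨a, ha, hda, hc, hpa⟩
    have hl : liftCell p f (mk n m r c s y) = hex.choose := by
      rw [liftCell, dif_pos hex]
    obtain ⟨ha, hda, _, hpa⟩ := hex.choose_spec
    rw [← hl] at ha hda hpa
    exact ⟨ha, hda.trans hsum.symm, hpa⟩

end Lift

variable (Y) in
/-- The values chosen on the cells define a lift along any trivial fibration. -/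
lemma data_cofibrant : (data Y).bimod.Cofibrant := by
  intro A B p hp hp' f
  have h := liftCell_spec f hp hp'
  refine ⟨SemifreeData.desc (fun c => liftCell p f c.1) (fun c => (h c.1 c.2).1) 
    (fun c => (h c.1 c.2).2.1.trans (ev_bdValid _ c)) rfl, SemifreeData.hom_ext fun c => ?_⟩
  refine Eq.trans (congrArg (PtBimod.Hom.toLinearMap p)
      (ev_gen (fun c : (data Y).E => liftCell p f c.1) c 1 1)) ?_
  rw [one_smul, PtBimod.rmul_one]
  exact (h c.1 c.2).2.2

end Cell

open Cell

variable (R S) in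
/-- The functorial resolution. -/
def resolution : PtBimod R S ⥤ PtBimod R S where
  obj Y := (data Y).bimod
  map f := dataMap f
  map_id Y := SemifreeData.hom_ext fun c => (dataMap_cell (𝟙 Y) c).trans
    (congrArg (data Y).cell (Subtype.ext (map_id_apply c.1)))
  map_comp {Y Z V} f g := SemifreeData.hom_ext fun c => by
    refine (dataMap_cell (f ≫ g) c).trans ?_
    have e : (⟨c.1.map (f ≫ g), c.2.map _⟩ : {c : Cell V // c.Valid}) =
        ⟨(c.1.map f).map g, (c.2.map f).map g⟩ := Subtype.ext (map_comp_apply f g c.1)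
    refine (congrArg (data V).cell e).trans ?_
    refine (dataMap_cell g ⟨c.1.map f, c.2.map f⟩).symm.trans ?_
    exact congrArg (PtBimod.Hom.toLinearMap (dataMap g)) (dataMap_cell f c).symm

variable (R S) in
/-- The augmentation of the functorial resolution. -/
def resolutionProj : resolution R S ⟶ 𝟭 (PtBimod R S) where
  app Y := augmentation Y
  naturality {Y Z} f := SemifreeData.hom_ext fun c => by
    refine (congrArg (PtBimod.Hom.toLinearMap (augmentation Z)) (dataMap_cell f c)).trans ?_
    refine (augmentation_cell (Y := Z) ⟨c.1.map f, c.2.map f⟩).trans ?_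
    refine (val_map f c.1).trans ?_
    exact congrArg (PtBimod.Hom.toLinearMap f) (augmentation_cell c).symm

end Resolution

/-! ### Left derived functors from functorial resolutions -/

section Derived

universe v₁ v₂ v₃ u₁ u₂ u₃

variable {C : Type u₁} {D : Type u₂} {H : Type u₃} [Category.{v₁} C] [Category.{v₂} D]
  [Category.{v₃} H] {L : C ⥤ D} {W : MorphismProperty C} [L.IsLocalization W] {G : C ⥤ H}
  {Q : C ⥤ C} (p : Q ⟶ 𝟭 C)

/-- A natural transformation `L ⋙ E ⟶ G` factors through the value of `G` on a functorial
resolution: invert `E.map (L.map (p.app X))` and evaluate the transformation at `Q.obj X`. -/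
lemma exists_fac_of_resolution (hp : ∀ X, W (p.app X)) {LG : D ⥤ H} (e : L ⋙ LG ≅ Q ⋙ G)
    {E : D ⥤ H} (β : L ⋙ E ⟶ G) :
    ∃ γ : E ⟶ LG, Functor.whiskerLeft L γ ≫ e.hom ≫ Functor.whiskerRight p G = β := by
  have hL : ∀ X, IsIso (L.map (p.app X)) := fun X => Localization.inverts L W _ (hp X)
  let pL : Q ⋙ L ⟶ L := Functor.whiskerRight p L
  have : ∀ X, IsIso (pL.app X) := hL
  have : IsIso pL := NatIso.isIso_of_isIso_app _
  let : Localization.Lifting L W (L ⋙ LG) LG := ⟨Iso.refl _⟩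
  let : Localization.Lifting L W (L ⋙ E) E := ⟨Iso.refl _⟩
  let τ : L ⋙ E ⟶ L ⋙ LG :=
    Functor.whiskerRight (inv pL) E ≫ Functor.whiskerLeft Q β ≫ e.inv
  refine ⟨Localization.liftNatTrans L W _ _ E LG τ, ?_⟩
  ext X
  have h : E.map (L.map (p.app X)) ≫ β.app X = β.app (Q.obj X) ≫ G.map (p.app X) :=
    β.naturality (p.app X)
  have h' : E.map ((inv pL).app X) ≫ E.map (L.map (p.app X)) = 𝟙 _ := by
    rw [← E.map_comp, ← E.map_id]
    exact congrArg (fun τ => E.map (NatTrans.app τ X)) (IsIso.inv_hom_id pL)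
  have hτ : (Localization.liftNatTrans L W _ _ E LG τ).app (L.obj X) = τ.app X :=
    (Localization.liftNatTrans_app L W _ _ E LG τ X).trans
      ((Category.id_comp _).trans (Category.comp_id _))
  simp only [NatTrans.comp_app, Functor.whiskerLeft_app, Functor.whiskerRight_app, hτ]
  simp only [τ, NatTrans.comp_app, Functor.whiskerLeft_app, Functor.whiskerRight_app,
    Category.assoc]
  rw [Iso.inv_hom_id_app_assoc]
  refine (congrArg (E.map ((inv pL).app X) ≫ ·) h.symm).trans ?_
  rw [← Category.assoc, h']
  exact Category.id_comp _

/-- The factorization through the value of `G` on a functorial resolution is unique if `G` inverts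
`p : Q (Q X) ⟶ Q X`. -/
lemma fac_unique_of_resolution (hp : ∀ X, W (p.app X)) (hG : ∀ X, IsIso (G.map (p.app (Q.obj X))))
    {LG : D ⥤ H} (e : L ⋙ LG ≅ Q ⋙ G) {E : D ⥤ H} {γ γ' : E ⟶ LG}
    (h : Functor.whiskerLeft L γ ≫ e.hom ≫ Functor.whiskerRight p G =
      Functor.whiskerLeft L γ' ≫ e.hom ≫ Functor.whiskerRight p G) : γ = γ' := by
  refine Localization.natTrans_ext L W fun X => ?_
  have hL : IsIso (L.map (p.app X)) := Localization.inverts L W _ (hp X)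
  have hX : γ.app (L.obj (Q.obj X)) = γ'.app (L.obj (Q.obj X)) := by
    have h' : γ.app (L.obj (Q.obj X)) ≫ e.hom.app (Q.obj X) ≫ G.map (p.app (Q.obj X)) =
        γ'.app (L.obj (Q.obj X)) ≫ e.hom.app (Q.obj X) ≫ G.map (p.app (Q.obj X)) :=
      congrArg (fun τ => NatTrans.app τ (Q.obj X)) h
    have := hG X
    exact (cancel_mono (e.hom.app (Q.obj X) ≫ G.map (p.app (Q.obj X)))).1 h'
  -- by naturality along the isomorphism `L.map (p.app X)` it suffices to compare at `Q.obj X`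
  rw [← cancel_epi (E.map (L.map (p.app X)))]
  exact (γ.naturality _).trans ((congrArg (· ≫ LG.map (L.map (p.app X))) hX).trans
    (γ'.naturality _).symm)

/-- The value of `G` on a functorial resolution `Q`, with the counit to `G`, is a left derived
functor of `G` as soon as `G` inverts `p : Q (Q X) ⟶ Q X`. -/
lemma isLeftDerivedFunctor_of_resolution (hp : ∀ X, W (p.app X))
    (hG : ∀ X, IsIso (G.map (p.app (Q.obj X)))) (LG : D ⥤ H) (e : L ⋙ LG ≅ Q ⋙ G) :
    LG.IsLeftDerivedFunctor (e.hom ≫ Functor.whiskerRight p G) W :=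
  ⟨⟨⟨Limits.IsTerminal.ofUniqueHom
    (fun E => CostructuredArrow.homMk (exists_fac_of_resolution p hp e E.hom).choose
      (exists_fac_of_resolution p hp e E.hom).choose_spec)
    (fun E m => CostructuredArrow.hom_ext _ _ (fac_unique_of_resolution p hp hG e
      ((CostructuredArrow.w m).trans
        (exists_fac_of_resolution p hp e E.hom).choose_spec.symm)))⟩⟩⟩

end Derived

/-! ### The left derived functor of `F` -/

section DerivedF

variable {k : Type u} [CommRing k] {R S : DGAlg k}

lemma resolution_cofibrant (X : PtBimod R S) : ((resolution R S).obj X).Cofibrant :=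
  Cell.data_cofibrant X

lemma resolutionProj_quasiIso (X : PtBimod R S) :
    PtBimod.quasiIso R S ((resolutionProj R S).app X) := Cell.augmentation_quasiIso X

lemma resolution_map_quasiIso {X Y : PtBimod R S} {f : X ⟶ Y} (hf : PtBimod.quasiIso R S f) :
    PtBimod.quasiIso R S ((resolution R S).map f) := by
  have h := (resolutionProj R S).naturality f
  have hc : PtBimod.quasiIso R S ((resolutionProj R S).app X ≫ f) :=
    DGHom.IsQuasiIso.comp_of_eq (resolutionProj_quasiIso X) hf fun _ => rfl
  rw [Functor.id_map] at h
  rw [← h] at hc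
  exact DGHom.IsQuasiIso.of_comp_left hc (resolutionProj_quasiIso Y) fun _ => rfl

/-- The resolution of a distinguished bimodule is distinguished. -/
lemma resolution_distinguished {X : PtBimod R S} (hX : PtBimod.distinguished R S X) :
    PtBimod.distinguished R S ((resolution R S).obj X) :=
  DGHom.IsQuasiIso.of_comp_left hX (resolutionProj_quasiIso X) fun s => by
    change PtBimod.rmul X.pt s = PtBimod.Hom.toLinearMap ((resolutionProj R S).app X)
      (PtBimod.rmul ((resolution R S).obj X).pt s)
    rw [PtBimod.Hom.map_rmul, PtBimod.Hom.map_pt]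
    rfl

lemma isIso_Q_F_map {X Y : PtBimod R S} (hX : X.Cofibrant) (hY : Y.Cofibrant) {f : Y ⟶ X}
    (hf : PtBimod.quasiIso R S f) :
    IsIso ((F R S ⋙ (AlgUnder.quasiIso R S).Q).map f) :=
  Localization.inverts (AlgUnder.quasiIso R S).Q (AlgUnder.quasiIso R S) _
    (F_quasiIso hX hY f hf)

lemma isInvertedBy_resolution_F : (PtBimod.quasiIso R S).IsInvertedBy
    (resolution R S ⋙ F R S ⋙ (AlgUnder.quasiIso R S).Q) := fun X Y _ hf =>
  isIso_Q_F_map (resolution_cofibrant Y) (resolution_cofibrant X) (resolution_map_quasiIso hf)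

variable (R S) in
/-- The total left derived functor of `F`, given by the values of `F` on the resolutions. -/
def leftDerivedF :
    (PtBimod.quasiIso R S).Localization ⥤ (AlgUnder.quasiIso R S).Localization :=
  Localization.lift _ isInvertedBy_resolution_F (PtBimod.quasiIso R S).Q

variable (R S) in
/-- On bimodules the derived functor is the value of `F` on the resolution. -/
def leftDerivedFIso : (PtBimod.quasiIso R S).Q ⋙ leftDerivedF R S ≅
    resolution R S ⋙ F R S ⋙ (AlgUnder.quasiIso R S).Q :=
  Localization.fac _ isInvertedBy_resolution_F _

variable (R S) in
/-- The comparison of the derived functor with `F`, induced by the augmentation. -/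
def leftDerivedFCounit : (PtBimod.quasiIso R S).Q ⋙ leftDerivedF R S ⟶
    F R S ⋙ (AlgUnder.quasiIso R S).Q :=
  (leftDerivedFIso R S).hom ≫
    Functor.whiskerRight (resolutionProj R S) (F R S ⋙ (AlgUnder.quasiIso R S).Q)

instance : (leftDerivedF R S).IsLeftDerivedFunctor (leftDerivedFCounit R S)
    (PtBimod.quasiIso R S) :=
  isLeftDerivedFunctor_of_resolution (resolutionProj R S) resolutionProj_quasiIso
    (fun _ => isIso_Q_F_map (resolution_cofibrant _) (resolution_cofibrant _)
      (resolutionProj_quasiIso _)) _ (leftDerivedFIso R S)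

end DerivedF

end DG

end

theorem mainTheorem5 {k : Type u} [CommRing k] (R S : DG.DGAlg k) (hR : R.Cofibrant)
    (hS : ∀ x : S, DG.HomotopyInvertible x → IsUnit x) :
    ((DG.F R S ⋙ (DG.AlgUnder.quasiIso R S).Q).HasLeftDerivedFunctor (DG.PtBimod.quasiIso R S)) ∧
    (∀ (LF : (DG.PtBimod.quasiIso R S).Localization ⥤ (DG.AlgUnder.quasiIso R S).Localization)
      (α : (DG.PtBimod.quasiIso R S).Q ⋙ LF ⟶ DG.F R S ⋙ (DG.AlgUnder.quasiIso R S).Q)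
      [LF.IsLeftDerivedFunctor α (DG.PtBimod.quasiIso R S)]
      (X : (DG.PtBimod.quasiIso R S).Localization),
      (DG.PtBimod.distinguished R S).map (DG.PtBimod.quasiIso R S).Q X →
        (DG.AlgUnder.distinguished R S).map (DG.AlgUnder.quasiIso R S).Q (LF.obj X)) ∧
    (∀ X : DG.PtBimod R S, X.Cofibrant → DG.PtBimod.distinguished R S X →
      ((DG.F R S).obj X).Cofibrant ∧ DG.AlgUnder.distinguished R S ((DG.F R S).obj X)) := by
  refine ⟨CategoryTheory.Functor.HasLeftDerivedFunctor.mk' (DG.leftDerivedF R S)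
      (DG.leftDerivedFCounit R S),
    fun LF α _ X hX => ?_,
    fun X hX hX' => ⟨DG.F_cofibrant hX, DG.F_distinguished hR hX hX'⟩⟩
  obtain ⟨Y, hY, ⟨e⟩⟩ := (ObjectProperty.prop_map_iff _ _ _).1 hX
  have i : LF ≅ DG.leftDerivedF R S := Functor.leftDerivedUnique _ _ α
    (DG.leftDerivedFCounit R S) (DG.PtBimod.quasiIso R S)
  exact (ObjectProperty.prop_map_iff _ _ _).2 ⟨(DG.F R S).obj ((DG.resolution R S).obj Y),
    DG.F_distinguished hR (DG.resolution_cofibrant Y) (DG.resolution_distinguished hY),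
    ⟨((DG.leftDerivedFIso R S).app Y).symm ≪≫ i.symm.app _ ≪≫ LF.mapIso e⟩⟩
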